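/- Let $d\ge 3$ and let $A,B\in\mathbb C[x,y]$ be homogeneous polynomials of degree $d$ with $\gcd(A,B)=1$; let $\mathcal H$ be the homogeneous foliation of degree $d$ on $\mathbb P^2_{\mathbb C}$ defined by $\omega=A(x,y)\,dx+B(x,y)\,dy$. Let $(p,q)$ be the affine chart of the dual plane $\check{\mathbb P}^2_{\mathbb C}$ corresponding to the line $\{y=px-q\}$. The Legendre transform $\mathrm{Leg}\,\mathcal H$ is the $d$-web given in this chart by the implicit differential equation $A(x,px-q)+p\,B(x,px-q)=0$ with $x=\frac{dq}{dp}$, that is, by the symmetric form $A(dq,\,p\,dq-q\,dp)+p\,B(dq,\,p\,dq-q\,dp)$ of degree $d$; its discriminant $\Delta(\mathrm{Leg}\,\mathcal H)$ is the set of points where this form is not a product of $d$ pairwise linearly independent linear forms. The curvature $K(\mathrm{Leg}\,\mathcal H)$ is the $2$-form given off $\Delta(\mathrm{Leg}\,\mathcal H)$ as follows: locally the web is defined by $d$ pairwise transverse holomorphic $1$-forms $\omega_1,\dots,\omega_d$ whose product is the symmetric form above, and $K=d\eta$ with $\eta=\sum_{r<s<t}\eta_{rst}$, where, writing $\omega_i\wedge\omega_j=\delta_{ij}\,dp\wedge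 dq$, $\eta_{rst}$ is the unique $1$-form such that $d(\delta_{st}\omega_r)=\eta_{rst}\wedge\delta_{st}\omega_r$, $d(\delta_{tr}\omega_s)=\eta_{rst}\wedge\delta_{tr}\omega_s$ and $d(\delta_{rs}\omega_t)=\eta_{rst}\wedge\delta_{rs}\omega_t$. It is holomorphic on a curve $D$ if it extends holomorphically near every point of $D$ outside a finite set. Let $D=\{p=p_0\}$, $p_0\in\mathbb C$, be an irreducible component of $\Delta(\mathrm{Leg}\,\mathcal H)$ (hence different from the line $\{q=0\}$ dual to the origin). Let $\underline{\mathcal G}_{\mathcal H}:\mathbb P^1_{\mathbb C}\to\mathbb P^1_{\mathbb C}$ be the map $[y:x]\mapsto[-A(x,y):B(x,y)]$, write $\underline{\mathcal G}_{\mathcal H}^{-1}([p_0:1])=\{[a_1:b_1],\dots,[a_n:b_n]\}$ with these $n$ points distinct, and let $\nu_i$ be the ramification index of $\underline{\mathcal G}_{\mathcal H}$ at $[a_i:b_i]$. Then, for every $i$, $1\le\nu_i\le d$, $(b_iy-a_ix)^{\nu_i}$ divides $A(x,y)B(b_i,a_i)-A(b_i,a_i)B(x,y)$, and the polynomials $$P_i(x,y)=\frac{A(x,y)\,B(b_i,a_i)-A(b_i,a_i)\,B(x,y)}{(b_iy-a_ix)^{\nu_i}},$$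 $$Q_i(x,y)=(\nu_i-2)\Big(\frac{\partial B}{\partial x}-\frac{\partial A}{\partial y}\Big)P_i+2(\nu_i+1)\Big(\frac{\partial P_i}{\partial x}\,B-\frac{\partial P_i}{\partial y}\,A\Big)$$ are homogeneous of degree $d-\nu_i$ and $2d-\nu_i-1$ respectively, with $P_i(b_i,a_i)\ne0$ and $B(b_i,a_i)\neq 0$. Moreover, the curvature of $\mathrm{Leg}\,\mathcal H$ is holomorphic on $D$ if and only if $$\sum_{i=1}^n\Big(1-\frac1{\nu_i}\Big)\frac{(p_0b_i-a_i)\,Q_i(b_i,a_i)}{P_i(b_i,a_i)\,B(b_i,a_i)}=0.$$ -/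

import Mathlib

open MvPolynomial

namespace HomogeneousWeb

/-! ### One-forms in two complex variables

Points of `ℂ × ℂ` have coordinates `(p, q)`. A differential `1`-form `α dp + β dq` is given by the
pair of functions `(α, β)`, and a `2`-form `k dp ∧ dq` by the function `k`. -/

/-- A `1`-form `α dp + β dq` on (a subset of) `ℂ²`. -/
abbrev OneForm := ℂ × ℂ → ℂ × ℂ

/-- `(α₁ dp + α₂ dq) ∧ (β₁ dp + β₂ dq) = wedge α β • dp ∧ dq`. -/
def wedge (α β : ℂ × ℂ) : ℂ := α.1 * β.2 - α.2 * β.1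

/-- The value of the covector `α₁ dp + α₂ dq` on the tangent vector `v = (dp, dq)`. -/
def pairing (α v : ℂ × ℂ) : ℂ := α.1 * v.1 + α.2 * v.2

/-- Exterior derivative: `d(α dp + β dq) = (∂β/∂p - ∂α/∂q) dp ∧ dq`. -/
noncomputable def extD (η : OneForm) (m : ℂ × ℂ) : ℂ :=
  fderiv ℂ (fun z => (η z).2) m (1, 0) - fderiv ℂ (fun z => (η z).1) m (0, 1)

/-! ### Webs, discriminant, fundamental form, curvature -/

/-- A symmetric form on `ℂ²`, given through its values `F m v` on tangent vectors `v` at `m`.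
For a symmetric form of degree `d`, `F m` is a binary form of degree `d`; it defines a `d`-web. -/
abbrev SymForm := ℂ × ℂ → ℂ × ℂ → ℂ

/-- The support of the discriminant of the `d`-web given by `F`: the points at which `F` does not
factor as a product of `d` pairwise linearly independent linear forms. -/
def discriminantLocus (d : ℕ) (F : SymForm) : Set (ℂ × ℂ) :=
  {m | ¬ ∃ l : Fin d → ℂ × ℂ,
      (∀ i j, i ≠ j → wedge (l i) (l j) ≠ 0) ∧ ∀ v, F m v = ∏ i, pairing (l i) v}

/-- On the set `U`, the web given by `F` is the superposition of the `d` pairwise transverse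
holomorphic foliations defined by the `1`-forms `ω 0, …, ω (d - 1)`. -/
structure IsDecomposition (d : ℕ) (F : SymForm) (U : Set (ℂ × ℂ)) (ω : Fin d → OneForm) :
    Prop where
  analytic : ∀ i, AnalyticOnNhd ℂ (ω i) U
  transverse : ∀ z ∈ U, ∀ i j, i ≠ j → wedge (ω i z) (ω j z) ≠ 0
  factor : ∀ z ∈ U, ∀ v, F z v = ∏ i, pairing (ω i z) v

/-- The equations that characterize the fundamental form `η` of the `3`-web given by the `1`-forms
`ω₁, ω₂, ω₃` on an open set `U`: with `ωᵢ ∧ ωⱼ = δᵢⱼ dp ∧ dq`,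
`d(δ₂₃ ω₁) = η ∧ δ₂₃ ω₁`, `d(δ₃₁ ω₂) = η ∧ δ₃₁ ω₂`, `d(δ₁₂ ω₃) = η ∧ δ₁₂ ω₃`. -/
def IsTripleForm (U : Set (ℂ × ℂ)) (ω₁ ω₂ ω₃ η : OneForm) : Prop :=
  ∀ z ∈ U,
    extD (fun w => wedge (ω₂ w) (ω₃ w) • ω₁ w) z
        = wedge (η z) (wedge (ω₂ z) (ω₃ z) • ω₁ z) ∧
    extD (fun w => wedge (ω₃ w) (ω₁ w) • ω₂ w) z
        = wedge (η z) (wedge (ω₃ z) (ω₁ z) • ω₂ z) ∧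
    extD (fun w => wedge (ω₁ w) (ω₂ w) • ω₃ w) z
        = wedge (η z) (wedge (ω₁ z) (ω₂ z) • ω₃ z)

/-- `η` is, on the open set `U`, the fundamental form of the completely decomposable web given by
the `1`-forms `ω 0, …, ω (d - 1)`: the sum over `r < s < t` of the fundamental forms of the
`3`-subwebs `ω r, ω s, ω t`. -/
def IsFundamentalForm (d : ℕ) (U : Set (ℂ × ℂ)) (ω : Fin d → OneForm) (η : OneForm) : Prop :=
  ∃ θ : Fin d → Fin d → Fin d → OneForm,
    (∀ r s t, r < s → s < t → IsTripleForm U (ω r) (ω s) (ω t) (θ r s t)) ∧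
    ∀ z ∈ U, η z = ∑ r, ∑ s ∈ Finset.Ioi r, ∑ t ∈ Finset.Ioi s, θ r s t z

/-- The curvature `K = dη` of the `d`-web given by `F` takes the value `k dp ∧ dq` at the point `m`
(a point outside the discriminant, where the web is locally completely decomposable). -/
def IsCurvatureAt (d : ℕ) (F : SymForm) (m : ℂ × ℂ) (k : ℂ) : Prop :=
  ∃ U : Set (ℂ × ℂ), IsOpen U ∧ m ∈ U ∧
    ∃ (ω : Fin d → OneForm) (η : OneForm),
      IsDecomposition d F U ω ∧ IsFundamentalForm d U ω η ∧ k = extD η m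

/-- Near `m`, the curvature, defined outside the discriminant, is the restriction of a
holomorphic `2`-form `g dp ∧ dq`. -/
def CurvatureHolomorphicAt (d : ℕ) (F : SymForm) (m : ℂ × ℂ) : Prop :=
  ∃ N : Set (ℂ × ℂ), IsOpen N ∧ m ∈ N ∧
    ∃ g : ℂ × ℂ → ℂ, AnalyticOnNhd ℂ g N ∧
      ∀ z ∈ N \ discriminantLocus d F, IsCurvatureAt d F z (g z)

/-- The curvature is holomorphic along the algebraic curve `D`: it is holomorphic at the generic
points of `D`, that is, at all but finitely many points of `D`. -/
def CurvatureHolomorphicAlong (d : ℕ) (F : SymForm) (D : Set (ℂ × ℂ)) : Prop :=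
  {m ∈ D | ¬ CurvatureHolomorphicAt d F m}.Finite

/-! ### Legendre transform of a homogeneous foliation

In `MvPolynomial (Fin 2) ℂ` the variables are `x = X 0` and `y = X 1`. -/

/-- The Legendre transform of the foliation defined by `A dx + B dy`, in the affine chart `(p, q)`
of the dual plane that corresponds to the line `{y = p x - q}`. The implicit differential equation
`A(x, p x - q) + p B(x, p x - q) = 0`, `x = dq / dp`, is written as the symmetric form of degree `d`
`A(dq, p dq - q dp) + p B(dq, p dq - q dp)` (where `A`, `B` are homogeneous of degree `d`). -/
noncomputable def legForm (A B : MvPolynomial (Fin 2) ℂ) : SymForm := fun m v =>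
  eval ![v.2, m.1 * v.2 - m.2 * v.1] A + m.1 * eval ![v.2, m.1 * v.2 - m.2 * v.1] B

/-! ### The projective line and ramification -/

/-- The complex projective line. -/
abbrev P1 := Projectivization ℂ (Fin 2 → ℂ)

lemma vec_left_ne (t : ℂ) : ![t, (1 : ℂ)] ≠ 0 := fun h => by simpa using congrFun h 1

lemma vec_right_ne (t : ℂ) : ![(1 : ℂ), t] ≠ 0 := fun h => by simpa using congrFun h 0

/-- The point `[t : 1]`. -/
noncomputable def P1.ofAffine (t : ℂ) : P1 := Projectivization.mk ℂ ![t, 1] (vec_left_ne t)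

open Classical in
/-- The inverse of the standard affine chart around `P`: `t ↦ [t : 1]` unless `P = [1 : 0]`, and
`t ↦ [1 : t]` for `P = [1 : 0]`. -/
noncomputable def P1.param (P : P1) (t : ℂ) : P1 :=
  if P.rep 1 = 0 then Projectivization.mk ℂ ![1, t] (vec_right_ne t) else P1.ofAffine t

open Classical in
/-- The standard affine coordinate around `P`, evaluated at `R`: `[a : b] ↦ a / b` unless
`P = [1 : 0]`, and `[a : b] ↦ b / a` for `P = [1 : 0]`. -/
noncomputable def P1.coord (P R : P1) : ℂ :=
  if P.rep 1 = 0 then R.rep 1 / R.rep 0 else R.rep 0 / R.rep 1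

/-- The ramification index at `P` of a nonconstant holomorphic map `f : ℙ¹ → ℙ¹`: the order of
vanishing at `P` of `f - f P`, in affine coordinates around `P` and `f P`. -/
noncomputable def ramificationIndex (f : P1 → P1) (P : P1) : ℕ :=
  analyticOrderNatAt
    (fun t => P1.coord (f P) (f (P1.param P t)) - P1.coord (f P) (f P)) (P1.coord P P)

open Classical in
/-- The map `[y : x] ↦ [-A(x, y) : B(x, y)]` associated to the foliation `A dx + B dy`; here `A`
and `B` are homogeneous of the same degree without common factor, so that they have no common zero
and the second branch is never used. -/
noncomputable def gMap (A B : MvPolynomial (Fin 2) ℂ) (P : P1) : P1 :=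
  if h : ![-eval ![P.rep 1, P.rep 0] A, eval ![P.rep 1, P.rep 0] B] ≠ 0 then
    Projectivization.mk ℂ _ h
  else P

/-! ### The polynomials of the criterion -/

/-- The determinant `A(x, y) B(b, a) - A(b, a) B(x, y)`. -/
noncomputable def numP (A B : MvPolynomial (Fin 2) ℂ) (a b : ℂ) : MvPolynomial (Fin 2) ℂ :=
  Matrix.det !![A, C (eval ![b, a] A); B, C (eval ![b, a] B)]

/-- The linear form `b y - a x`. -/
noncomputable def lineForm (a b : ℂ) : MvPolynomial (Fin 2) ℂ := C b * X 1 - C a * X 0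

open Classical in
/-- The quotient of `A(x, y) B(b, a) - A(b, a) B(x, y)` by `(b y - a x) ^ ν`
(with value `0` if the division is not exact). -/
noncomputable def polyP (A B : MvPolynomial (Fin 2) ℂ) (a b : ℂ) (ν : ℕ) :
    MvPolynomial (Fin 2) ℂ :=
  if h : lineForm a b ^ ν ∣ numP A B a b then h.choose else 0

/-- `(ν - 2) (∂B/∂x - ∂A/∂y) P + 2 (ν + 1) det (∂P/∂x, A; ∂P/∂y, B)`. -/
noncomputable def polyQ (A B : MvPolynomial (Fin 2) ℂ) (a b : ℂ) (ν : ℕ) :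
    MvPolynomial (Fin 2) ℂ :=
  C ((ν : ℂ) - 2) * (pderiv 0 B - pderiv 1 A) * polyP A B a b ν +
    C (2 * ((ν : ℂ) + 1)) *
      Matrix.det !![pderiv 0 (polyP A B a b ν), A; pderiv 1 (polyP A B a b ν), B]

end HomogeneousWeb

/-!
Near the line `p = p₀` the web is given by the roots `t` of `f = 𝓐 + p 𝓑`, where `𝓐` and `𝓑` are `A`
and `B` in an affine coordinate of `ℙ¹` that is finite on the fibre over `p₀`. Because the web is
invariant under the homotheties `q ↦ c q`, its fundamental form is `E(p) dp + H(p) dq / q`, so that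
the curvature is `H'(p) / q dp ∧ dq`. Up to a constant, `-H(p) dp` is the trace of a meromorphic
differential `R dt` along the map `t ↦ p = -𝓐(t) / 𝓑(t)`. Above `p₀`, `R dt` has at most double
poles, located at the points of the fibre, and only their residues contribute to a pole of the
trace: `H` has at most a simple pole at `p₀`, whose residue is minus the sum of the residues of
`R dt` over the fibre. Hence the curvature extends across `p = p₀` if and only if this sum vanishes,
and the residue at `[a_i : b_i]` is one sixth of the `i`-th term of the criterion.
-/

namespace HomogeneousWeb

/-! ### Binary forms -/

section BinaryForms

variable {A B G : MvPolynomial (Fin 2) ℂ} {d : ℕ} {a b : ℂ}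

lemma aeval_smul_of_isHomogeneous {σ R S : Type*} [CommSemiring R] [CommSemiring S] [Algebra R S]
    {G : MvPolynomial σ R} (hG : G.IsHomogeneous d) (c : S) (f : σ → S) :
    aeval (c • f) G = c ^ d * aeval f G := by
  simp only [aeval_def, eval₂_eq, Finset.mul_sum]
  refine Finset.sum_congr rfl fun m hm => ?_
  simp only [hG.degree_eq_sum_deg_support hm, Pi.smul_apply, smul_eq_mul, mul_pow,
    Finset.prod_mul_distrib, Finset.prod_pow_eq_pow_sum]
  ring

lemma eval_smul_of_isHomogeneous (hG : G.IsHomogeneous d) (c x y : ℂ) :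
    eval ![c * x, c * y] G = c ^ d * eval ![x, y] G := by
  simpa [aeval_eq_eval] using aeval_smul_of_isHomogeneous hG c ![x, y]

lemma eval_lineForm (a b x y : ℂ) : eval ![x, y] (lineForm a b) = b * y - a * x := by
  simp [lineForm]

lemma isHomogeneous_lineForm (a b : ℂ) : (lineForm a b).IsHomogeneous 1 :=
  (isHomogeneous_C_mul_X _ _).sub (isHomogeneous_C_mul_X _ _)

lemma lineForm_ne_zero (hab : ![a, b] ≠ 0) : lineForm a b ≠ 0 := by
  refine fun h => hab ?_
  have ha := eval_lineForm a b 1 0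
  have hb := eval_lineForm a b 0 1
  simp only [h, map_zero, mul_zero, mul_one, zero_sub, sub_zero, zero_eq_neg] at ha hb
  rw [ha, ← hb, Matrix.cons_eq_zero_iff]
  simp

lemma lineForm_dvd_of_eval_eq_zero (hG : G.IsHomogeneous d) (hab : ![a, b] ≠ 0)
    (h : eval ![b, a] G = 0) : lineForm a b ∣ G := by
  set v : Fin 2 → ℂ := ![b, a]
  set π := Ideal.Quotient.mkₐ ℂ (Ideal.span {lineForm a b})
  have hπ (F : MvPolynomial (Fin 2) ℂ) : π F = 0 ↔ lineForm a b ∣ F := by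
    rw [← Ideal.mem_span_singleton]
    exact Ideal.Quotient.eq_zero_iff_mem
  obtain ⟨i, hi⟩ : ∃ i, v i ≠ 0 := by
    by_contra! hv
    exact hab (by rw [show a = 0 from hv 1, show b = 0 from hv 0]; simp)
  -- Modulo `b y - a x`, the vectors `(x, y)` and `(b, a)` are proportional.
  have hprop (j : Fin 2) : π (C (v i) * X j) = π (X i * C (v j)) := by
    rw [← sub_eq_zero, ← map_sub, hπ, lineForm]
    fin_cases i <;> fin_cases j
    · exact ⟨0, show C b * X 0 - X 0 * C b = _ by ring⟩
    · exact ⟨1, show C b * X 1 - X 0 * C a = _ by ring⟩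
    · exact ⟨-1, show C a * X 0 - X 1 * C b = _ by ring⟩
    · exact ⟨0, show C a * X 1 - X 1 * C a = _ by ring⟩
  have hmul : π (C (v i) ^ d * G) = 0 := calc
    π (C (v i) ^ d * G) = π (aeval (C (v i) • X) G) := by
      rw [aeval_smul_of_isHomogeneous hG, aeval_X_left_apply]
    _ = π (aeval ((X i : MvPolynomial (Fin 2) ℂ) • fun j => C (v j)) G) := by
      simp only [comp_aeval_apply, Pi.smul_apply, smul_eq_mul, hprop]
    _ = π (X i ^ d * C (eval v G)) := by
      rw [aeval_smul_of_isHomogeneous hG]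
      congr 2
      exact aeval_algebraMap_apply _ _ _
    _ = 0 := by rw [h, C_0, mul_zero, map_zero]
  exact (((isUnit_iff_ne_zero.2 hi).map C).pow d).dvd_mul_left.1 ((hπ _).1 hmul)

lemma isHomogeneous_of_mul_left {σ R : Type*} [CommRing R] [IsDomain R] {L P : MvPolynomial σ R}
    {k m : ℕ} (hL : L.IsHomogeneous k) (hL0 : L ≠ 0) (h : (L * P).IsHomogeneous (k + m)) :
    P.IsHomogeneous m := by
  let _ : GradedAlgebra (homogeneousSubmodule σ R) := MvPolynomial.gradedAlgebra
  have hdecomp := DirectSum.coe_decompose_mul_add_of_left_mem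
    (𝒜 := homogeneousSubmodule σ R) (i := k) (j := m) (b := P) hL
  rw [DirectSum.decompose_of_mem_same _ h] at hdecomp
  rw [mul_left_cancel₀ hL0 hdecomp]
  exact (DirectSum.decompose (homogeneousSubmodule σ R) P m).2

lemma exists_eq_lineForm_pow_mul (hG : G.IsHomogeneous d) (hG0 : G ≠ 0) (hab : ![a, b] ≠ 0) :
    ∃ m ≤ d, ∃ P : MvPolynomial (Fin 2) ℂ, P.IsHomogeneous (d - m) ∧
      G = lineForm a b ^ m * P ∧ eval ![b, a] P ≠ 0 := by
  induction d generalizing G with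
  | zero =>
    refine ⟨0, le_rfl, G, hG, by simp, fun h => hG0 ?_⟩
    rw [← totalDegree_zero_iff_isHomogeneous, totalDegree_eq_zero_iff_eq_C] at hG
    rw [hG, eval_C] at h
    rw [hG, h, C_0]
  | succ d ih =>
    by_cases h : eval ![b, a] G = 0
    · obtain ⟨G', rfl⟩ := lineForm_dvd_of_eval_eq_zero hG hab h
      have hG' : G'.IsHomogeneous d :=
        isHomogeneous_of_mul_left (isHomogeneous_lineForm a b) (lineForm_ne_zero hab)
          (by rwa [add_comm])
      obtain ⟨m, hm, P, hP, rfl, hP0⟩ := ih hG' (right_ne_zero_of_mul hG0)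
      exact ⟨m + 1, by omega, P, by simpa using hP, by ring, hP0⟩
    · exact ⟨0, by omega, G, hG, by simp, h⟩

lemma eval_ne_zero_or_eval_ne_zero (hA : A.IsHomogeneous d) (hB : B.IsHomogeneous d)
    (hAB : IsRelPrime A B) (hab : ![a, b] ≠ 0) : eval ![b, a] A ≠ 0 ∨ eval ![b, a] B ≠ 0 := by
  by_contra! h
  have hunit := hAB (lineForm_dvd_of_eval_eq_zero hA hab h.1)
    (lineForm_dvd_of_eval_eq_zero hB hab h.2)
  have hval := hunit.map (eval ![b, a])
  rw [eval_lineForm] at hval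
  exact hval.ne_zero (by ring)

lemma add_C_mul_ne_zero (hd : d ≠ 0) (hB : B.IsHomogeneous d) (hAB : IsRelPrime A B) (p : ℂ) :
    A + C p * B ≠ 0 := by
  intro h
  have hBA : B ∣ A := by
    rw [eq_neg_of_add_eq_zero_left h]
    exact (Dvd.intro_left _ rfl).neg_right
  have hB0 : eval ![0, 0] B = 0 := by
    simpa [hd] using eval_smul_of_isHomogeneous hB 0 0 0
  exact ((hAB hBA dvd_rfl).map (eval ![0, 0])).ne_zero hB0

end BinaryForms

/-! ### Ramification of the map `gMap` -/

section Ramification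

variable {A B P : MvPolynomial (Fin 2) ℂ} {d : ℕ} {a b p : ℂ}

lemma exists_rep_eq_smul {K ι : Type*} [Field K] (v : ι → K) (hv : v ≠ 0) :
    ∃ c : K, c ≠ 0 ∧ (Projectivization.mk K v hv).rep = c • v := by
  obtain ⟨c, hc⟩ := Projectivization.exists_smul_eq_mk_rep K v hv
  exact ⟨c, c.ne_zero, hc.symm⟩

open Classical in
lemma P1.coord_mk (u v : Fin 2 → ℂ) (hu : u ≠ 0) (hv : v ≠ 0) :
    P1.coord (Projectivization.mk ℂ u hu) (Projectivization.mk ℂ v hv) =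
      if u 1 = 0 then v 1 / v 0 else v 0 / v 1 := by
  obtain ⟨c, hc, hcu⟩ := exists_rep_eq_smul u hu
  obtain ⟨k, hk, hkv⟩ := exists_rep_eq_smul v hv
  simp only [P1.coord, hcu, hkv, Pi.smul_apply, smul_eq_mul, mul_eq_zero, hc, false_or,
    mul_div_mul_left _ _ hk]

open Classical in
lemma P1.param_mk (u : Fin 2 → ℂ) (hu : u ≠ 0) (t : ℂ) :
    P1.param (Projectivization.mk ℂ u hu) t =
      if u 1 = 0 then Projectivization.mk ℂ ![1, t] (vec_right_ne t) else P1.ofAffine t := by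
  obtain ⟨c, hc, hcu⟩ := exists_rep_eq_smul u hu
  simp only [P1.param, hcu, Pi.smul_apply, smul_eq_mul, mul_eq_zero, hc, false_or]

lemma gMap_vec_ne (hA : A.IsHomogeneous d) (hB : B.IsHomogeneous d) (hAB : IsRelPrime A B)
    (hab : ![a, b] ≠ 0) : ![-eval ![b, a] A, eval ![b, a] B] ≠ 0 := by
  intro h
  rcases eval_ne_zero_or_eval_ne_zero hA hB hAB hab with hA0 | hB0
  · exact hA0 (neg_eq_zero.1 (congrFun h 0))
  · exact hB0 (congrFun h 1)

lemma gMap_mk (hA : A.IsHomogeneous d) (hB : B.IsHomogeneous d) (hAB : IsRelPrime A B)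
    (hab : ![a, b] ≠ 0) :
    gMap A B (Projectivization.mk ℂ ![a, b] hab) =
      Projectivization.mk ℂ ![-eval ![b, a] A, eval ![b, a] B] (gMap_vec_ne hA hB hAB hab) := by
  obtain ⟨c, hc, hrep⟩ := exists_rep_eq_smul ![a, b] hab
  set v : Fin 2 → ℂ := ![-eval ![b, a] A, eval ![b, a] B]
  have hscale : ![-eval ![c * b, c * a] A, eval ![c * b, c * a] B] = c ^ d • v := by
    simp [v, eval_smul_of_isHomogeneous hA, eval_smul_of_isHomogeneous hB]
  have hne : c ^ d • v ≠ 0 := smul_ne_zero (pow_ne_zero _ hc) (gMap_vec_ne hA hB hAB hab)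
  simp only [gMap, hrep, Pi.smul_apply, Matrix.cons_val_zero, Matrix.cons_val_one, smul_eq_mul,
    hscale]
  rw [dif_pos hne, Projectivization.mk_eq_mk_iff']
  exact ⟨c ^ d, rfl⟩

lemma gMap_mk_eq_ofAffine_iff (hA : A.IsHomogeneous d) (hB : B.IsHomogeneous d)
    (hAB : IsRelPrime A B) (hab : ![a, b] ≠ 0) :
    gMap A B (Projectivization.mk ℂ ![a, b] hab) = P1.ofAffine p ↔
      eval ![b, a] (A + C p * B) = 0 := by
  rw [gMap_mk hA hB hAB hab, P1.ofAffine, Projectivization.mk_eq_mk_iff']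
  simp only [map_add, map_mul, eval_C, Matrix.smul_cons, smul_eq_mul, mul_one,
    Matrix.smul_empty, Matrix.vecCons_inj, and_true, exists_eq_right]
  rw [mul_comm, eq_neg_iff_add_eq_zero, add_comm]

lemma coord_ofAffine_gMap_mk (hA : A.IsHomogeneous d) (hB : B.IsHomogeneous d)
    (hAB : IsRelPrime A B) (hab : ![a, b] ≠ 0) (p : ℂ) :
    P1.coord (P1.ofAffine p) (gMap A B (Projectivization.mk ℂ ![a, b] hab)) =
      -eval ![b, a] A / eval ![b, a] B := by
  simp [gMap_mk hA hB hAB, P1.ofAffine, P1.coord_mk]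

lemma analyticOrderNatAt_slope {f g : ℂ → ℂ} {t₀ c : ℂ} {m : ℕ}
    (hf : AnalyticAt ℂ f t₀) (hg : AnalyticAt ℂ g t₀) (hc : c ≠ 0)
    (hline : ∀ t, b * g t - a * f t = c * (t - t₀))
    (hP : A + C p * B = lineForm a b ^ m * P) (hP0 : eval ![f t₀, g t₀] P ≠ 0)
    (hB0 : eval ![f t₀, g t₀] B ≠ 0) :
    analyticOrderNatAt (fun t => -eval ![f t, g t] A / eval ![f t, g t] B - p) t₀ = m := by
  have hval (Q : MvPolynomial (Fin 2) ℂ) : AnalyticAt ℂ (fun t => eval ![f t, g t] Q) t₀ := by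
    simp only [← aeval_eq_eval]
    refine AnalyticAt.aeval_mvPolynomial (fun i => ?_) Q
    fin_cases i <;> assumption
  have hslope := ((hval A).neg.div (hval B) hB0).sub (analyticAt_const (v := p))
  refine congrArg ENat.toNat (hslope.analyticOrderAt_eq_natCast.2
    ⟨fun t => -c ^ m * eval ![f t, g t] P / eval ![f t, g t] B,
      (analyticAt_const.mul (hval P)).div (hval B) hB0,
      div_ne_zero (mul_ne_zero (neg_ne_zero.2 (pow_ne_zero _ hc)) hP0) hB0, ?_⟩)
  filter_upwards [(hval B).continuousAt.eventually_ne hB0] with t ht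
  have hPt := congrArg (eval ![f t, g t]) hP
  simp only [map_add, map_mul, eval_C, map_pow, eval_lineForm, hline, mul_pow] at hPt
  rw [Pi.sub_apply, Pi.div_apply, Pi.neg_apply, smul_eq_mul]
  field_simp
  linear_combination -hPt

lemma ramificationIndex_eq_of_param (hA : A.IsHomogeneous d) (hB : B.IsHomogeneous d)
    (hAB : IsRelPrime A B) (hab : ![a, b] ≠ 0)
    (hp : gMap A B (Projectivization.mk ℂ ![a, b] hab) = P1.ofAffine p)
    (hB0 : eval ![b, a] B ≠ 0) {m k : ℕ} (hPh : P.IsHomogeneous k)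
    (hP : A + C p * B = lineForm a b ^ m * P) (hP0 : eval ![b, a] P ≠ 0)
    {f g : ℂ → ℂ} {t₀ l c : ℂ} (hf : AnalyticAt ℂ f t₀) (hg : AnalyticAt ℂ g t₀) (hc : c ≠ 0)
    (hvec : ∀ t, ![g t, f t] ≠ 0)
    (hparam : ∀ t, P1.param (Projectivization.mk ℂ ![a, b] hab) t =
      Projectivization.mk ℂ ![g t, f t] (hvec t))
    (hcoord : P1.coord (Projectivization.mk ℂ ![a, b] hab) (Projectivization.mk ℂ ![a, b] hab) = t₀)
    (hb : b = l * f t₀) (ha : a = l * g t₀) (hline : ∀ t, b * g t - a * f t = c * (t - t₀)) :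
    ramificationIndex (gMap A B) (Projectivization.mk ℂ ![a, b] hab) = m := by
  have hne {Q : MvPolynomial (Fin 2) ℂ} {k : ℕ} (hQ : Q.IsHomogeneous k)
      (h : eval ![b, a] Q ≠ 0) : eval ![f t₀, g t₀] Q ≠ 0 := by
    rw [hb, ha, eval_smul_of_isHomogeneous hQ] at h
    exact right_ne_zero_of_mul h
  have hcoordp : P1.coord (P1.ofAffine p) (P1.ofAffine p) = p := by
    simp [P1.ofAffine, P1.coord_mk]
  simp only [ramificationIndex, hp, hcoordp, hcoord, hparam, coord_ofAffine_gMap_mk hA hB hAB]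
  exact analyticOrderNatAt_slope hf hg hc hline hP (hne hPh hP0) (hne hB hB0)

lemma ramificationIndex_eq (hA : A.IsHomogeneous d) (hB : B.IsHomogeneous d)
    (hAB : IsRelPrime A B) (hab : ![a, b] ≠ 0)
    (hp : gMap A B (Projectivization.mk ℂ ![a, b] hab) = P1.ofAffine p)
    (hB0 : eval ![b, a] B ≠ 0) {m k : ℕ} (hPh : P.IsHomogeneous k)
    (hP : A + C p * B = lineForm a b ^ m * P) (hP0 : eval ![b, a] P ≠ 0) :
    ramificationIndex (gMap A B) (Projectivization.mk ℂ ![a, b] hab) = m := by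
  rcases eq_or_ne b 0 with rfl | hb
  · have ha : a ≠ 0 := by
      rintro rfl
      simp at hab
    refine ramificationIndex_eq_of_param hA hB hAB hab hp hB0 hPh hP hP0
      (f := fun t => t) (g := fun _ => 1) (l := a) (c := -a) analyticAt_id analyticAt_const
      (neg_ne_zero.2 ha) vec_right_ne (fun t => ?_) (P1.coord_mk _ _ _ _) ?_ ?_ fun t => ?_
    · simp [P1.param_mk]
    all_goals simp
  · refine ramificationIndex_eq_of_param hA hB hAB hab hp hB0 hPh hP hP0
      (f := fun _ => 1) (g := fun t => t) (l := b) (c := b) analyticAt_const analyticAt_id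
      hb vec_left_ne (fun t => ?_) (P1.coord_mk _ _ _ _) ?_ ?_ fun t => ?_
    · simp [P1.param_mk, hb, P1.ofAffine]
    all_goals simp [hb, mul_sub, mul_div_cancel₀]

end Ramification

/-! ### Dehomogenization -/

section Dehomogenization

/-- The dehomogenization `G(1 - κ τ, τ)` of a binary form `G(x, y)`, in the affine coordinate
`τ = y / (x + κ y)` of the projective line. A generic `κ` keeps a given finite set of points away
from the point at infinity `x + κ y = 0`. -/
noncomputable def dehom (κ : ℂ) : MvPolynomial (Fin 2) ℂ →ₐ[ℂ] Polynomial ℂ :=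
  aeval ![1 - Polynomial.C κ * Polynomial.X, Polynomial.X]

variable {F G : MvPolynomial (Fin 2) ℂ} {d : ℕ} {κ : ℂ}

lemma dehom_C (κ c : ℂ) : dehom κ (C c) = Polynomial.C c := by
  simp [dehom]

lemma dehom_lineForm (κ a b : ℂ) :
    dehom κ (lineForm a b) = Polynomial.C (b + κ * a) * Polynomial.X - Polynomial.C a := by
  simp only [dehom, lineForm, map_sub, map_mul, algHom_C, aeval_X, Matrix.cons_val_zero,
    Matrix.cons_val_one, map_add, Polynomial.algebraMap_eq]
  ring

lemma eval_dehom (κ τ : ℂ) (G : MvPolynomial (Fin 2) ℂ) :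
    (dehom κ G).eval τ = eval ![1 - κ * τ, τ] G := by
  have h : (Polynomial.aeval τ).comp (dehom κ) = aeval ![1 - κ * τ, τ] := by
    ext i
    fin_cases i <;> simp [dehom]
  simpa [aeval_eq_eval] using DFunLike.congr_fun h G

lemma natDegree_one_sub_C_mul_X_le {R : Type*} [Ring R] (c : R) :
    (1 - Polynomial.C c * Polynomial.X).natDegree ≤ 1 := by
  compute_degree

lemma natDegree_dehom_le (hG : G.IsHomogeneous d) : (dehom κ G).natDegree ≤ d := by
  rw [← mul_one d]
  refine aeval_natDegree_le G hG.totalDegree_le _ fun i => ?_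
  fin_cases i
  · exact natDegree_one_sub_C_mul_X_le κ
  · exact Polynomial.natDegree_X_le

lemma coeff_dehom (hG : G.IsHomogeneous d) : (dehom κ G).coeff d = eval ![-κ, 1] G := by
  rw [dehom, aeval_def, eval₂_eq', Polynomial.finsetSum_coeff, eval_eq']
  refine Finset.sum_congr rfl fun m hm => ?_
  have hdeg : m 0 + m 1 = d := by
    rw [hG.degree_eq_sum_deg_support hm, Finset.sum_subset (Finset.subset_univ _) (by simp),
      Fin.sum_univ_two]
  have hpow := Polynomial.coeff_pow_of_natDegree_le (m := m 0) (natDegree_one_sub_C_mul_X_le κ)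
  simp only [Polynomial.algebraMap_eq, Polynomial.coeff_C_mul, Fin.prod_univ_two,
    Matrix.cons_val_zero, Matrix.cons_val_one, ← hdeg, Polynomial.coeff_mul_X_pow, one_pow, mul_one]
  rw [mul_one] at hpow
  simp [hpow, Polynomial.coeff_one]

lemma eval_eq_pow_mul_eval_dehom (hG : G.IsHomogeneous d) {x y : ℂ} (h : x + κ * y ≠ 0) :
    eval ![x, y] G = (x + κ * y) ^ d * (dehom κ G).eval (y / (x + κ * y)) := by
  have hx : (x + κ * y) * (1 - κ * (y / (x + κ * y))) = x := by
    field_simp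
    ring
  rw [eval_dehom, ← eval_smul_of_isHomogeneous hG, hx, mul_div_cancel₀ y h]

lemma eq_of_dehom_eq (hF : F.IsHomogeneous d) (hG : G.IsHomogeneous d)
    (h : dehom κ F = dehom κ G) : F = G := by
  have hne : X 0 + C κ * X 1 ≠ (0 : MvPolynomial (Fin 2) ℂ) := fun h0 => by
    simpa using congrArg (eval ![1, 0]) h0
  refine mul_left_cancel₀ hne (funext fun v => ?_)
  obtain ⟨x, y, rfl⟩ : ∃ x y, v = ![x, y] := ⟨v 0, v 1, by ext i; fin_cases i <;> rfl⟩
  by_cases hxy : x + κ * y = 0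
  · simp [hxy]
  · rw [map_mul, map_mul, eval_eq_pow_mul_eval_dehom hF hxy, eval_eq_pow_mul_eval_dehom hG hxy, h]

lemma eq_C_mul_prod_lineForm (hG : G.IsHomogeneous d) {c : ℂ} {τ : Fin d → ℂ}
    (h : dehom κ G = Polynomial.C c * ∏ s, (Polynomial.X - Polynomial.C (τ s))) :
    G = C c * ∏ s, lineForm (τ s) (1 - κ * τ s) := by
  have hprod : (∏ s, lineForm (τ s) (1 - κ * τ s)).IsHomogeneous d := by
    simpa using IsHomogeneous.prod Finset.univ _ _ fun s _ =>
      isHomogeneous_lineForm (τ s) (1 - κ * τ s)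
  refine eq_of_dehom_eq hG (hprod.C_mul c) (h.trans ?_)
  simp [dehom_lineForm]

lemma eval_derivative_dehom (κ τ : ℂ) (G : MvPolynomial (Fin 2) ℂ) :
    (dehom κ G).derivative.eval τ =
      -κ * eval ![1 - κ * τ, τ] (pderiv 0 G) + eval ![1 - κ * τ, τ] (pderiv 1 G) := by
  induction G using MvPolynomial.induction_on with
  | C c => simp
  | add F G hF hG =>
    simp only [map_add, Polynomial.eval_add, hF, hG]
    ring
  | mul_X G i hG =>
    simp only [map_mul, Polynomial.derivative_mul, Polynomial.eval_add, Polynomial.eval_mul, hG,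
      pderiv_mul, map_add, eval_dehom, eval_X]
    fin_cases i <;> simp [dehom] <;> ring

lemma sum_mul_eval_pderiv (hG : G.IsHomogeneous d) (x y : ℂ) :
    x * eval ![x, y] (pderiv 0 G) + y * eval ![x, y] (pderiv 1 G) = d * eval ![x, y] G := by
  simpa [Fin.sum_univ_two] using congrArg (eval ![x, y]) hG.sum_X_mul_pderiv

lemma mul_eval_smul_pderiv (hG : G.IsHomogeneous d) (c x y : ℂ) (i : Fin 2) :
    c * eval ![c * x, c * y] (pderiv i G) = c ^ d * eval ![x, y] (pderiv i G) := by
  rcases d with _ | d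
  · rw [← totalDegree_zero_iff_isHomogeneous, totalDegree_eq_zero_iff_eq_C] at hG
    rw [hG, pderiv_C, map_zero, map_zero, mul_zero, mul_zero]
  · rw [eval_smul_of_isHomogeneous hG.pderiv, Nat.add_sub_cancel, pow_succ']
    ring

-- Relative to the point `(x, y) = (1 - κ ρ, ρ)` and the tangent `(-κ, 1)` of the chart, the vector
-- `(1, p)` has the coordinates `κ p + 1` and `p x - y`; the first is handled by Euler's relation.
lemma mul_eval_pderiv_div_eval (hG : G.IsHomogeneous d) {a b p : ℂ} (hl : b + κ * a ≠ 0)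
    (hG0 : eval ![b, a] G ≠ 0) :
    let ρ := a / (b + κ * a)
    (b + κ * a) * (eval ![b, a] (pderiv 0 G) + p * eval ![b, a] (pderiv 1 G)) / eval ![b, a] G =
      d * (κ * p + 1) + (p * (1 - κ * ρ) - ρ) *
        ((dehom κ G).derivative.eval ρ / (dehom κ G).eval ρ) := by
  intro ρ
  have hb : (b + κ * a) * (1 - κ * ρ) = b := by
    simp only [ρ]
    field_simp
    ring
  have ha : (b + κ * a) * ρ = a := mul_div_cancel₀ a hl
  have hx := mul_eval_smul_pderiv hG (b + κ * a) (1 - κ * ρ) ρ 0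
  have hy := mul_eval_smul_pderiv hG (b + κ * a) (1 - κ * ρ) ρ 1
  have hev := eval_smul_of_isHomogeneous hG (b + κ * a) (1 - κ * ρ) ρ
  have heuler := sum_mul_eval_pderiv hG (1 - κ * ρ) ρ
  rw [hb, ha] at hx hy hev
  rw [hev] at hG0
  have hne : eval ![1 - κ * ρ, ρ] G ≠ 0 := right_ne_zero_of_mul hG0
  rw [mul_add, mul_left_comm, hx, hy, hev, eval_derivative_dehom, eval_dehom,
    div_eq_iff hG0]
  field_simp
  linear_combination (κ * p + 1) * heuler

end Dehomogenization

/-! ### The polynomials of the criterion -/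

section Criterion

variable {A B P : MvPolynomial (Fin 2) ℂ} {d ν : ℕ} {a b p κ : ℂ}

lemma numP_eq (h : eval ![b, a] (A + C p * B) = 0) :
    numP A B a b = C (eval ![b, a] B) * (A + C p * B) := by
  have hA : eval ![b, a] A = -(p * eval ![b, a] B) := by
    rw [map_add, map_mul, eval_C] at h
    exact eq_neg_of_add_eq_zero_left h
  rw [numP, Matrix.det_fin_two_of, hA]
  simp only [map_neg, map_mul]
  ring

lemma polyP_eq (hab : ![a, b] ≠ 0) (h : eval ![b, a] (A + C p * B) = 0)
    (hP : A + C p * B = lineForm a b ^ ν * P) :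
    polyP A B a b ν = C (eval ![b, a] B) * P := by
  have hnum : numP A B a b = lineForm a b ^ ν * (C (eval ![b, a] B) * P) := by
    rw [numP_eq h, hP]
    ring
  have hdvd : lineForm a b ^ ν ∣ numP A B a b := ⟨_, hnum⟩
  rw [polyP, dif_pos hdvd]
  exact mul_left_cancel₀ (pow_ne_zero _ (lineForm_ne_zero hab))
    (hdvd.choose_spec.symm.trans hnum)

lemma isHomogeneous_pderiv_mul {F G : MvPolynomial (Fin 2) ℂ} {k m : ℕ} (hF : F.IsHomogeneous k)
    (hG : G.IsHomogeneous m) (i : Fin 2) :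
    (pderiv i F * G).IsHomogeneous (k + m - 1) := by
  rcases k with _ | k
  · rw [← totalDegree_zero_iff_isHomogeneous, totalDegree_eq_zero_iff_eq_C] at hF
    rw [hF, pderiv_C, zero_mul]
    exact isHomogeneous_zero _ _ _
  · rw [show k + 1 + m - 1 = k + 1 - 1 + m by omega]
    exact hF.pderiv.mul hG

lemma polyQ_isHomogeneous (hA : A.IsHomogeneous d) (hB : B.IsHomogeneous d)
    (hν : ν ≤ d) (hP : (polyP A B a b ν).IsHomogeneous (d - ν)) :
    (polyQ A B a b ν).IsHomogeneous (2 * d - ν - 1) := by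
  rw [polyQ, mul_assoc, Matrix.det_fin_two_of, mul_comm A]
  refine IsHomogeneous.add (IsHomogeneous.C_mul ?_ _) (IsHomogeneous.C_mul ?_ _)
  · rw [show 2 * d - ν - 1 = (d - 1) + (d - ν) by omega]
    exact (hB.pderiv.sub hA.pderiv).mul hP
  · rw [show 2 * d - ν - 1 = (d - ν) + d - 1 by omega]
    exact (isHomogeneous_pderiv_mul hP hB 0).sub (isHomogeneous_pderiv_mul hP hA 1)

lemma eval_pderiv_lineForm_pow_mul (hν : 2 ≤ ν) (i : Fin 2) :
    eval ![b, a] (pderiv i (lineForm a b ^ ν * P)) = 0 := by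
  have hline : eval ![b, a] (lineForm a b) = 0 := by
    rw [eval_lineForm]
    ring
  simp only [pderiv_mul, pderiv_pow, map_add, map_mul, map_pow, hline,
    zero_pow (show ν ≠ 0 by omega), zero_pow (show ν - 1 ≠ 0 by omega), mul_zero, zero_mul,
    add_zero]

-- At a multiple point of the fibre, `A` and `-p B` agree to first order.
lemma eval_polyQ (hν : 2 ≤ ν) (hP : A + C p * B = lineForm a b ^ ν * P) :
    eval ![b, a] (polyQ A B a b ν) =
      (ν - 2) * (eval ![b, a] (pderiv 0 B) + p * eval ![b, a] (pderiv 1 B)) *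
          eval ![b, a] (polyP A B a b ν) +
        2 * (ν + 1) * (eval ![b, a] (pderiv 0 (polyP A B a b ν)) +
          p * eval ![b, a] (pderiv 1 (polyP A B a b ν))) * eval ![b, a] B := by
  have hA : eval ![b, a] A + p * eval ![b, a] B = 0 := by
    simpa [eval_lineForm, mul_comm a b, show ν ≠ 0 by omega] using congrArg (eval ![b, a]) hP
  have hAy : eval ![b, a] (pderiv 1 A) + p * eval ![b, a] (pderiv 1 B) = 0 := by
    have h := eval_pderiv_lineForm_pow_mul (P := P) (a := a) (b := b) hν 1
    simpa [← hP, pderiv_C_mul] using h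
  simp only [polyQ, Matrix.det_fin_two_of, map_add, map_sub, map_mul, eval_C]
  linear_combination -(ν - 2) * eval ![b, a] (polyP A B a b ν) * hAy -
    2 * (ν + 1) * eval ![b, a] (pderiv 1 (polyP A B a b ν)) * hA

/-- Six times the residue of `traceForm d κ 𝓐 𝓑` at a point `ρ` of multiplicity `ν` of the fibre
over `p`, where `𝓐 + p 𝓑 = (X - ρ) ^ ν * P`. -/
noncomputable def fibreResidue (d ν : ℕ) (κ p : ℂ) (𝓑 P : Polynomial ℂ) (ρ : ℂ) : ℂ :=
  (1 - 1 / (ν : ℂ)) * (p * (1 - κ * ρ) - ρ) *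
    ((ν - 2) * (d * (κ * p + 1) +
        (p * (1 - κ * ρ) - ρ) * (𝓑.derivative.eval ρ / 𝓑.eval ρ)) +
      2 * (ν + 1) * ((d - ν) * (κ * p + 1) +
        (p * (1 - κ * ρ) - ρ) * (P.derivative.eval ρ / P.eval ρ)))

lemma fibreResidue_C_mul (𝓑 Q : Polynomial ℂ) (ρ : ℂ) {c : ℂ} (hc : c ≠ 0) :
    fibreResidue d ν κ p 𝓑 (Polynomial.C c * Q) ρ = fibreResidue d ν κ p 𝓑 Q ρ := by
  simp only [fibreResidue, Polynomial.derivative_C_mul, Polynomial.eval_mul, Polynomial.eval_C,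
    mul_div_mul_left _ _ hc]

lemma criterion_term_eq_fibreResidue (hB : B.IsHomogeneous d) (hν1 : 1 ≤ ν) (hν : ν ≤ d)
    (hPh : (polyP A B a b ν).IsHomogeneous (d - ν)) (hP : A + C p * B = lineForm a b ^ ν * P)
    (hP0 : eval ![b, a] (polyP A B a b ν) ≠ 0) (hB0 : eval ![b, a] B ≠ 0) (hl : b + κ * a ≠ 0) :
    (1 - 1 / (ν : ℂ)) * ((p * b - a) * eval ![b, a] (polyQ A B a b ν) /
        (eval ![b, a] (polyP A B a b ν) * eval ![b, a] B)) =
      fibreResidue d ν κ p (dehom κ B) (dehom κ (polyP A B a b ν)) (a / (b + κ * a)) := by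
  rcases hν1.eq_or_lt with rfl | hν2
  · simp [fibreResidue]
  have hM : p * b - a = (b + κ * a) *
      (p * (1 - κ * (a / (b + κ * a))) - a / (b + κ * a)) := by
    linear_combination (p * κ + 1) * mul_div_cancel₀ a hl
  rw [fibreResidue, ← Nat.cast_sub hν, ← mul_eval_pderiv_div_eval hB hl hB0,
    ← mul_eval_pderiv_div_eval hPh hl hP0, eval_polyQ hν2 hP, hM, mul_assoc (1 - 1 / (ν : ℂ))]
  congr 1
  field_simp

end Criterion

/-! ### Fundamental forms of `3`-webs -/

section ThreeWeb

lemma wedge_smul_left (c : ℂ) (α β : ℂ × ℂ) : wedge (c • α) β = c * wedge α β := by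
  simp only [wedge, Prod.smul_fst, Prod.smul_snd, smul_eq_mul]
  ring

lemma wedge_smul_right (c : ℂ) (α β : ℂ × ℂ) : wedge α (c • β) = c * wedge α β := by
  simp only [wedge, Prod.smul_fst, Prod.smul_snd, smul_eq_mul]
  ring

lemma wedge_add_left (α β γ : ℂ × ℂ) : wedge (α + β) γ = wedge α γ + wedge β γ := by
  simp only [wedge, Prod.fst_add, Prod.snd_add]
  ring

lemma extD_congr {α β : OneForm} {z : ℂ × ℂ} (h : α =ᶠ[nhds z] β) : extD α z = extD β z := by
  have h₁ : (fun w => (α w).1) =ᶠ[nhds z] fun w => (β w).1 := h.fun_comp Prod.fst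
  have h₂ : (fun w => (α w).2) =ᶠ[nhds z] fun w => (β w).2 := h.fun_comp Prod.snd
  rw [extD, extD, h₁.fderiv_eq, h₂.fderiv_eq]

/-- The covector `df` at `z`, in the coordinates `dp`, `dq`. -/
noncomputable def diffAt (f : ℂ × ℂ → ℂ) (z : ℂ × ℂ) : ℂ × ℂ :=
  (fderiv ℂ f z (1, 0), fderiv ℂ f z (0, 1))

/-- The logarithmic differential `df / f` at `z`. -/
noncomputable def logDiffAt (f : ℂ × ℂ → ℂ) (z : ℂ × ℂ) : ℂ × ℂ := (f z)⁻¹ • diffAt f z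

lemma extD_smul {f : ℂ × ℂ → ℂ} {α : OneForm} {z : ℂ × ℂ} (hf : DifferentiableAt ℂ f z)
    (hα : DifferentiableAt ℂ α z) :
    extD (fun w => f w • α w) z = f z * extD α z + wedge (diffAt f z) (α z) := by
  have h₁ : fderiv ℂ (fun w => f w * (α w).1) z = _ := fderiv_mul hf hα.fst
  have h₂ : fderiv ℂ (fun w => f w * (α w).2) z = _ := fderiv_mul hf hα.snd
  simp only [extD, Prod.smul_fst, Prod.smul_snd, smul_eq_mul, h₁, h₂, diffAt, wedge, add_apply,
    smul_apply]
  ring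

lemma extD_smul_eq_wedge_add_logDiffAt {f : ℂ × ℂ → ℂ} {α : OneForm} {θ z : ℂ × ℂ}
    (hf : DifferentiableAt ℂ f z) (hf0 : f z ≠ 0) (hα : DifferentiableAt ℂ α z)
    (h : extD α z = wedge θ (α z)) :
    extD (fun w => f w • α w) z = wedge (θ + logDiffAt f z) (f z • α z) := by
  rw [extD_smul hf hα, h, logDiffAt, wedge_smul_right, wedge_add_left, wedge_smul_left]
  field_simp

lemma logDiffAt_mul {f g : ℂ × ℂ → ℂ} {z : ℂ × ℂ} (hf : DifferentiableAt ℂ f z)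
    (hg : DifferentiableAt ℂ g z) (hf0 : f z ≠ 0) (hg0 : g z ≠ 0) :
    logDiffAt (fun w => f w * g w) z = logDiffAt f z + logDiffAt g z := by
  have h : fderiv ℂ (fun w => f w * g w) z = _ := fderiv_mul hf hg
  ext <;> simp only [logDiffAt, diffAt, h, Prod.smul_fst, Prod.smul_snd, Prod.fst_add,
    Prod.snd_add, add_apply, smul_apply, smul_eq_mul] <;> field_simp <;> ring

lemma logDiffAt_prod {ι : Type*} {u : Finset ι} {f : ι → ℂ × ℂ → ℂ} {z : ℂ × ℂ}
    (hf : ∀ i ∈ u, DifferentiableAt ℂ (f i) z) (hf0 : ∀ i ∈ u, f i z ≠ 0) :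
    logDiffAt (fun w => ∏ i ∈ u, f i w) z = ∑ i ∈ u, logDiffAt (f i) z := by
  classical
  induction u using Finset.induction_on with
  | empty => simp [logDiffAt, diffAt]
  | insert i u hi ih =>
    rw [Finset.forall_mem_insert] at hf hf0
    simp only [Finset.prod_insert hi, Finset.sum_insert hi]
    have hprod := (HasFDerivAt.finsetProd fun i hi => (hf.2 i hi).hasFDerivAt).differentiableAt
    rw [logDiffAt_mul hf.1 hprod hf0.1 (Finset.prod_ne_zero_iff.2 hf0.2), ih hf.2 hf0.2]

lemma logDiffAt_congr {f g : ℂ × ℂ → ℂ} {z : ℂ × ℂ} (h : f =ᶠ[nhds z] g) :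
    logDiffAt f z = logDiffAt g z := by
  rw [logDiffAt, logDiffAt, diffAt, diffAt, h.fderiv_eq, h.eq_of_nhds]

/-- The equations of the fundamental form `θ` of a `3`-web at one point. -/
def TripleAt (ω₁ ω₂ ω₃ : OneForm) (θ z : ℂ × ℂ) : Prop :=
  extD (fun w => wedge (ω₂ w) (ω₃ w) • ω₁ w) z = wedge θ (wedge (ω₂ z) (ω₃ z) • ω₁ z) ∧
  extD (fun w => wedge (ω₃ w) (ω₁ w) • ω₂ w) z = wedge θ (wedge (ω₃ z) (ω₁ z) • ω₂ z) ∧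
  extD (fun w => wedge (ω₁ w) (ω₂ w) • ω₃ w) z = wedge θ (wedge (ω₁ z) (ω₂ z) • ω₃ z)

lemma TripleAt.unique {ω₁ ω₂ ω₃ : OneForm} {θ θ' z : ℂ × ℂ} (h : TripleAt ω₁ ω₂ ω₃ θ z)
    (h' : TripleAt ω₁ ω₂ ω₃ θ' z) (h₁₂ : wedge (ω₁ z) (ω₂ z) ≠ 0) (h₂₃ : wedge (ω₂ z) (ω₃ z) ≠ 0)
    (h₃₁ : wedge (ω₃ z) (ω₁ z) ≠ 0) : θ = θ' := by
  have e₁ := h.1.symm.trans h'.1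
  have e₂ := h.2.1.symm.trans h'.2.1
  rw [wedge_smul_right, wedge_smul_right] at e₁ e₂
  have e₁ := mul_left_cancel₀ h₂₃ e₁
  have e₂ := mul_left_cancel₀ h₃₁ e₂
  simp only [wedge] at e₁ e₂ h₁₂
  ext
  · apply mul_right_cancel₀ h₁₂
    linear_combination (ω₁ z).1 * e₂ - (ω₂ z).1 * e₁
  · apply mul_right_cancel₀ h₁₂
    linear_combination (ω₁ z).2 * e₂ - (ω₂ z).2 * e₁

lemma TripleAt.congr {ω₁ ω₂ ω₃ ω₁' ω₂' ω₃' : OneForm} {θ z : ℂ × ℂ}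
    (h : TripleAt ω₁ ω₂ ω₃ θ z) (h₁ : ω₁' =ᶠ[nhds z] ω₁) (h₂ : ω₂' =ᶠ[nhds z] ω₂)
    (h₃ : ω₃' =ᶠ[nhds z] ω₃) : TripleAt ω₁' ω₂' ω₃' θ z := by
  have hcongr {α β γ α' β' γ' : OneForm} (hα : α' =ᶠ[nhds z] α) (hβ : β' =ᶠ[nhds z] β)
      (hγ : γ' =ᶠ[nhds z] γ)
      (h : extD (fun w => wedge (β w) (γ w) • α w) z = wedge θ (wedge (β z) (γ z) • α z)) :
      extD (fun w => wedge (β' w) (γ' w) • α' w) z = wedge θ (wedge (β' z) (γ' z) • α' z) := by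
    have he : (fun w => wedge (β' w) (γ' w) • α' w) =ᶠ[nhds z]
        fun w => wedge (β w) (γ w) • α w := by
      filter_upwards [hα, hβ, hγ] with w hα hβ hγ
      rw [hα, hβ, hγ]
    rw [extD_congr he, h, hα.eq_of_nhds, hβ.eq_of_nhds, hγ.eq_of_nhds]
  exact ⟨hcongr h₁ h₂ h₃ h.1, hcongr h₂ h₃ h₁ h.2.1, hcongr h₃ h₁ h₂ h.2.2⟩

lemma TripleAt.smul {ω₁ ω₂ ω₃ : OneForm} {θ z : ℂ × ℂ} (h : TripleAt ω₁ ω₂ ω₃ θ z)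
    (h₁ : DifferentiableAt ℂ ω₁ z) (h₂ : DifferentiableAt ℂ ω₂ z) (h₃ : DifferentiableAt ℂ ω₃ z)
    {f₁ f₂ f₃ : ℂ × ℂ → ℂ} (hf₁ : DifferentiableAt ℂ f₁ z) (hf₂ : DifferentiableAt ℂ f₂ z)
    (hf₃ : DifferentiableAt ℂ f₃ z) (n₁ : f₁ z ≠ 0) (n₂ : f₂ z ≠ 0) (n₃ : f₃ z ≠ 0) :
    TripleAt (fun w => f₁ w • ω₁ w) (fun w => f₂ w • ω₂ w) (fun w => f₃ w • ω₃ w)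
      (θ + (logDiffAt f₁ z + logDiffAt f₂ z + logDiffAt f₃ z)) z := by
  have hlog : logDiffAt (fun w => f₁ w * f₂ w * f₃ w) z =
      logDiffAt f₁ z + logDiffAt f₂ z + logDiffAt f₃ z := by
    rw [logDiffAt_mul (hf₁.fun_mul hf₂) hf₃ (mul_ne_zero n₁ n₂) n₃, logDiffAt_mul hf₁ hf₂ n₁ n₂]
  have hsmul {α β γ : OneForm} {f g k : ℂ × ℂ → ℂ}
      (hα : DifferentiableAt ℂ α z) (hβ : DifferentiableAt ℂ β z) (hγ : DifferentiableAt ℂ γ z)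
      (hk : ∀ w, f w * g w * k w = f₁ w * f₂ w * f₃ w)
      (h : extD (fun w => wedge (β w) (γ w) • α w) z = wedge θ (wedge (β z) (γ z) • α z)) :
      extD (fun w => wedge (g w • β w) (k w • γ w) • f w • α w) z =
        wedge (θ + (logDiffAt f₁ z + logDiffAt f₂ z + logDiffAt f₃ z))
          (wedge (g z • β z) (k z • γ z) • f z • α z) := by
    have he (w : ℂ × ℂ) : wedge (g w • β w) (k w • γ w) • f w • α w =
        (f₁ w * f₂ w * f₃ w) • wedge (β w) (γ w) • α w := by
      rw [← hk, wedge_smul_left, wedge_smul_right, smul_smul, smul_smul]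
      congr 1
      ring
    have hd : DifferentiableAt ℂ (fun w => wedge (β w) (γ w) • α w) z :=
      ((hβ.fst.mul hγ.snd).sub (hβ.snd.mul hγ.fst)).smul hα
    simp only [he]
    rw [← hlog, extD_smul_eq_wedge_add_logDiffAt ((hf₁.fun_mul hf₂).fun_mul hf₃)
      (mul_ne_zero (mul_ne_zero n₁ n₂) n₃) hd h]
  exact ⟨hsmul h₁ h₂ h₃ (fun w => rfl) h.1, hsmul h₂ h₃ h₁ (fun w => by ring) h.2.1,
    hsmul h₃ h₁ h₂ (fun w => by ring) h.2.2⟩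

/-- The linear form `lineForm (τ p) (1 - κ τ p)`, which vanishes at the point `(1 - κ τ, τ)`,
evaluated at `(dq, p dq - q dp)` as in `legForm`. -/
def liftForm (κ : ℂ) (τ : ℂ → ℂ) : OneForm := fun z =>
  (-z.2 * (1 - κ * τ z.1), z.1 * (1 - κ * τ z.1) - τ z.1)

lemma wedge_liftForm (κ : ℂ) (τ₁ τ₂ : ℂ → ℂ) (z : ℂ × ℂ) :
    wedge (liftForm κ τ₁ z) (liftForm κ τ₂ z) = z.2 * (τ₂ z.1 - τ₁ z.1) := by
  simp only [wedge, liftForm]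
  ring

lemma differentiableAt_liftForm (κ : ℂ) {τ : ℂ → ℂ} {z : ℂ × ℂ} (h : DifferentiableAt ℂ τ z.1) :
    DifferentiableAt ℂ (liftForm κ τ) z := by
  unfold liftForm
  fun_prop

lemma diffAt_snd_mul {τ : ℂ → ℂ} {s : ℂ} {z : ℂ × ℂ} (h : HasDerivAt τ s z.1) :
    diffAt (fun w => w.2 * τ w.1) z = (z.2 * s, τ z.1) := by
  have hτ : HasFDerivAt (fun w : ℂ × ℂ => τ w.1) (s • ContinuousLinearMap.fst ℂ ℂ ℂ) z :=
    h.comp_hasFDerivAt z hasFDerivAt_fst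
  have hq : HasFDerivAt (fun w : ℂ × ℂ => w.2) _ z := hasFDerivAt_snd (𝕜 := ℂ)
  rw [diffAt, (hq.fun_mul hτ).fderiv]
  simp

lemma extD_liftForm {κ : ℂ} {τ : ℂ → ℂ} {s : ℂ} {z : ℂ × ℂ} (h : HasDerivAt τ s z.1) :
    extD (liftForm κ τ) z = 2 * (1 - κ * τ z.1) - (κ * z.1 + 1) * s := by
  have hτ : HasFDerivAt (fun w : ℂ × ℂ => τ w.1) (s • ContinuousLinearMap.fst ℂ ℂ ℂ) z :=
    h.comp_hasFDerivAt z hasFDerivAt_fst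
  have hp : HasFDerivAt (fun w : ℂ × ℂ => w.1) _ z := hasFDerivAt_fst (𝕜 := ℂ)
  have hq : HasFDerivAt (fun w : ℂ × ℂ => w.2) _ z := hasFDerivAt_snd (𝕜 := ℂ)
  have hx := (hτ.const_mul κ).const_sub 1
  have h₁ : fderiv ℂ (fun w => (liftForm κ τ w).1) z = _ := (hq.neg.mul hx).fderiv
  have h₂ : fderiv ℂ (fun w => (liftForm κ τ w).2) z = _ := ((hp.mul hx).sub hτ).fderiv
  rw [extD, h₁, h₂]
  simp only [smul_neg, add_apply, sub_apply, neg_apply, smul_apply,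
    ContinuousLinearMap.coe_fst', ContinuousLinearMap.coe_snd', smul_eq_mul]
  ring

/-- The coefficient of `dq / q` in the fundamental form of the `3`-web given by three forms
`liftForm κ τᵢ`; here `tᵢ` and `sᵢ` are the values of `τᵢ` and of its derivative at `p`. -/
noncomputable def tripleCoeff (κ p t₁ t₂ t₃ s₁ s₂ s₃ : ℂ) : ℂ :=
  3 - (s₁ * (p * (1 - κ * t₂) - t₂) * (p * (1 - κ * t₃) - t₃) / ((t₁ - t₂) * (t₁ - t₃)) +
    s₂ * (p * (1 - κ * t₁) - t₁) * (p * (1 - κ * t₃) - t₃) / ((t₂ - t₁) * (t₂ - t₃)) +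
    s₃ * (p * (1 - κ * t₁) - t₁) * (p * (1 - κ * t₂) - t₂) / ((t₃ - t₁) * (t₃ - t₂)))

/-- The coefficient of `dp` in the fundamental form of the `3`-web given by three forms
`liftForm κ τᵢ`; here `tᵢ` and `sᵢ` are the values of `τᵢ` and of its derivative at `p`. -/
noncomputable def tripleCoeffP (κ p t₁ t₂ t₃ s₁ s₂ s₃ : ℂ) : ℂ :=
  s₁ * (p * (1 - κ * t₂) * (1 - κ * t₃) + t₁ - t₂ - t₃ + κ * t₂ * t₃) /
      ((t₁ - t₂) * (t₁ - t₃)) +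
    s₂ * (p * (1 - κ * t₁) * (1 - κ * t₃) + t₂ - t₁ - t₃ + κ * t₁ * t₃) /
      ((t₂ - t₁) * (t₂ - t₃)) +
    s₃ * (p * (1 - κ * t₁) * (1 - κ * t₂) + t₃ - t₁ - t₂ + κ * t₁ * t₂) /
      ((t₃ - t₁) * (t₃ - t₂))

lemma tripleCoeff_rotate (κ p t₁ t₂ t₃ s₁ s₂ s₃ : ℂ) :
    tripleCoeff κ p t₂ t₃ t₁ s₂ s₃ s₁ = tripleCoeff κ p t₁ t₂ t₃ s₁ s₂ s₃ := by
  unfold tripleCoeff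
  ring

lemma tripleCoeffP_rotate (κ p t₁ t₂ t₃ s₁ s₂ s₃ : ℂ) :
    tripleCoeffP κ p t₂ t₃ t₁ s₂ s₃ s₁ = tripleCoeffP κ p t₁ t₂ t₃ s₁ s₂ s₃ := by
  unfold tripleCoeffP
  ring

lemma tripleCoeff_swap (κ p t₁ t₂ t₃ s₁ s₂ s₃ : ℂ) :
    tripleCoeff κ p t₂ t₁ t₃ s₂ s₁ s₃ = tripleCoeff κ p t₁ t₂ t₃ s₁ s₂ s₃ := by
  unfold tripleCoeff
  ring

lemma extD_smul_liftForm {κ : ℂ} {τ₁ τ₂ τ₃ : ℂ → ℂ} {s₁ s₂ s₃ : ℂ} {z : ℂ × ℂ}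
    (h₁ : HasDerivAt τ₁ s₁ z.1) (h₂ : HasDerivAt τ₂ s₂ z.1) (h₃ : HasDerivAt τ₃ s₃ z.1)
    (h₁₂ : τ₁ z.1 ≠ τ₂ z.1) (h₂₃ : τ₂ z.1 ≠ τ₃ z.1) (h₃₁ : τ₃ z.1 ≠ τ₁ z.1) (hz : z.2 ≠ 0) :
    extD (fun w => wedge (liftForm κ τ₂ w) (liftForm κ τ₃ w) • liftForm κ τ₁ w) z =
      wedge (tripleCoeffP κ z.1 (τ₁ z.1) (τ₂ z.1) (τ₃ z.1) s₁ s₂ s₃,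
          tripleCoeff κ z.1 (τ₁ z.1) (τ₂ z.1) (τ₃ z.1) s₁ s₂ s₃ / z.2)
        (wedge (liftForm κ τ₂ z) (liftForm κ τ₃ z) • liftForm κ τ₁ z) := by
  have hτ : HasDerivAt (fun p => τ₃ p - τ₂ p) (s₃ - s₂) z.1 := h₃.sub h₂
  have hd : DifferentiableAt ℂ (fun w : ℂ × ℂ => w.2 * (τ₃ w.1 - τ₂ w.1)) z :=
    differentiableAt_snd.mul (hτ.differentiableAt.comp z differentiableAt_fst)
  simp only [wedge_liftForm]
  rw [extD_smul hd (differentiableAt_liftForm κ h₁.differentiableAt), extD_liftForm h₁,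
    diffAt_snd_mul hτ, wedge_smul_right]
  simp only [wedge, liftForm, tripleCoeff, tripleCoeffP]
  generalize τ₁ z.1 = t₁, τ₂ z.1 = t₂, τ₃ z.1 = t₃ at *
  have k₁ := sub_ne_zero.2 h₁₂
  have k₂ := sub_ne_zero.2 h₂₃
  have k₃ := sub_ne_zero.2 h₃₁
  rw [← neg_sub t₁ t₂, ← neg_sub t₂ t₃, ← neg_sub t₃ t₁]
  field_simp
  ring

lemma tripleAt_liftForm {κ : ℂ} {τ₁ τ₂ τ₃ : ℂ → ℂ} {s₁ s₂ s₃ : ℂ} {z : ℂ × ℂ}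
    (h₁ : HasDerivAt τ₁ s₁ z.1) (h₂ : HasDerivAt τ₂ s₂ z.1) (h₃ : HasDerivAt τ₃ s₃ z.1)
    (h₁₂ : τ₁ z.1 ≠ τ₂ z.1) (h₂₃ : τ₂ z.1 ≠ τ₃ z.1) (h₃₁ : τ₃ z.1 ≠ τ₁ z.1) (hz : z.2 ≠ 0) :
    TripleAt (liftForm κ τ₁) (liftForm κ τ₂) (liftForm κ τ₃)
      (tripleCoeffP κ z.1 (τ₁ z.1) (τ₂ z.1) (τ₃ z.1) s₁ s₂ s₃,
        tripleCoeff κ z.1 (τ₁ z.1) (τ₂ z.1) (τ₃ z.1) s₁ s₂ s₃ / z.2) z := by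
  refine ⟨extD_smul_liftForm h₁ h₂ h₃ h₁₂ h₂₃ h₃₁ hz, ?_, ?_⟩
  · rw [← tripleCoeffP_rotate, ← tripleCoeff_rotate]
    exact extD_smul_liftForm h₂ h₃ h₁ h₂₃ h₃₁ h₁₂ hz
  · rw [tripleCoeffP_rotate κ _ (τ₃ z.1) (τ₁ z.1) (τ₂ z.1) s₃ s₁ s₂,
      tripleCoeff_rotate κ _ (τ₃ z.1) (τ₁ z.1) (τ₂ z.1) s₃ s₁ s₂]
    exact extD_smul_liftForm h₃ h₁ h₂ h₃₁ h₁₂ h₂₃ hz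

end ThreeWeb

section TripleSums

variable {ι E : Type*} [AddCommGroup E]

lemma ite_pairwise_ne_eq_sum_ite_lt [LinearOrder ι] (r s t : ι) (x : E) :
    (if r ≠ s ∧ s ≠ t ∧ t ≠ r then x else 0) =
      (if r < s ∧ s < t then x else 0) + (if s < t ∧ t < r then x else 0) +
      (if t < r ∧ r < s then x else 0) + (if s < r ∧ r < t then x else 0) +
      (if r < t ∧ t < s then x else 0) + (if t < s ∧ s < r then x else 0) := by
  rcases lt_trichotomy r s with h | h | h <;> rcases lt_trichotomy s t with h' | h' | h' <;>
    rcases lt_trichotomy r t with h'' | h'' | h'' <;> grind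

variable [Fintype ι]

section DistinctSum

variable [DecidableEq ι]

/-- The sum over all triples of pairwise distinct indices. -/
def distinctSum (S : ι → ι → ι → E) : E :=
  ∑ r, ∑ s, ∑ t, if r ≠ s ∧ s ≠ t ∧ t ≠ r then S r s t else 0

lemma distinctSum_congr {S T : ι → ι → ι → E}
    (h : ∀ r s t, r ≠ s → s ≠ t → t ≠ r → S r s t = T r s t) : distinctSum S = distinctSum T :=
  Finset.sum_congr rfl fun r _ => Finset.sum_congr rfl fun s _ => Finset.sum_congr rfl fun t _ =>
    if_ctx_congr Iff.rfl (fun hd => h r s t hd.1 hd.2.1 hd.2.2) fun _ => rfl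

lemma distinctSum_eq_sum_erase (S : ι → ι → ι → E) :
    distinctSum S =
      ∑ r, ∑ s ∈ Finset.univ.erase r, ∑ t ∈ (Finset.univ.erase r).erase s, S r s t := by
  refine Finset.sum_congr rfl fun r _ => ?_
  rw [← Finset.filter_ne Finset.univ r, Finset.sum_filter]
  refine Finset.sum_congr rfl fun s _ => ?_
  split_ifs with h
  · rw [← Finset.filter_ne _ s, Finset.filter_filter, Finset.sum_filter]
    exact Finset.sum_congr rfl fun t _ => if_congr (by grind) rfl rfl
  · exact Finset.sum_eq_zero fun t _ => if_neg fun hd => h hd.1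

lemma distinctSum_add (S T : ι → ι → ι → E) :
    distinctSum (fun r s t => S r s t + T r s t) = distinctSum S + distinctSum T := by
  simp only [distinctSum_eq_sum_erase, Finset.sum_add_distrib]

lemma distinctSum_rotate (S : ι → ι → ι → E) :
    distinctSum (fun r s t => S s t r) = distinctSum S := by
  rw [distinctSum, distinctSum, Finset.sum_comm]
  refine Finset.sum_congr rfl fun s _ => ?_
  rw [Finset.sum_comm]
  exact Finset.sum_congr rfl fun t _ => Finset.sum_congr rfl fun r _ =>
    if_congr (by tauto) rfl rfl

lemma distinctSum_comp_equiv (σ : Equiv.Perm ι) (S : ι → ι → ι → E) :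
    distinctSum (fun r s t => S (σ r) (σ s) (σ t)) = distinctSum S := by
  simp only [distinctSum]
  refine Fintype.sum_equiv σ _ _ fun r => Fintype.sum_equiv σ _ _ fun s =>
    Fintype.sum_equiv σ _ _ fun t => ?_
  simp only [ne_eq, EmbeddingLike.apply_eq_iff_eq]

lemma distinctSum_fst [Module ℂ E] (hι : 2 ≤ Fintype.card ι) (φ : ι → E) :
    distinctSum (fun r _ _ => φ r) =
      (((Fintype.card ι : ℂ) - 1) * (Fintype.card ι - 2)) • ∑ r, φ r := by
  have h₁ (r : ι) : ((Finset.univ.erase r).card : ℂ) = Fintype.card ι - 1 := by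
    rw [Finset.card_erase_of_mem (Finset.mem_univ _), Finset.card_univ, Nat.cast_sub (by omega),
      Nat.cast_one]
  have h₂ {r s : ι} (hs : s ∈ Finset.univ.erase r) :
      (((Finset.univ.erase r).erase s).card : ℂ) = Fintype.card ι - 2 := by
    rw [Finset.card_erase_of_mem hs, Finset.card_erase_of_mem (Finset.mem_univ _),
      Finset.card_univ, Nat.sub_sub, Nat.cast_sub hι, Nat.cast_two]
  rw [distinctSum_eq_sum_erase, Finset.smul_sum]
  refine Finset.sum_congr rfl fun r _ => ?_
  simp_rw [Finset.sum_const, ← Nat.cast_smul_eq_nsmul ℂ]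
  rw [Finset.sum_congr rfl fun s hs => by rw [h₂ hs], Finset.sum_const,
    ← Nat.cast_smul_eq_nsmul ℂ, h₁, smul_smul]

end DistinctSum

variable [LinearOrder ι]

lemma distinctSum_eq_six_smul {S : ι → ι → ι → E} (hrot : ∀ r s t, S s t r = S r s t)
    (hswap : ∀ r s t, S s r t = S r s t) :
    distinctSum S = 6 • ∑ r, ∑ s, ∑ t, if r < s ∧ s < t then S r s t else 0 := by
  set T : ι → ι → ι → E := fun r s t => if r < s ∧ s < t then S r s t else 0 with hT
  have hST (r s t : ι) : (if r ≠ s ∧ s ≠ t ∧ t ≠ r then S r s t else 0) =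
      T r s t + T s t r + T t r s + T s r t + T r t s + T t s r := by
    have hcyc : S t r s = S r s t := (hrot t r s).symm
    have hflip : S r t s = S r s t := by rw [← hswap, hcyc]
    have hrev : S t s r = S r s t := by rw [← hrot, hswap]
    simp only [hT, hrot r s t, hswap r s t, hcyc, hflip, hrev]
    exact ite_pairwise_ne_eq_sum_ite_lt r s t (S r s t)
  have hcomm₁ (U : ι → ι → ι → E) :
      ∑ r, ∑ s, ∑ t, U s r t = ∑ r, ∑ s, ∑ t, U r s t := Finset.sum_comm
  have hcomm₂ (U : ι → ι → ι → E) : ∑ r, ∑ s, ∑ t, U r t s = ∑ r, ∑ s, ∑ t, U r s t :=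
    Finset.sum_congr rfl fun r _ => Finset.sum_comm
  simp only [distinctSum, hST, Finset.sum_add_distrib]
  rw [(hcomm₁ fun r s t => T r t s).trans (hcomm₂ T),
    (hcomm₂ fun r s t => T s r t).trans (hcomm₁ T), hcomm₁ T, hcomm₂ T,
    (hcomm₁ fun r s t => T t r s).trans ((hcomm₂ fun r s t => T s r t).trans (hcomm₁ T))]
  abel

lemma sum_Ioi_eq_sum_ite [LocallyFiniteOrderTop ι] (S : ι → ι → ι → E) :
    ∑ r, ∑ s ∈ Finset.Ioi r, ∑ t ∈ Finset.Ioi s, S r s t =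
      ∑ r, ∑ s, ∑ t, if r < s ∧ s < t then S r s t else 0 := by
  refine Finset.sum_congr rfl fun r _ => ?_
  rw [← Finset.filter_lt_eq_Ioi, Finset.sum_filter]
  refine Finset.sum_congr rfl fun s _ => ?_
  split_ifs with h
  · simp only [← Finset.filter_lt_eq_Ioi, Finset.sum_filter, h, true_and]
  · simp only [h, false_and, if_false, Finset.sum_const_zero]

lemma sum_Ioi_eq_distinctSum [LocallyFiniteOrderTop ι] [Module ℂ E] {S : ι → ι → ι → E}
    (hrot : ∀ r s t, S s t r = S r s t) (hswap : ∀ r s t, S s r t = S r s t) :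
    ∑ r, ∑ s ∈ Finset.Ioi r, ∑ t ∈ Finset.Ioi s, S r s t = (6⁻¹ : ℂ) • distinctSum S := by
  rw [sum_Ioi_eq_sum_ite, distinctSum_eq_six_smul hrot hswap, ← ofNat_smul_eq_nsmul ℂ, smul_smul,
    inv_mul_cancel₀ (by norm_num), one_smul]

lemma sum_Ioi_add_add [LocallyFiniteOrderTop ι] [Module ℂ E] (hι : 2 ≤ Fintype.card ι)
    (φ : ι → E) : ∑ r, ∑ s ∈ Finset.Ioi r, ∑ t ∈ Finset.Ioi s, (φ r + φ s + φ t) =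
      (((Fintype.card ι : ℂ) - 1) * (Fintype.card ι - 2) / 2) • ∑ r, φ r := by
  rw [sum_Ioi_eq_distinctSum (S := fun r s t => φ r + φ s + φ t) (fun _ _ _ => by abel)
    (fun _ _ _ => by abel), distinctSum_add, distinctSum_add,
    distinctSum_rotate fun r _ _ : ι => φ r, ← distinctSum_rotate fun _ _ r : ι => φ r,
    distinctSum_fst hι]
  module

end TripleSums

/-! ### The curvature in terms of the branches -/

/-- The functions `τ i` are, over the open set `V`, the branches of the roots of the polynomial
`𝓐 + p 𝓑`, which are simple. -/
structure IsBranches (d : ℕ) (𝓐 𝓑 : Polynomial ℂ) (V : Set ℂ) (τ : Fin d → ℂ → ℂ) : Prop where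
  isOpen : IsOpen V
  differentiableOn : ∀ i, DifferentiableOn ℂ (τ i) V
  injective : ∀ p ∈ V, Function.Injective fun i => τ i p
  lead_ne : ∀ p ∈ V, 𝓐.coeff d + p * 𝓑.coeff d ≠ 0
  factor : ∀ p ∈ V, 𝓐 + Polynomial.C p * 𝓑 = Polynomial.C (𝓐.coeff d + p * 𝓑.coeff d) *
    ∏ i, (Polynomial.X - Polynomial.C (τ i p))

section Branches

variable {d : ℕ} {𝓐 𝓑 : Polynomial ℂ} {V : Set ℂ} {τ : Fin d → ℂ → ℂ}

lemma IsBranches.comp_equiv (h : IsBranches d 𝓐 𝓑 V τ) (σ : Equiv.Perm (Fin d)) :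
    IsBranches d 𝓐 𝓑 V fun i => τ (σ i) where
  isOpen := h.isOpen
  differentiableOn i := h.differentiableOn _
  injective p hp := (h.injective p hp).comp σ.injective
  lead_ne := h.lead_ne
  factor p hp := by
    rw [h.factor p hp, Equiv.prod_comp σ fun i => Polynomial.X - Polynomial.C (τ i p)]

lemma IsBranches.differentiableAt (h : IsBranches d 𝓐 𝓑 V τ) {p : ℂ} (hp : p ∈ V) (i : Fin d) :
    DifferentiableAt ℂ (τ i) p :=
  (h.differentiableOn i).differentiableAt (h.isOpen.mem_nhds hp)

lemma IsBranches.ne (h : IsBranches d 𝓐 𝓑 V τ) {p : ℂ} (hp : p ∈ V) {i j : Fin d} (hij : i ≠ j) :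
    τ i p ≠ τ j p :=
  (h.injective p hp).ne hij

/-- The fundamental form of the `3`-web given by the branches `r`, `s` and `t`. -/
noncomputable def branchTriple (κ : ℂ) (τ : Fin d → ℂ → ℂ) (r s t : Fin d) : OneForm := fun z =>
  (tripleCoeffP κ z.1 (τ r z.1) (τ s z.1) (τ t z.1) (deriv (τ r) z.1) (deriv (τ s) z.1)
      (deriv (τ t) z.1),
    tripleCoeff κ z.1 (τ r z.1) (τ s z.1) (τ t z.1) (deriv (τ r) z.1) (deriv (τ s) z.1)
      (deriv (τ t) z.1) / z.2)

/-- The coefficient of `dq / q` in the fundamental form, in terms of the branches. -/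
noncomputable def branchSum (κ : ℂ) (τ : Fin d → ℂ → ℂ) (p : ℂ) : ℂ :=
  6⁻¹ * distinctSum fun r s t => tripleCoeff κ p (τ r p) (τ s p) (τ t p) (deriv (τ r) p)
    (deriv (τ s) p) (deriv (τ t) p)

lemma branchSum_comp_equiv (κ : ℂ) (τ : Fin d → ℂ → ℂ) (σ : Equiv.Perm (Fin d)) :
    (branchSum κ fun i => τ (σ i)) = branchSum κ τ :=
  funext fun p => congrArg (6⁻¹ * ·) (distinctSum_comp_equiv σ fun r s t =>
    tripleCoeff κ p (τ r p) (τ s p) (τ t p) (deriv (τ r) p) (deriv (τ s) p) (deriv (τ t) p))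

lemma sum_branchTriple_snd (κ : ℂ) (τ : Fin d → ℂ → ℂ) (z : ℂ × ℂ) :
    (∑ r, ∑ s ∈ Finset.Ioi r, ∑ t ∈ Finset.Ioi s, branchTriple κ τ r s t z).2 =
      branchSum κ τ z.1 / z.2 := by
  have h := sum_Ioi_eq_distinctSum (S := fun r s t => tripleCoeff κ z.1 (τ r z.1) (τ s z.1)
    (τ t z.1) (deriv (τ r) z.1) (deriv (τ s) z.1) (deriv (τ t) z.1))
    (fun _ _ _ => tripleCoeff_rotate ..) fun _ _ _ => tripleCoeff_swap ..
  rw [branchSum, ← smul_eq_mul, ← h]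
  simp only [branchTriple, Prod.snd_sum, Finset.sum_div]

lemma IsBranches.differentiableAt_branchSum (h : IsBranches d 𝓐 𝓑 V τ) (κ : ℂ) {p : ℂ}
    (hp : p ∈ V) : DifferentiableAt ℂ (branchSum κ τ) p := by
  have hτ i := h.differentiableAt hp i
  have hτ' i : DifferentiableAt ℂ (deriv (τ i)) p :=
    ((h.differentiableOn i).deriv h.isOpen).differentiableAt (h.isOpen.mem_nhds hp)
  refine DifferentiableAt.const_mul (DifferentiableAt.fun_sum fun r _ =>
    DifferentiableAt.fun_sum fun s _ => DifferentiableAt.fun_sum fun t _ => ?_) _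
  split_ifs with hrst
  · have hne {i j k l : Fin d} (hij : i ≠ j) (hkl : k ≠ l) :
        (τ i p - τ j p) * (τ k p - τ l p) ≠ 0 :=
      mul_ne_zero (sub_ne_zero.2 (h.ne hp hij)) (sub_ne_zero.2 (h.ne hp hkl))
    have h₁ := hne hrst.1 hrst.2.2.symm
    have h₂ := hne hrst.1.symm hrst.2.1
    have h₃ := hne hrst.2.2 hrst.2.1.symm
    unfold tripleCoeff
    fun_prop (disch := assumption)
  · exact differentiableAt_const 0

lemma IsBranches.wedge_liftForm_ne_zero (h : IsBranches d 𝓐 𝓑 V τ) (κ : ℂ) {z : ℂ × ℂ}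
    (hzV : z.1 ∈ V) (hz : z.2 ≠ 0) {i j : Fin d} (hij : i ≠ j) :
    wedge (liftForm κ (τ i) z) (liftForm κ (τ j) z) ≠ 0 := by
  rw [wedge_liftForm]
  exact mul_ne_zero hz (sub_ne_zero.2 (h.ne hzV hij.symm))

lemma IsBranches.tripleAt_smul (h : IsBranches d 𝓐 𝓑 V τ) (κ : ℂ) {z : ℂ × ℂ} (hzV : z.1 ∈ V)
    (hz : z.2 ≠ 0) {f : Fin d → ℂ × ℂ → ℂ} (hf : ∀ i, DifferentiableAt ℂ (f i) z)
    (hf0 : ∀ i, f i z ≠ 0) {r s t : Fin d} (hrs : r ≠ s) (hst : s ≠ t) (htr : t ≠ r) :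
    TripleAt (fun w => f r w • liftForm κ (τ r) w) (fun w => f s w • liftForm κ (τ s) w)
      (fun w => f t w • liftForm κ (τ t) w)
      (branchTriple κ τ r s t z + (logDiffAt (f r) z + logDiffAt (f s) z + logDiffAt (f t) z)) z :=
  have hτ i := (h.differentiableAt hzV i).hasDerivAt
  have hlift i := differentiableAt_liftForm κ (h.differentiableAt hzV i)
  (tripleAt_liftForm (hτ r) (hτ s) (hτ t) (h.ne hzV hrs) (h.ne hzV hst) (h.ne hzV htr) hz).smul
    (hlift r) (hlift s) (hlift t) (hf r) (hf s) (hf t) (hf0 r) (hf0 s) (hf0 t)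

end Branches

lemma fderiv_comp_fst_vertical (F : ℂ → ℂ) (z : ℂ × ℂ) :
    fderiv ℂ (fun w : ℂ × ℂ => F w.1) z (0, 1) = 0 := by
  by_cases h : DifferentiableAt ℂ (fun w : ℂ × ℂ => F w.1) z
  · have hline : HasLineDerivAt ℂ (fun w : ℂ × ℂ => F w.1) 0 z (0, 1) := by
      unfold HasLineDerivAt
      simpa using hasDerivAt_const (0 : ℂ) (F z.1)
    exact (h.hasFDerivAt.hasLineDerivAt (0, 1)).unique hline
  · rw [fderiv_zero_of_not_differentiableAt h]
    rfl

lemma extD_eq_deriv_div {η : OneForm} {z : ℂ × ℂ} {F H : ℂ → ℂ}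
    (hH : DifferentiableAt ℂ H z.1) (hz : z.2 ≠ 0)
    (h : ∀ᶠ w in nhds z, η w = (F w.1, H w.1 / w.2)) : extD η z = deriv H z.1 / z.2 := by
  have hfst : HasFDerivAt (fun w : ℂ × ℂ => H w.1)
      (deriv H z.1 • ContinuousLinearMap.fst ℂ ℂ ℂ) z :=
    hH.hasDerivAt.comp_hasFDerivAt z hasFDerivAt_fst
  have hsnd : HasFDerivAt (fun w : ℂ × ℂ => w.2⁻¹)
      ((-(z.2 ^ 2)⁻¹) • ContinuousLinearMap.snd ℂ ℂ ℂ) z :=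
    (hasDerivAt_inv hz).comp_hasFDerivAt z hasFDerivAt_snd
  rw [extD_congr (β := fun w => (F w.1, H w.1 / w.2)) h]
  simp only [extD, fderiv_comp_fst_vertical, div_eq_mul_inv, (hfst.fun_mul hsnd).fderiv]
  simp [mul_comm]

lemma logDiffAt_add_mul_fst (α β : ℂ) (z : ℂ × ℂ) :
    logDiffAt (fun w => α + w.1 * β) z = (β / (α + z.1 * β), 0) := by
  have hp : HasFDerivAt (fun w : ℂ × ℂ => w.1) _ z := hasFDerivAt_fst (𝕜 := ℂ)
  rw [logDiffAt, diffAt, ((hp.mul_const β).const_add α).fderiv]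
  simp [div_eq_inv_mul]

/-- A tangent vector at `z` on which all the forms `liftForm κ τ` take the value `1`. -/
noncomputable def transversal (κ : ℂ) (z : ℂ × ℂ) : ℂ × ℂ := ((-κ * z.1 - 1) / z.2, -κ)

lemma pairing_liftForm_transversal (κ : ℂ) (f : ℂ → ℂ) {z : ℂ × ℂ} (hz : z.2 ≠ 0) :
    pairing (liftForm κ f z) (transversal κ z) = 1 := by
  simp only [pairing, liftForm, transversal]
  field_simp
  ring

lemma eq_pairing_smul_of_wedge_eq_zero {α β v : ℂ × ℂ} (hβ : pairing β v = 1)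
    (h : wedge β α = 0) : α = pairing α v • β := by
  simp only [wedge, pairing] at h hβ
  ext
  · simp only [pairing, Prod.smul_fst, smul_eq_mul]
    linear_combination -α.1 * hβ - v.2 * h
  · simp only [pairing, Prod.smul_snd, smul_eq_mul]
    linear_combination -α.2 * hβ + v.1 * h

lemma wedge_smul_smul_self (a b : ℂ) (α : ℂ × ℂ) : wedge (a • α) (b • α) = 0 := by
  simp only [wedge, Prod.smul_fst, Prod.smul_snd, smul_eq_mul]
  ring

lemma pairing_smul (c : ℂ) (α v : ℂ × ℂ) : pairing (c • α) v = c * pairing α v := by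
  simp only [pairing, Prod.smul_fst, Prod.smul_snd, smul_eq_mul]
  ring

section Curvature

variable {A B : MvPolynomial (Fin 2) ℂ} {d : ℕ} {κ : ℂ} {V : Set ℂ} {τ : Fin d → ℂ → ℂ}

lemma legForm_eq_prod (hA : A.IsHomogeneous d) (hB : B.IsHomogeneous d)
    (hτ : IsBranches d (dehom κ A) (dehom κ B) V τ) {z : ℂ × ℂ} (hz : z.1 ∈ V) (v : ℂ × ℂ) :
    legForm A B z v = ((dehom κ A).coeff d + z.1 * (dehom κ B).coeff d) *
      ∏ i, pairing (liftForm κ (τ i) z) v := by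
  have hfactor := eq_C_mul_prod_lineForm (κ := κ) (hA.add (hB.C_mul z.1))
    (by rw [map_add, map_mul, dehom_C, hτ.factor _ hz])
  have heval := congrArg (eval ![v.2, z.1 * v.2 - z.2 * v.1]) hfactor
  simp only [map_add, map_mul, map_prod, eval_C, eval_lineForm] at heval
  rw [legForm, heval]
  congr 1
  refine Finset.prod_congr rfl fun i _ => ?_
  simp only [pairing, liftForm]
  ring

variable {U : Set (ℂ × ℂ)} {ω : Fin d → OneForm} {z : ℂ × ℂ}

lemma IsDecomposition.ne_zero {F : SymForm} (hω : IsDecomposition d F U ω) (hd : 2 ≤ d)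
    (hz : z ∈ U) (i : Fin d) : ω i z ≠ 0 := by
  have : Nontrivial (Fin d) := Fin.nontrivial_iff_two_le.2 hd
  obtain ⟨j, hj⟩ := exists_ne i
  intro h0
  apply hω.transverse z hz i j hj.symm
  rw [h0, wedge, Prod.fst_zero, Prod.snd_zero, zero_mul, zero_mul, sub_zero]

lemma IsDecomposition.exists_wedge_eq_zero (hω : IsDecomposition d (legForm A B) U ω)
    (hA : A.IsHomogeneous d) (hB : B.IsHomogeneous d)
    (hτ : IsBranches d (dehom κ A) (dehom κ B) V τ) (hzU : z ∈ U) (hzV : z.1 ∈ V)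
    (i : Fin d) : ∃ j, wedge (liftForm κ (τ j) z) (ω i z) = 0 := by
  have h := legForm_eq_prod hA hB hτ hzV ((ω i z).2, -(ω i z).1)
  rw [hω.factor z hzU, Finset.prod_eq_zero (Finset.mem_univ i) (by simp only [pairing]; ring)] at h
  have h := (mul_eq_zero.1 h.symm).resolve_left (hτ.lead_ne _ hzV)
  obtain ⟨j, -, hj⟩ := Finset.prod_eq_zero_iff.1 h
  refine ⟨j, ?_⟩
  simp only [pairing, wedge] at hj ⊢
  linear_combination hj

lemma IsDecomposition.eventually_wedge_ne_zero {F : SymForm} {𝓐 𝓑 : Polynomial ℂ}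
    (hω : IsDecomposition d F U ω) (hd : 2 ≤ d) (hτ : IsBranches d 𝓐 𝓑 V τ) (hzU : z ∈ U)
    (hzV : z.1 ∈ V) (hz : z.2 ≠ 0) {i j : Fin d} (hij : j ≠ i)
    (h : wedge (liftForm κ (τ i) z) (ω i z) = 0) :
    ∀ᶠ w in nhds z, wedge (liftForm κ (τ j) w) (ω i w) ≠ 0 := by
  have hcont : ContinuousAt (fun w => wedge (liftForm κ (τ j) w) (ω i w)) z := by
    have h₁ := (differentiableAt_liftForm κ (hτ.differentiableAt hzV j)).continuousAt
    have h₂ := (hω.analytic i z hzU).continuousAt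
    exact (h₁.fst.mul h₂.snd).sub (h₁.snd.mul h₂.fst)
  have hsmul := eq_pairing_smul_of_wedge_eq_zero (pairing_liftForm_transversal κ (τ i) hz) h
  refine hcont.eventually_ne ?_
  rw [hsmul, wedge_smul_right]
  refine mul_ne_zero (fun h0 => hω.ne_zero hd hzU i ?_) (hτ.wedge_liftForm_ne_zero κ hzV hz hij)
  rw [hsmul, h0, zero_smul]

lemma IsDecomposition.eventually_wedge_eq_zero (hω : IsDecomposition d (legForm A B) U ω)
    (hd : 2 ≤ d) (hA : A.IsHomogeneous d) (hB : B.IsHomogeneous d)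
    (hτ : IsBranches d (dehom κ A) (dehom κ B) V τ) (hU : IsOpen U) (hzU : z ∈ U)
    (hzV : z.1 ∈ V) (hz : z.2 ≠ 0) (h : ∀ i, wedge (liftForm κ (τ i) z) (ω i z) = 0) :
    ∀ᶠ w in nhds z, ∀ i, wedge (liftForm κ (τ i) w) (ω i w) = 0 := by
  have hne : ∀ᶠ w in nhds z, ∀ i j, j ≠ i → wedge (liftForm κ (τ j) w) (ω i w) ≠ 0 := by
    simp only [Filter.eventually_all]
    exact fun i j hij => hω.eventually_wedge_ne_zero hd hτ hzU hzV hz hij (h i)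
  filter_upwards [hU.mem_nhds hzU, continuousAt_fst.eventually (hτ.isOpen.mem_nhds hzV), hne]
    with w hwU hwV hne i
  obtain ⟨j, hj⟩ := hω.exists_wedge_eq_zero hA hB hτ hwU hwV i
  obtain rfl : j = i := by_contra fun hji => hne i j hji hj
  exact hj

/-- The coefficient of `dp` in the fundamental form, in terms of the branches. -/
noncomputable def branchSumP (κ : ℂ) (𝓐 𝓑 : Polynomial ℂ) (τ : Fin d → ℂ → ℂ) (p : ℂ) : ℂ :=
  (∑ r, ∑ s ∈ Finset.Ioi r, ∑ t ∈ Finset.Ioi s, branchTriple κ τ r s t (p, 0)).1 +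
    (d - 1) * (d - 2) / 2 * (𝓑.coeff d / (𝓐.coeff d + p * 𝓑.coeff d))

lemma sum_branchTriple_add (hd : 2 ≤ d) (κ : ℂ) (τ : Fin d → ℂ → ℂ) (φ : Fin d → ℂ × ℂ)
    (z : ℂ × ℂ) :
    ∑ r, ∑ s ∈ Finset.Ioi r, ∑ t ∈ Finset.Ioi s,
        (branchTriple κ τ r s t z + (φ r + φ s + φ t)) =
      ∑ r, ∑ s ∈ Finset.Ioi r, ∑ t ∈ Finset.Ioi s, branchTriple κ τ r s t z +
        (((d : ℂ) - 1) * (d - 2) / 2) • ∑ i, φ i := by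
  simp only [Finset.sum_add_distrib (f := fun t => branchTriple κ τ _ _ t z),
    Finset.sum_add_distrib (f := fun s => ∑ t ∈ _, branchTriple κ τ _ s t z),
    Finset.sum_add_distrib (f := fun r => ∑ s ∈ _, ∑ t ∈ _, branchTriple κ τ r s t z)]
  rw [sum_Ioi_add_add (by rwa [Fintype.card_fin]) φ, Fintype.card_fin]

lemma IsDecomposition.sum_logDiffAt (hω : IsDecomposition d (legForm A B) U ω)
    (hA : A.IsHomogeneous d) (hB : B.IsHomogeneous d)
    (hτ : IsBranches d (dehom κ A) (dehom κ B) V τ) (hU : IsOpen U) (hzU : z ∈ U)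
    (hzV : z.1 ∈ V) (hz : z.2 ≠ 0)
    (hd : ∀ i, DifferentiableAt ℂ (fun w => pairing (ω i w) (transversal κ w)) z)
    (h0 : ∀ i, pairing (ω i z) (transversal κ z) ≠ 0) :
    ∑ i, logDiffAt (fun w => pairing (ω i w) (transversal κ w)) z =
      ((dehom κ B).coeff d / ((dehom κ A).coeff d + z.1 * (dehom κ B).coeff d), 0) := by
  have hprod : (fun w => ∏ i, pairing (ω i w) (transversal κ w)) =ᶠ[nhds z]
      fun w => (dehom κ A).coeff d + w.1 * (dehom κ B).coeff d := by
    filter_upwards [hU.mem_nhds hzU, continuousAt_fst.eventually (hτ.isOpen.mem_nhds hzV),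
      continuousAt_snd.eventually_ne hz] with w hwU hwV hw2
    rw [← hω.factor w hwU, legForm_eq_prod hA hB hτ hwV]
    simp only [pairing_liftForm_transversal κ _ hw2, Finset.prod_const_one, mul_one]
  rw [← logDiffAt_prod (fun i _ => hd i) (fun i _ => h0 i), logDiffAt_congr hprod,
    logDiffAt_add_mul_fst]

lemma differentiableAt_pairing_transversal {α : OneForm} (hα : DifferentiableAt ℂ α z)
    (hz : z.2 ≠ 0) : DifferentiableAt ℂ (fun w => pairing (α w) (transversal κ w)) z := by
  have h : DifferentiableAt ℂ (fun w : ℂ × ℂ => (-κ * w.1 - 1) / w.2) z := by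
    clear hα
    fun_prop (disch := assumption)
  exact (hα.fst.fun_mul h).fun_add (hα.snd.fun_mul (differentiableAt_const _))

lemma IsFundamentalForm.eq_branchSum {η : OneForm} (hη : IsFundamentalForm d U ω η) (hd : 2 ≤ d)
    (hA : A.IsHomogeneous d) (hB : B.IsHomogeneous d)
    (hτ : IsBranches d (dehom κ A) (dehom κ B) V τ) (hU : IsOpen U)
    (hω : IsDecomposition d (legForm A B) U ω) (hzU : z ∈ U) (hzV : z.1 ∈ V) (hz : z.2 ≠ 0)
    (h : ∀ᶠ w in nhds z, ∀ i, wedge (liftForm κ (τ i) w) (ω i w) = 0) :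
    η z = (branchSumP κ (dehom κ A) (dehom κ B) τ z.1, branchSum κ τ z.1 / z.2) := by
  obtain ⟨θ, hθ, hηθ⟩ := hη
  set f : Fin d → ℂ × ℂ → ℂ := fun i w => pairing (ω i w) (transversal κ w)
  have hωf i : ω i =ᶠ[nhds z] fun w => f i w • liftForm κ (τ i) w := by
    filter_upwards [h, continuousAt_snd.eventually_ne hz] with w hw hw2
    exact eq_pairing_smul_of_wedge_eq_zero (pairing_liftForm_transversal κ (τ i) hw2) (hw i)
  have hf0 i : f i z ≠ 0 := fun h0 => hω.ne_zero hd hzU i <| by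
    rw [(hωf i).eq_of_nhds, h0, zero_smul]
  have hfd i : DifferentiableAt ℂ (f i) z :=
    differentiableAt_pairing_transversal (hω.analytic i z hzU).differentiableAt hz
  have hθz {r s t : Fin d} (hrs : r < s) (hst : s < t) : θ r s t z =
      branchTriple κ τ r s t z + (logDiffAt (f r) z + logDiffAt (f s) z + logDiffAt (f t) z) :=
    TripleAt.unique (hθ r s t hrs hst z hzU)
      ((hτ.tripleAt_smul κ hzV hz hfd hf0 hrs.ne hst.ne (hrs.trans hst).ne').congr
        (hωf r) (hωf s) (hωf t))
      (hω.transverse z hzU _ _ hrs.ne) (hω.transverse z hzU _ _ hst.ne)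
      (hω.transverse z hzU _ _ (hrs.trans hst).ne')
  have hηz := (hηθ z hzU).trans <| Finset.sum_congr rfl fun r _ => Finset.sum_congr rfl fun s hs =>
    Finset.sum_congr rfl fun t ht => hθz (Finset.mem_Ioi.1 hs) (Finset.mem_Ioi.1 ht)
  rw [hηz, sum_branchTriple_add hd, hω.sum_logDiffAt hA hB hτ hU hzU hzV hz hfd hf0]
  ext
  · simp only [branchSumP, branchTriple, Prod.fst_add, Prod.smul_fst, Prod.fst_sum, smul_eq_mul]
  · rw [Prod.snd_add, sum_branchTriple_snd, Prod.smul_snd, smul_zero, add_zero]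

lemma IsFundamentalForm.extD_eq_deriv_branchSum {η : OneForm} (hη : IsFundamentalForm d U ω η)
    (hd : 2 ≤ d) (hA : A.IsHomogeneous d) (hB : B.IsHomogeneous d)
    (hτ : IsBranches d (dehom κ A) (dehom κ B) V τ) (hU : IsOpen U)
    (hω : IsDecomposition d (legForm A B) U ω) (hzU : z ∈ U) (hzV : z.1 ∈ V) (hz : z.2 ≠ 0)
    (h : ∀ i, wedge (liftForm κ (τ i) z) (ω i z) = 0) :
    extD η z = deriv (branchSum κ τ) z.1 / z.2 := by
  refine extD_eq_deriv_div (F := branchSumP κ (dehom κ A) (dehom κ B) τ)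
    (hτ.differentiableAt_branchSum κ hzV) hz ?_
  filter_upwards [(hω.eventually_wedge_eq_zero hd hA hB hτ hU hzU hzV hz h).eventually_nhds,
    hU.mem_nhds hzU, continuousAt_fst.eventually (hτ.isOpen.mem_nhds hzV),
    continuousAt_snd.eventually_ne hz] with w hw hwU hwV hw2
  exact hη.eq_branchSum hd hA hB hτ hU hω hwU hwV hw2 hw

lemma IsCurvatureAt.eq_deriv_branchSum {k : ℂ} (hk : IsCurvatureAt d (legForm A B) z k)
    (hd : 2 ≤ d) (hA : A.IsHomogeneous d) (hB : B.IsHomogeneous d)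
    (hτ : IsBranches d (dehom κ A) (dehom κ B) V τ) (hzV : z.1 ∈ V) (hz : z.2 ≠ 0) :
    k = deriv (branchSum κ τ) z.1 / z.2 := by
  obtain ⟨U, hU, hzU, ω, η, hω, hη, rfl⟩ := hk
  choose σ hσ using fun i => hω.exists_wedge_eq_zero hA hB hτ hzU hzV i
  have hsmul i :=
    eq_pairing_smul_of_wedge_eq_zero (pairing_liftForm_transversal κ (τ (σ i)) hz) (hσ i)
  have hinj : Function.Injective σ := by
    intro i j hij
    by_contra hne
    apply hω.transverse z hzU i j hne
    rw [hsmul i, hsmul j, hij]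
    exact wedge_smul_smul_self _ _ _
  let e : Equiv.Perm (Fin d) := Equiv.ofBijective σ (Finite.injective_iff_bijective.1 hinj)
  rw [← branchSum_comp_equiv κ τ e]
  exact hη.extD_eq_deriv_branchSum hd hA hB (hτ.comp_equiv e) hU hω hzU hzV hz hσ

lemma analyticOnNhd_liftForm (κ : ℂ) {f : ℂ → ℂ} (hV : IsOpen V) (hf : DifferentiableOn ℂ f V) :
    AnalyticOnNhd ℂ (liftForm κ f) {w | w.1 ∈ V ∧ w.2 ≠ 0} := by
  intro z hz
  have hfz : AnalyticAt ℂ (fun w : ℂ × ℂ => f w.1) z :=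
    AnalyticAt.comp (f := Prod.fst) (hf.analyticAt (hV.mem_nhds hz.1)) analyticAt_fst
  exact (analyticAt_snd.neg.mul (analyticAt_const.sub (analyticAt_const.mul hfz))).prod
    ((analyticAt_fst.mul (analyticAt_const.sub (analyticAt_const.mul hfz))).sub hfz)

lemma exists_isDecomposition (hd : d ≠ 0) (hA : A.IsHomogeneous d) (hB : B.IsHomogeneous d)
    (hτ : IsBranches d (dehom κ A) (dehom κ B) V τ) :
    ∃ f : Fin d → ℂ × ℂ → ℂ, (∀ i w, w.1 ∈ V → f i w ≠ 0) ∧ (∀ i, Differentiable ℂ (f i)) ∧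
      IsDecomposition d (legForm A B) {w | w.1 ∈ V ∧ w.2 ≠ 0}
        fun i w => f i w • liftForm κ (τ i) w := by
  set lead : ℂ × ℂ → ℂ := fun w => (dehom κ A).coeff d + w.1 * (dehom κ B).coeff d with hlead
  let i₀ : Fin d := ⟨0, Nat.pos_of_ne_zero hd⟩
  have hne : ∀ i w, w.1 ∈ V → (if i = i₀ then lead w else 1) ≠ 0 := by
    intro i w hw
    split_ifs
    exacts [hτ.lead_ne _ hw, one_ne_zero]
  have han (i : Fin d) (w : ℂ × ℂ) : AnalyticAt ℂ (fun w => if i = i₀ then lead w else 1) w := by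
    split_ifs
    exacts [analyticAt_const.add (analyticAt_fst.mul analyticAt_const), analyticAt_const]
  refine ⟨fun i w => if i = i₀ then lead w else 1, hne,
    fun i w => (han i w).differentiableAt,
    ⟨fun i w hw => ?_, fun w hw i j hij => ?_, fun w hw v => ?_⟩⟩
  · exact (han i w).smul (analyticOnNhd_liftForm κ hτ.isOpen (hτ.differentiableOn i) w hw)
  · rw [wedge_smul_left, wedge_smul_right]
    exact mul_ne_zero (hne i w hw.1)
      (mul_ne_zero (hne j w hw.1) (hτ.wedge_liftForm_ne_zero κ hw.1 hw.2 hij))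
  · simp only [legForm_eq_prod hA hB hτ hw.1, pairing_smul, Finset.prod_mul_distrib,
      Finset.prod_ite_eq', Finset.mem_univ, if_true, hlead]

lemma isCurvatureAt_deriv_branchSum (hd : 2 ≤ d) (hA : A.IsHomogeneous d)
    (hB : B.IsHomogeneous d) (hτ : IsBranches d (dehom κ A) (dehom κ B) V τ) (hzV : z.1 ∈ V)
    (hz : z.2 ≠ 0) : IsCurvatureAt d (legForm A B) z (deriv (branchSum κ τ) z.1 / z.2) := by
  obtain ⟨f, hf0, hfd, hω⟩ := exists_isDecomposition (by omega) hA hB hτ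
  set θ : Fin d → Fin d → Fin d → OneForm := fun r s t w =>
    branchTriple κ τ r s t w + (logDiffAt (f r) w + logDiffAt (f s) w + logDiffAt (f t) w)
  have hU : IsOpen {w : ℂ × ℂ | w.1 ∈ V ∧ w.2 ≠ 0} :=
    (hτ.isOpen.preimage continuous_fst).inter (isOpen_ne.preimage continuous_snd)
  have hη : IsFundamentalForm d {w : ℂ × ℂ | w.1 ∈ V ∧ w.2 ≠ 0}
      (fun i w => f i w • liftForm κ (τ i) w)
      fun w => ∑ r, ∑ s ∈ Finset.Ioi r, ∑ t ∈ Finset.Ioi s, θ r s t w :=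
    ⟨θ, fun r s t hrs hst w hw => hτ.tripleAt_smul κ hw.1 hw.2 (fun i => hfd i w)
      (fun i => hf0 i w hw.1) hrs.ne hst.ne (hrs.trans hst).ne', fun _ _ => rfl⟩
  refine ⟨_, hU, ⟨hzV, hz⟩, _, _, hω, hη,
    (hη.extD_eq_deriv_branchSum hd hA hB hτ hU hω ⟨hzV, hz⟩ hzV hz fun i => ?_).symm⟩
  simpa only [one_smul] using wedge_smul_smul_self 1 (f i z) (liftForm κ (τ i) z)

lemma notMem_discriminantLocus (hd : d ≠ 0) (hA : A.IsHomogeneous d) (hB : B.IsHomogeneous d)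
    (hτ : IsBranches d (dehom κ A) (dehom κ B) V τ) (hzV : z.1 ∈ V) (hz : z.2 ≠ 0) :
    z ∉ discriminantLocus d (legForm A B) := by
  obtain ⟨f, -, -, hω⟩ := exists_isDecomposition hd hA hB hτ
  exact not_not.2 ⟨_, hω.transverse z ⟨hzV, hz⟩, hω.factor z ⟨hzV, hz⟩⟩

end Curvature

/-! ### The curvature as a trace -/

section RootSums

lemma sum_sum_erase_mul {ι R : Type*} [DecidableEq ι] [CommRing R] (S : Finset ι) (u : ι → R) :
    ∑ s ∈ S, ∑ t ∈ S.erase s, u s * u t = (∑ s ∈ S, u s) ^ 2 - ∑ s ∈ S, u s ^ 2 := by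
  rw [sq, Finset.sum_mul_sum, ← Finset.sum_sub_distrib]
  refine Finset.sum_congr rfl fun s hs => ?_
  rw [← Finset.add_sum_erase S _ hs]
  ring

section DerivativesAtRoots

variable {K : Type*} [Field K]

lemma sum_roots_eq {ι : Type*} [Fintype ι] {τ : ι → K} {c : K} {f : Polynomial K}
    (hτ : Function.Injective τ) (hc : c ≠ 0)
    (hf : f = Polynomial.C c * ∏ s, (Polynomial.X - Polynomial.C (τ s))) (g : K → K)
    [DecidableEq K] :
    ∑ x ∈ f.roots.toFinset, g x = ∑ i, g (τ i) := by
  have himage : f.roots.toFinset = Finset.univ.image τ := by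
    rw [hf, Polynomial.roots_C_mul _ hc, Polynomial.roots_prod _ _
      (Finset.prod_ne_zero_iff.2 fun s _ => Polynomial.X_sub_C_ne_zero (τ s))]
    ext x
    simp [eq_comm]
  rw [himage, Finset.sum_image hτ.injOn]

lemma eval_derivative_X_sub_C_mul (a : K) (g : Polynomial K) :
    ((Polynomial.X - Polynomial.C a) * g).derivative.eval a = g.eval a := by
  simp

lemma eval_derivative_derivative_X_sub_C_mul (a : K) (g : Polynomial K) :
    ((Polynomial.X - Polynomial.C a) * g).derivative.derivative.eval a =
      2 * g.derivative.eval a := by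
  simp [two_mul]

lemma eval_derivative_derivative_derivative_X_sub_C_mul (a : K) (g : Polynomial K) :
    ((Polynomial.X - Polynomial.C a) * g).derivative.derivative.derivative.eval a =
      3 * g.derivative.derivative.eval a := by
  simp only [Polynomial.derivative_mul, Polynomial.derivative_sub, Polynomial.derivative_X,
    Polynomial.derivative_C, Polynomial.derivative_add, Polynomial.eval_add, Polynomial.eval_mul,
    Polynomial.eval_sub, Polynomial.eval_X, Polynomial.eval_C, sub_zero, one_mul, sub_self,
    zero_mul, add_zero]
  ring

variable {ι : Type*} {τ : ι → K}

lemma eval_derivative_prod_X_sub_C (S : Finset ι) {x : K} (hx : ∀ s ∈ S, x ≠ τ s) :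
    (Polynomial.derivative (∏ s ∈ S, (Polynomial.X - Polynomial.C (τ s)))).eval x =
      (∏ s ∈ S, (x - τ s)) * ∑ s ∈ S, (x - τ s)⁻¹ := by
  classical
  rw [Polynomial.derivative_prod_finset]
  simp only [Polynomial.derivative_X_sub_C, mul_one, Polynomial.eval_finsetSum,
    Polynomial.eval_prod, Polynomial.eval_sub, Polynomial.eval_X, Polynomial.eval_C,
    Finset.mul_sum]
  refine Finset.sum_congr rfl fun s hs => ?_
  rw [← Finset.prod_erase_mul S _ hs, mul_inv_cancel_right₀ (sub_ne_zero.2 (hx s hs))]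

lemma eval_derivative_derivative_prod_X_sub_C (S : Finset ι) {x : K} (hx : ∀ s ∈ S, x ≠ τ s) :
    (Polynomial.derivative (Polynomial.derivative
      (∏ s ∈ S, (Polynomial.X - Polynomial.C (τ s))))).eval x =
      (∏ s ∈ S, (x - τ s)) * ((∑ s ∈ S, (x - τ s)⁻¹) ^ 2 - ∑ s ∈ S, (x - τ s)⁻¹ ^ 2) := by
  classical
  rw [← sum_sum_erase_mul, Polynomial.derivative_prod_finset]
  simp only [Polynomial.derivative_X_sub_C, mul_one, Polynomial.derivative_sum,
    Polynomial.eval_finsetSum, Finset.mul_sum]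
  refine Finset.sum_congr rfl fun s hs => ?_
  rw [eval_derivative_prod_X_sub_C (S.erase s) fun t ht => hx t (Finset.mem_of_mem_erase ht),
    ← Finset.prod_erase_mul S _ hs, ← Finset.mul_sum, ← Finset.mul_sum, mul_assoc,
    mul_inv_cancel_left₀ (sub_ne_zero.2 (hx s hs))]

variable [Fintype ι] [DecidableEq ι] {c : K} {f : Polynomial K}

lemma eval_derivatives_at_root (hτ : Function.Injective τ) (hc : c ≠ 0)
    (hf : f = Polynomial.C c * ∏ s, (Polynomial.X - Polynomial.C (τ s))) (r : ι) :
    f.derivative.eval (τ r) ≠ 0 ∧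
    f.derivative.derivative.eval (τ r) =
      f.derivative.eval (τ r) * (2 * ∑ s ∈ Finset.univ.erase r, (τ r - τ s)⁻¹) ∧
    f.derivative.derivative.derivative.eval (τ r) =
      f.derivative.eval (τ r) * (3 * ((∑ s ∈ Finset.univ.erase r, (τ r - τ s)⁻¹) ^ 2 -
        ∑ s ∈ Finset.univ.erase r, (τ r - τ s)⁻¹ ^ 2)) := by
  have hne : ∀ s ∈ Finset.univ.erase r, τ r ≠ τ s :=
    fun s hs => hτ.ne (Finset.ne_of_mem_erase hs).symm
  rw [hf, ← Finset.mul_prod_erase Finset.univ _ (Finset.mem_univ r)]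
  simp only [Polynomial.derivative_C_mul, Polynomial.eval_C_mul, eval_derivative_X_sub_C_mul,
    eval_derivative_derivative_X_sub_C_mul, eval_derivative_derivative_derivative_X_sub_C_mul,
    eval_derivative_prod_X_sub_C _ hne, eval_derivative_derivative_prod_X_sub_C _ hne,
    Polynomial.eval_prod, Polynomial.eval_sub, Polynomial.eval_X, Polynomial.eval_C]
  exact ⟨mul_ne_zero hc (Finset.prod_ne_zero_iff.2 fun s hs => sub_ne_zero.2 (hne s hs)),
    by ring, by ring⟩

end DerivativesAtRoots

/-- Half the sum of `(m_s / (t - s)) (m_{s'} / (t - s'))` over the pairs of distinct roots `s, s'`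
of `f` other than the root `t`, where `m_s = p (1 - κ s) - s`, expressed through `f`. -/
noncomputable def rootTerm (d : ℕ) (κ p : ℂ) (f : Polynomial ℂ) (t : ℂ) : ℂ :=
  (p * (1 - κ * t) - t) ^ 2 *
      (f.derivative.derivative.derivative.eval t / (6 * f.derivative.eval t)) +
    (d - 2) * (κ * p + 1) * (p * (1 - κ * t) - t) *
      (f.derivative.derivative.eval t / (2 * f.derivative.eval t)) +
    (d - 1) * (d - 2) / 2 * (κ * p + 1) ^ 2

lemma sum_sum_eq_rootTerm {d : ℕ} (κ p : ℂ) {τ : Fin d → ℂ} {c : ℂ} {f : Polynomial ℂ}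
    (hτ : Function.Injective τ) (hc : c ≠ 0)
    (hf : f = Polynomial.C c * ∏ s, (Polynomial.X - Polynomial.C (τ s))) (r : Fin d) :
    ∑ s ∈ Finset.univ.erase r, ∑ t ∈ (Finset.univ.erase r).erase s,
      (p * (1 - κ * τ s) - τ s) / (τ r - τ s) * ((p * (1 - κ * τ t) - τ t) / (τ r - τ t)) =
        2 * rootTerm d κ p f (τ r) := by
  obtain ⟨h₁, h₂, h₃⟩ := eval_derivatives_at_root hτ hc hf r
  have hcard : ((Finset.univ.erase r).card : ℂ) = d - 1 := by
    rw [Finset.card_erase_of_mem (Finset.mem_univ _), Finset.card_univ, Fintype.card_fin,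
      Nat.cast_sub r.pos, Nat.cast_one]
  have hterm (s : Fin d) (hs : s ∈ Finset.univ.erase r) :
      (p * (1 - κ * τ s) - τ s) / (τ r - τ s) =
        (κ * p + 1) + (p * (1 - κ * τ r) - τ r) * (τ r - τ s)⁻¹ := by
    have := sub_ne_zero.2 (hτ.ne (Finset.ne_of_mem_erase hs).symm)
    field_simp
    ring
  rw [sum_sum_erase_mul, Finset.sum_congr rfl hterm,
    Finset.sum_congr rfl fun s hs => congrArg (· ^ 2) (hterm s hs)]
  simp only [add_sq, mul_pow, Finset.sum_add_distrib, ← Finset.mul_sum, ← mul_assoc,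
    Finset.sum_const, nsmul_eq_mul, hcard]
  rw [rootTerm, h₂, h₃]
  field_simp
  ring

variable {d : ℕ} {κ : ℂ} {𝓐 𝓑 : Polynomial ℂ} {V : Set ℂ} {τ : Fin d → ℂ → ℂ}

lemma IsBranches.eval_derivative_ne_zero (h : IsBranches d 𝓐 𝓑 V τ) {p : ℂ} (hp : p ∈ V)
    (i : Fin d) : (𝓐 + Polynomial.C p * 𝓑).derivative.eval (τ i p) ≠ 0 :=
  (eval_derivatives_at_root (h.injective p hp) (h.lead_ne p hp) (h.factor p hp) i).1

lemma IsBranches.eval_eq_zero (h : IsBranches d 𝓐 𝓑 V τ) {p : ℂ} (hp : p ∈ V) (i : Fin d) :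
    𝓐.eval (τ i p) + p * 𝓑.eval (τ i p) = 0 := by
  have := congrArg (Polynomial.eval (τ i p)) (h.factor p hp)
  rw [Polynomial.eval_mul, Polynomial.eval_prod, Finset.prod_eq_zero (Finset.mem_univ i) (by simp),
    mul_zero] at this
  rwa [Polynomial.eval_add, Polynomial.eval_C_mul] at this

lemma IsBranches.deriv_eq (h : IsBranches d 𝓐 𝓑 V τ) {p : ℂ} (hp : p ∈ V) (i : Fin d) :
    deriv (τ i) p = -𝓑.eval (τ i p) / (𝓐 + Polynomial.C p * 𝓑).derivative.eval (τ i p) := by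
  have hτ := (h.differentiableAt hp i).hasDerivAt
  have hderiv : HasDerivAt (fun p => 𝓐.eval (τ i p) + p * 𝓑.eval (τ i p)) _ p :=
    ((𝓐.hasDerivAt _).comp p hτ).add ((hasDerivAt_id p).mul ((𝓑.hasDerivAt _).comp p hτ))
  have hzero : (fun p => 𝓐.eval (τ i p) + p * 𝓑.eval (τ i p)) =ᶠ[nhds p] fun _ => 0 :=
    Filter.eventually_of_mem (h.isOpen.mem_nhds hp) fun p' hp' => h.eval_eq_zero hp' i
  have h0 := hderiv.unique ((hasDerivAt_const p (0 : ℂ)).congr_of_eventuallyEq hzero)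
  rw [eq_div_iff (h.eval_derivative_ne_zero hp i)]
  simp only [Polynomial.derivative_add, Polynomial.derivative_C_mul, Polynomial.eval_add,
    Polynomial.eval_mul, Polynomial.eval_C, id] at h0 ⊢
  linear_combination h0

/-- The trace of the differential `R dt` along the fibres of `t ↦ -𝓐(t) / 𝓑(t)`, as a coefficient
of `dp`: at a root `t` of `f = 𝓐 + p 𝓑` one has `dt / dp = -𝓑(t) / f'(t)`. -/
noncomputable def fibreTrace (𝓐 𝓑 : Polynomial ℂ) (R : ℂ → ℂ) (p : ℂ) : ℂ :=
  ∑ t ∈ (𝓐 + Polynomial.C p * 𝓑).roots.toFinset,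
    -𝓑.eval t / (𝓐 + Polynomial.C p * 𝓑).derivative.eval t * R t

/-- The part of `branchSum κ τ p` that is not constant in `p`, expressed through the polynomial
`𝓐 + p 𝓑` of which the branches `τ` are the roots. -/
noncomputable def rootSum (d : ℕ) (κ : ℂ) (𝓐 𝓑 : Polynomial ℂ) (p : ℂ) : ℂ :=
  fibreTrace 𝓐 𝓑 (rootTerm d κ p (𝓐 + Polynomial.C p * 𝓑)) p

lemma IsBranches.distinctSum_eq_rootSum (h : IsBranches d 𝓐 𝓑 V τ) (κ : ℂ) {p : ℂ}
    (hp : p ∈ V) :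
    distinctSum (fun r s t => deriv (τ r) p * ((p * (1 - κ * τ s p) - τ s p) / (τ r p - τ s p) *
      ((p * (1 - κ * τ t p) - τ t p) / (τ r p - τ t p)))) = 2 * rootSum d κ 𝓐 𝓑 p := by
  rw [distinctSum_eq_sum_erase, rootSum, fibreTrace,
    sum_roots_eq (h.injective p hp) (h.lead_ne p hp) (h.factor p hp), Finset.mul_sum]
  refine Finset.sum_congr rfl fun r _ => ?_
  have hr := sum_sum_eq_rootTerm κ p (h.injective p hp) (h.lead_ne p hp) (h.factor p hp) r
  calc _ = deriv (τ r) p * (2 * rootTerm d κ p (𝓐 + Polynomial.C p * 𝓑) (τ r p)) := by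
        rw [← hr]
        simp only [Finset.mul_sum]
    _ = _ := by
        rw [h.deriv_eq hp]
        ring

lemma IsBranches.branchSum_eq (hd : 2 ≤ d) (h : IsBranches d 𝓐 𝓑 V τ) {p : ℂ} (hp : p ∈ V) :
    branchSum κ τ p = d * (d - 1) * (d - 2) / 2 - rootSum d κ 𝓐 𝓑 p := by
  set G : Fin d → Fin d → Fin d → ℂ := fun r s t => deriv (τ r) p *
    ((p * (1 - κ * τ s p) - τ s p) / (τ r p - τ s p) *
      ((p * (1 - κ * τ t p) - τ t p) / (τ r p - τ t p)))
  have hG : distinctSum (fun r s t => -G r s t) = -(2 * rootSum d κ 𝓐 𝓑 p) := by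
    rw [← h.distinctSum_eq_rootSum κ hp]
    simp only [distinctSum_eq_sum_erase, Finset.sum_neg_distrib]
    rfl
  have hthree : distinctSum (fun _ _ _ : Fin d => (3 : ℂ)) = 3 * d * (d - 1) * (d - 2) := by
    rw [distinctSum_fst (by rwa [Fintype.card_fin]) fun _ => (3 : ℂ)]
    simp only [Fintype.card_fin, Finset.sum_const, Finset.card_univ, nsmul_eq_mul, smul_eq_mul]
    ring
  have hsplit : distinctSum (fun r s t => tripleCoeff κ p (τ r p) (τ s p) (τ t p) (deriv (τ r) p)
      (deriv (τ s) p) (deriv (τ t) p)) =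
        distinctSum fun r s t => 3 + (-G r s t + -G s t r + -G t r s) := by
    refine distinctSum_congr fun r s t _ _ _ => ?_
    simp only [tripleCoeff, G, div_mul_div_comm]
    ring
  rw [branchSum, hsplit, distinctSum_add, distinctSum_add, distinctSum_add,
    distinctSum_rotate fun r s t => -G r s t, ← distinctSum_rotate fun r s t => -G t r s, hG,
    hthree]
  ring

end RootSums

/-! ### Residues of the traced differential -/

section LocalResidue

/-- The cofactor of `(X - ρ) ^ ν` in `(X - ρ) ^ k` times the `k`-th derivative of
`(X - ρ) ^ ν * P`. -/
noncomputable def derivCofactor {R : Type*} [CommRing R] (ρ : R) (ν : ℕ) (P : Polynomial R) :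
    ℕ → Polynomial R
  | 0 => P
  | k + 1 => Polynomial.C (ν - k : R) * derivCofactor ρ ν P k +
      (Polynomial.X - Polynomial.C ρ) * (derivCofactor ρ ν P k).derivative

lemma X_sub_C_mul_derivative_pow_mul {R : Type*} [CommRing R] (ρ : R) (ν : ℕ)
    (Q : Polynomial R) :
    (Polynomial.X - Polynomial.C ρ) *
        Polynomial.derivative ((Polynomial.X - Polynomial.C ρ) ^ ν * Q) =
      (Polynomial.X - Polynomial.C ρ) ^ ν *
        (Polynomial.C (ν : R) * Q + (Polynomial.X - Polynomial.C ρ) * Q.derivative) := by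
  rw [Polynomial.derivative_mul, Polynomial.derivative_X_sub_C_pow]
  rcases ν with _ | ν
  · simp
  · simp only [Nat.add_sub_cancel]
    ring

lemma X_sub_C_pow_mul_iterate_derivative {R : Type*} [CommRing R] (ρ : R) (ν : ℕ)
    (P : Polynomial R) (k : ℕ) :
    (Polynomial.X - Polynomial.C ρ) ^ k *
        Polynomial.derivative^[k] ((Polynomial.X - Polynomial.C ρ) ^ ν * P) =
      (Polynomial.X - Polynomial.C ρ) ^ ν * derivCofactor ρ ν P k := by
  induction k with
  | zero => simp [derivCofactor]
  | succ k ih =>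
    have h := congrArg (fun G => (Polynomial.X - Polynomial.C ρ) * Polynomial.derivative G) ih
    simp only [X_sub_C_mul_derivative_pow_mul] at h
    rw [Function.iterate_succ_apply', derivCofactor, Polynomial.C_sub]
    linear_combination h - Polynomial.C (k : R) * ih

/-- The value of the parameter `p` for which `t` is a root of `𝓐 + p 𝓑`; meaningful where
`𝓑(t) ≠ 0`. -/
noncomputable def paramOf (𝓐 𝓑 : Polynomial ℂ) (t : ℂ) : ℂ := -𝓐.eval t / 𝓑.eval t

/-- The quotient by `(t - ρ) ^ (ν - k)` of the `k`-th derivative at `t` of `𝓐 + p 𝓑`, where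
`p = paramOf 𝓐 𝓑 t` and `𝓐 + p₀ 𝓑 = (X - ρ) ^ ν * P`. -/
noncomputable def fibreCofactor (𝓑 : Polynomial ℂ) (ρ : ℂ) (ν : ℕ) (P : Polynomial ℂ) (k : ℕ)
    (t : ℂ) : ℂ :=
  (derivCofactor ρ ν P k).eval t -
    (t - ρ) ^ k * (P.eval t * (Polynomial.derivative^[k] 𝓑).eval t / 𝓑.eval t)

variable {𝓐 𝓑 P : Polynomial ℂ} {p₀ ρ : ℂ} {ν : ℕ}

lemma paramOf_sub_mul (h : 𝓐 + Polynomial.C p₀ * 𝓑 = (Polynomial.X - Polynomial.C ρ) ^ ν * P)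
    {t : ℂ} (ht : 𝓑.eval t ≠ 0) :
    (paramOf 𝓐 𝓑 t - p₀) * 𝓑.eval t = -((t - ρ) ^ ν * P.eval t) := by
  have h1 := congrArg (Polynomial.eval t) h
  simp only [Polynomial.eval_add, Polynomial.eval_mul, Polynomial.eval_C, Polynomial.eval_pow,
    Polynomial.eval_sub, Polynomial.eval_X] at h1
  rw [paramOf, sub_mul, div_mul_cancel₀ _ ht]
  linear_combination -h1

lemma sub_pow_mul_eval_iterate_derivative
    (h : 𝓐 + Polynomial.C p₀ * 𝓑 = (Polynomial.X - Polynomial.C ρ) ^ ν * P) {t : ℂ}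
    (ht : 𝓑.eval t ≠ 0) (k : ℕ) :
    (t - ρ) ^ k * (Polynomial.derivative^[k] (𝓐 + Polynomial.C (paramOf 𝓐 𝓑 t) * 𝓑)).eval t =
      (t - ρ) ^ ν * fibreCofactor 𝓑 ρ ν P k t := by
  have hsplit : 𝓐 + Polynomial.C (paramOf 𝓐 𝓑 t) * 𝓑 =
      (Polynomial.X - Polynomial.C ρ) ^ ν * P + Polynomial.C (paramOf 𝓐 𝓑 t - p₀) * 𝓑 := by
    rw [← h, Polynomial.C_sub]
    ring
  have hP := congrArg (Polynomial.eval t) (X_sub_C_pow_mul_iterate_derivative ρ ν P k)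
  simp only [Polynomial.eval_mul, Polynomial.eval_C, Polynomial.eval_pow, Polynomial.eval_sub,
    Polynomial.eval_X] at hP
  rw [hsplit, iterate_map_add, Polynomial.iterate_derivative_C_mul,
    Polynomial.eval_add, Polynomial.eval_C_mul, mul_add, hP, fibreCofactor,
    eq_div_of_mul_eq ht (paramOf_sub_mul h ht)]
  ring

lemma analyticAt_eval (f : Polynomial ℂ) (t : ℂ) : AnalyticAt ℂ (fun t => f.eval t) t :=
  f.differentiable.analyticAt t

lemma analyticAt_paramOf (hB : 𝓑.eval ρ ≠ 0) : AnalyticAt ℂ (paramOf 𝓐 𝓑) ρ :=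
  (analyticAt_eval 𝓐 ρ).neg.div (analyticAt_eval 𝓑 ρ) hB

lemma analyticAt_fibreCofactor (hB : 𝓑.eval ρ ≠ 0) (k : ℕ) :
    AnalyticAt ℂ (fibreCofactor 𝓑 ρ ν P k) ρ :=
  (analyticAt_eval _ ρ).sub (((analyticAt_id.sub analyticAt_const).pow k).mul
    (((analyticAt_eval P ρ).mul (analyticAt_eval _ ρ)).div (analyticAt_eval 𝓑 ρ) hB))

lemma fibreCofactor_succ_self (k : ℕ) :
    fibreCofactor 𝓑 ρ ν P (k + 1) ρ = (derivCofactor ρ ν P (k + 1)).eval ρ := by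
  simp [fibreCofactor]

lemma hasDerivAt_fibreCofactor_succ (hB : 𝓑.eval ρ ≠ 0) (k : ℕ) :
    HasDerivAt (fibreCofactor 𝓑 ρ ν P (k + 1)) ((derivCofactor ρ ν P (k + 1)).derivative.eval ρ -
      (k + 1) * 0 ^ k * (P.eval ρ * (Polynomial.derivative^[k + 1] 𝓑).eval ρ / 𝓑.eval ρ)) ρ := by
  have hquot : DifferentiableAt ℂ
      (fun t => P.eval t * (Polynomial.derivative^[k + 1] 𝓑).eval t / 𝓑.eval t) ρ :=
    (P.differentiableAt.mul (Polynomial.differentiableAt _)).div 𝓑.differentiableAt hB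
  refine (((derivCofactor ρ ν P (k + 1)).hasDerivAt ρ).sub
    ((((hasDerivAt_id ρ).sub_const ρ).pow (k + 1)).mul hquot.hasDerivAt)).congr_deriv ?_
  simp

lemma fibreCofactor_one_self : fibreCofactor 𝓑 ρ ν P 1 ρ = ν * P.eval ρ := by
  simp [fibreCofactor_succ_self, derivCofactor]

lemma paramOf_self (h : 𝓐 + Polynomial.C p₀ * 𝓑 = (Polynomial.X - Polynomial.C ρ) ^ ν * P)
    (hν : ν ≠ 0) (hB : 𝓑.eval ρ ≠ 0) : paramOf 𝓐 𝓑 ρ = p₀ := by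
  have h0 := paramOf_sub_mul h hB
  rw [sub_self, zero_pow hν, zero_mul, neg_zero] at h0
  exact sub_eq_zero.1 ((mul_eq_zero.1 h0).resolve_right hB)

lemma deriv_paramOf_mul (h : 𝓐 + Polynomial.C p₀ * 𝓑 = (Polynomial.X - Polynomial.C ρ) ^ ν * P)
    (hν : ν ≠ 0) (hB : 𝓑.eval ρ ≠ 0) : deriv (paramOf 𝓐 𝓑) ρ * (ν - 1) = 0 := by
  rcases (Nat.one_le_iff_ne_zero.2 hν).eq_or_lt with rfl | hν2
  · simp
  have hev : (fun t => (paramOf 𝓐 𝓑 t - p₀) * 𝓑.eval t) =ᶠ[nhds ρ]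
      fun t => -((t - ρ) ^ ν * P.eval t) := by
    filter_upwards [𝓑.continuous.continuousAt.eventually_ne hB] with t ht
    exact paramOf_sub_mul h ht
  have hleft : HasDerivAt (fun t => (paramOf 𝓐 𝓑 t - p₀) * 𝓑.eval t) _ ρ :=
    ((analyticAt_paramOf hB).differentiableAt.hasDerivAt.sub_const p₀).mul (𝓑.hasDerivAt ρ)
  have hright : HasDerivAt (fun t => -((t - ρ) ^ ν * P.eval t)) _ ρ :=
    ((((hasDerivAt_id ρ).sub_const ρ).pow ν).mul (P.hasDerivAt ρ)).neg
  have hderiv := hleft.unique (hright.congr_of_eventuallyEq hev)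
  have hzero : deriv (paramOf 𝓐 𝓑) ρ = 0 := by
    simpa [paramOf_self h hν hB, zero_pow hν, zero_pow (Nat.sub_ne_zero_of_lt hν2), hB]
      using hderiv
  rw [hzero, zero_mul]

lemma eventually_eval_derivative_ne_zero
    (h : 𝓐 + Polynomial.C p₀ * 𝓑 = (Polynomial.X - Polynomial.C ρ) ^ ν * P) (hν : ν ≠ 0)
    (hP : P.eval ρ ≠ 0) (hB : 𝓑.eval ρ ≠ 0) :
    ∀ᶠ t in nhdsWithin ρ {ρ}ᶜ, t ≠ ρ ∧ 𝓑.eval t ≠ 0 ∧ fibreCofactor 𝓑 ρ ν P 1 t ≠ 0 ∧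
      (𝓐 + Polynomial.C (paramOf 𝓐 𝓑 t) * 𝓑).derivative.eval t ≠ 0 := by
  have hcof : fibreCofactor 𝓑 ρ ν P 1 ρ ≠ 0 := by
    rw [fibreCofactor_one_self]
    exact mul_ne_zero (Nat.cast_ne_zero.2 hν) hP
  filter_upwards [self_mem_nhdsWithin,
    nhdsWithin_le_nhds (𝓑.continuous.continuousAt.eventually_ne hB),
    nhdsWithin_le_nhds ((analyticAt_fibreCofactor hB 1).continuousAt.eventually_ne hcof)]
    with t htρ htB htcof
  have hder := sub_pow_mul_eval_iterate_derivative h htB 1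
  exact ⟨htρ, htB, htcof, right_ne_zero_of_mul (hder.trans_ne
    (mul_ne_zero (pow_ne_zero ν (sub_ne_zero.2 htρ)) htcof))⟩

lemma tendsto_paramOf_sub_mul
    (h : 𝓐 + Polynomial.C p₀ * 𝓑 = (Polynomial.X - Polynomial.C ρ) ^ ν * P) (hν : ν ≠ 0)
    (hP : P.eval ρ ≠ 0) (hB : 𝓑.eval ρ ≠ 0) :
    Filter.Tendsto (fun t => (paramOf 𝓐 𝓑 t - p₀) * (-𝓑.eval t /
      (𝓐 + Polynomial.C (paramOf 𝓐 𝓑 t) * 𝓑).derivative.eval t))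
      (nhdsWithin ρ {ρ}ᶜ) (nhds 0) := by
  have hcof : fibreCofactor 𝓑 ρ ν P 1 ρ ≠ 0 := by
    rw [fibreCofactor_one_self]
    exact mul_ne_zero (Nat.cast_ne_zero.2 hν) hP
  have hlim : ContinuousAt (fun t => (t - ρ) * P.eval t / fibreCofactor 𝓑 ρ ν P 1 t) ρ :=
    ((analyticAt_id.sub analyticAt_const).mul (analyticAt_eval P ρ)).continuousAt.div
      (analyticAt_fibreCofactor hB 1).continuousAt hcof
  have hlim0 := hlim.tendsto.mono_left (nhdsWithin_le_nhds (s := {ρ}ᶜ))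
  rw [sub_self, zero_mul, zero_div] at hlim0
  refine hlim0.congr' ?_
  filter_upwards [eventually_eval_derivative_ne_zero h hν hP hB] with t ht
  obtain ⟨-, htB, htcof, htder⟩ := ht
  have hder := sub_pow_mul_eval_iterate_derivative h htB 1
  rw [pow_one, Function.iterate_one] at hder
  rw [mul_div_assoc', div_eq_div_iff htcof htder]
  linear_combination P.eval t * hder + fibreCofactor 𝓑 ρ ν P 1 t * paramOf_sub_mul h htB

/-- The differential of which `rootSum` is the trace along `t ↦ paramOf 𝓐 𝓑 t`, as a coefficient
of `dt`. -/
noncomputable def traceForm (d : ℕ) (κ : ℂ) (𝓐 𝓑 : Polynomial ℂ) (t : ℂ) : ℂ :=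
  rootTerm d κ (paramOf 𝓐 𝓑 t) (𝓐 + Polynomial.C (paramOf 𝓐 𝓑 t) * 𝓑) t

/-- The analytic extension of `(t - ρ) ^ 2 * traceForm d κ 𝓐 𝓑 t` to a root `ρ` of
`𝓐 + p₀ 𝓑`. -/
noncomputable def regularizedTrace (d : ℕ) (κ : ℂ) (𝓐 𝓑 : Polynomial ℂ) (ρ : ℂ) (ν : ℕ)
    (P : Polynomial ℂ) (t : ℂ) : ℂ :=
  (paramOf 𝓐 𝓑 t * (1 - κ * t) - t) ^ 2 * fibreCofactor 𝓑 ρ ν P 3 t /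
      (6 * fibreCofactor 𝓑 ρ ν P 1 t) +
    (d - 2) * (κ * paramOf 𝓐 𝓑 t + 1) * (paramOf 𝓐 𝓑 t * (1 - κ * t) - t) *
      ((t - ρ) * fibreCofactor 𝓑 ρ ν P 2 t) / (2 * fibreCofactor 𝓑 ρ ν P 1 t) +
    (d - 1) * (d - 2) / 2 * (κ * paramOf 𝓐 𝓑 t + 1) ^ 2 * (t - ρ) ^ 2

lemma sq_mul_traceForm (d : ℕ) (κ : ℂ)
    (h : 𝓐 + Polynomial.C p₀ * 𝓑 = (Polynomial.X - Polynomial.C ρ) ^ ν * P) {t : ℂ}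
    (htρ : t ≠ ρ) (htB : 𝓑.eval t ≠ 0) (htcof : fibreCofactor 𝓑 ρ ν P 1 t ≠ 0) :
    (t - ρ) ^ 2 * traceForm d κ 𝓐 𝓑 t = regularizedTrace d κ 𝓐 𝓑 ρ ν P t := by
  have hs := sub_ne_zero.2 htρ
  have hder (k : ℕ) : (Polynomial.derivative^[k]
      (𝓐 + Polynomial.C (paramOf 𝓐 𝓑 t) * 𝓑)).eval t =
        (t - ρ) ^ ν * fibreCofactor 𝓑 ρ ν P k t / (t - ρ) ^ k := by
    rw [eq_div_iff (pow_ne_zero k hs), mul_comm, sub_pow_mul_eval_iterate_derivative h htB]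
  have h1 := hder 1
  have h2 := hder 2
  have h3 := hder 3
  simp only [Function.iterate_succ_apply', Function.iterate_zero, id_eq] at h1 h2 h3
  rw [traceForm, rootTerm, regularizedTrace, h1, h2, h3]
  have := pow_ne_zero ν hs
  field_simp

lemma analyticAt_regularizedTrace (d : ℕ) (κ : ℂ) (hν : ν ≠ 0) (hP : P.eval ρ ≠ 0)
    (hB : 𝓑.eval ρ ≠ 0) : AnalyticAt ℂ (regularizedTrace d κ 𝓐 𝓑 ρ ν P) ρ := by
  have hcof : fibreCofactor 𝓑 ρ ν P 1 ρ ≠ 0 := by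
    rw [fibreCofactor_one_self]
    exact mul_ne_zero (Nat.cast_ne_zero.2 hν) hP
  have hp : AnalyticAt ℂ (paramOf 𝓐 𝓑) ρ := analyticAt_paramOf hB
  have hs : AnalyticAt ℂ (fun t : ℂ => t - ρ) ρ := analyticAt_id.sub analyticAt_const
  have hM : AnalyticAt ℂ (fun t => paramOf 𝓐 𝓑 t * (1 - κ * t) - t) ρ :=
    (hp.mul (analyticAt_const.sub (analyticAt_const.mul analyticAt_id))).sub analyticAt_id
  have hκ : AnalyticAt ℂ (fun t => κ * paramOf 𝓐 𝓑 t + 1) ρ :=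
    (analyticAt_const.mul hp).add analyticAt_const
  exact ((((hM.pow 2).mul (analyticAt_fibreCofactor hB 3)).div
      (analyticAt_const.mul (analyticAt_fibreCofactor hB 1)) (mul_ne_zero (by norm_num) hcof)).add
    ((((analyticAt_const.mul hκ).mul hM).mul (hs.mul (analyticAt_fibreCofactor hB 2))).div
      (analyticAt_const.mul (analyticAt_fibreCofactor hB 1)) (mul_ne_zero two_ne_zero hcof))).add
    ((analyticAt_const.mul (hκ.pow 2)).mul (hs.pow 2))

lemma regularizedTrace_one_self (d : ℕ) (κ : ℂ) :
    regularizedTrace d κ 𝓐 𝓑 ρ 1 P ρ = 0 := by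
  simp [regularizedTrace, fibreCofactor_succ_self, derivCofactor]

lemma hasDerivAt_regularizedTrace (d : ℕ) (κ : ℂ)
    (h : 𝓐 + Polynomial.C p₀ * 𝓑 = (Polynomial.X - Polynomial.C ρ) ^ ν * P) (hν : ν ≠ 0)
    (hP : P.eval ρ ≠ 0) (hB : 𝓑.eval ρ ≠ 0) :
    HasDerivAt (regularizedTrace d κ 𝓐 𝓑 ρ ν P) (fibreResidue d ν κ p₀ 𝓑 P ρ / 6) ρ := by
  have hν' : (ν : ℂ) ≠ 0 := Nat.cast_ne_zero.2 hν
  have hcof : fibreCofactor 𝓑 ρ ν P 1 ρ ≠ 0 := by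
    rw [fibreCofactor_one_self]
    exact mul_ne_zero hν' hP
  have hp := (analyticAt_paramOf (𝓐 := 𝓐) hB).differentiableAt.hasDerivAt
  have hp' := deriv_paramOf_mul h hν hB
  have hs : HasDerivAt (fun t : ℂ => t - ρ) 1 ρ := (hasDerivAt_id ρ).sub_const ρ
  have hM : HasDerivAt (fun t => paramOf 𝓐 𝓑 t * (1 - κ * t) - t) _ ρ :=
    (hp.mul (((hasDerivAt_id ρ).const_mul κ).const_sub 1)).sub (hasDerivAt_id ρ)
  have hκ : HasDerivAt (fun t => κ * paramOf 𝓐 𝓑 t + 1) _ ρ := (hp.const_mul κ).add_const 1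
  have h1 := hasDerivAt_fibreCofactor_succ (ρ := ρ) (ν := ν) (P := P) hB 0
  have h2 := hasDerivAt_fibreCofactor_succ (ρ := ρ) (ν := ν) (P := P) hB 1
  have h3 := hasDerivAt_fibreCofactor_succ (ρ := ρ) (ν := ν) (P := P) hB 2
  refine (((((hM.pow 2).mul h3).div (h1.const_mul 6) (mul_ne_zero (by norm_num) hcof)).add
    ((((hκ.const_mul ((d : ℂ) - 2)).mul hM).mul (hs.mul h2)).div (h1.const_mul 2)
      (mul_ne_zero two_ne_zero hcof))).add
    (((hκ.pow 2).const_mul (((d : ℂ) - 1) * (d - 2) / 2)).mul (hs.pow 2))).congr_deriv ?_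
  simp only [Nat.cast_ofNat, paramOf_self h hν hB, Nat.add_one_sub_one, pow_one, id_eq, mul_one,
    mul_neg, Nat.reduceAdd, fibreCofactor_succ_self, derivCofactor, map_sub, map_natCast,
    Nat.cast_one, map_one, CharP.cast_eq_zero, sub_zero, Polynomial.derivative_add,
    Polynomial.derivative_mul, Polynomial.derivative_natCast, zero_mul, zero_add,
    Polynomial.derivative_X, Polynomial.derivative_C, one_mul,
    Polynomial.derivative_one, sub_self, Polynomial.eval_add, Polynomial.eval_mul,
    Polynomial.eval_sub, Polynomial.eval_natCast, Polynomial.eval_C, Polynomial.eval_one,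
    Polynomial.eval_X, add_zero, Pi.pow_apply, ne_eq, OfNat.ofNat_ne_zero, not_false_eq_true,
    zero_pow, mul_zero, Function.iterate_succ, Function.iterate_zero, Function.comp_apply,
    Pi.mul_apply, pow_zero, fibreResidue]
  generalize deriv (paramOf 𝓐 𝓑) ρ = p' at *
  field_simp
  linear_combination
    (4 * (p₀ * (1 - κ * ρ) - ρ) * (1 - κ * ρ) * ν * (ν - 2) * P.eval ρ * 𝓑.eval ρ) * hp'

lemma tendsto_div_sq_sub {W : ℂ → ℂ} {β : ℂ} (hW : AnalyticAt ℂ W ρ) (hβ : HasDerivAt W β ρ) :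
    ∃ l, Filter.Tendsto (fun t => W t / (t - ρ) ^ 2 - (W ρ / (t - ρ) ^ 2 + β / (t - ρ)))
      (nhdsWithin ρ {ρ}ᶜ) (nhds l) := by
  obtain ⟨p, hp⟩ := hW
  have hcont := hp.has_fpower_series_dslope_fslope.has_fpower_series_dslope_fslope.continuousAt
  refine ⟨_, (hcont.tendsto.mono_left nhdsWithin_le_nhds).congr' ?_⟩
  filter_upwards [self_mem_nhdsWithin] with t ht
  have := sub_ne_zero.2 ht
  rw [dslope_of_ne _ ht, slope_def_field, dslope_same, dslope_of_ne _ ht, slope_def_field,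
    hβ.deriv]
  field_simp
  ring

lemma exists_tendsto_traceForm_sub (d : ℕ) (κ : ℂ)
    (h : 𝓐 + Polynomial.C p₀ * 𝓑 = (Polynomial.X - Polynomial.C ρ) ^ ν * P) (hν : ν ≠ 0)
    (hP : P.eval ρ ≠ 0) (hB : 𝓑.eval ρ ≠ 0) :
    ∃ α, (ν = 1 → α = 0) ∧ ∃ l, Filter.Tendsto (fun t => traceForm d κ 𝓐 𝓑 t -
      (α / (t - ρ) ^ 2 + fibreResidue d ν κ p₀ 𝓑 P ρ / 6 / (t - ρ)))
      (nhdsWithin ρ {ρ}ᶜ) (nhds l) := by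
  obtain ⟨l, hl⟩ := tendsto_div_sq_sub (analyticAt_regularizedTrace d κ hν hP hB)
    (hasDerivAt_regularizedTrace d κ h hν hP hB)
  have hα : ν = 1 → regularizedTrace d κ 𝓐 𝓑 ρ ν P ρ = 0 := by
    rintro rfl
    exact regularizedTrace_one_self d κ
  refine ⟨_, hα, l, hl.congr' ?_⟩
  filter_upwards [eventually_eval_derivative_ne_zero h hν hP hB] with t ht
  obtain ⟨htρ, htB, htcof, -⟩ := ht
  rw [← sq_mul_traceForm d κ h htρ htB htcof,
    mul_div_cancel_left₀ _ (pow_ne_zero 2 (sub_ne_zero.2 htρ))]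

end LocalResidue

section PartialFractions

variable {K : Type*} [Field K]

lemma sum_nodal_div_sub_eq {ι : Type*} {s : Finset ι} {v : ι → K}
    (hv : Set.InjOn v s) {g : Polynomial K} (hg : g.natDegree ≤ s.card) {x : K}
    (hx : (Lagrange.nodal s v).eval x ≠ 0) :
    ∑ i ∈ s, g.eval (v i) / (Lagrange.nodal s v).derivative.eval (v i) / (x - v i) =
      g.eval x / (Lagrange.nodal s v).eval x - g.coeff s.card := by
  classical
  set N := Lagrange.nodal s v with hN
  have hNdeg : N.natDegree = s.card := Lagrange.natDegree_nodal
  have hNcoeff : N.coeff s.card = 1 := by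
    rw [← hNdeg]
    exact Lagrange.nodal_monic.coeff_natDegree
  set R := g - Polynomial.C (g.coeff s.card) * N with hR
  have hRdeg : R.degree < s.card := by
    rw [Polynomial.degree_lt_iff_coeff_zero]
    intro k hk
    rw [hR, Polynomial.coeff_sub, Polynomial.coeff_C_mul]
    rcases hk.eq_or_lt with rfl | hk
    · rw [hNcoeff, mul_one, sub_self]
    · rw [Polynomial.coeff_eq_zero_of_natDegree_lt (hg.trans_lt hk),
        Polynomial.coeff_eq_zero_of_natDegree_lt (hNdeg.trans_lt hk), mul_zero, sub_zero]
  have hxv : ∀ i ∈ s, x ≠ v i := by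
    rintro i hi rfl
    exact hx (Lagrange.eval_nodal_at_node hi)
  have hterm : ∀ i ∈ s, g.eval (v i) / N.derivative.eval (v i) / (x - v i) =
      Lagrange.nodalWeight s v i * (x - v i)⁻¹ * R.eval (v i) := by
    intro i hi
    rw [Lagrange.nodalWeight_eq_eval_derivative_nodal hi, hR, hN, Polynomial.eval_sub,
      Polynomial.eval_C_mul, Lagrange.eval_nodal_at_node hi]
    ring
  have hinterp := congrArg (Polynomial.eval x) (Lagrange.eq_interpolate hv hRdeg)
  rw [Lagrange.eval_interpolate_not_at_node _ hxv, ← Finset.sum_congr rfl hterm, ← hN, hR,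
    Polynomial.eval_sub, Polynomial.eval_C_mul] at hinterp
  rw [div_sub' hx, eq_div_iff hx]
  linear_combination -hinterp

variable {f g : Polynomial K}

lemma card_roots_toFinset [DecidableEq K] (hs : f.Splits) (hf : f.Separable) :
    f.roots.toFinset.card = f.natDegree := by
  rw [Multiset.toFinset_card_of_nodup (Polynomial.nodup_roots hf), hs.natDegree_eq_card_roots]

lemma eq_C_mul_nodal_roots [DecidableEq K] (hs : f.Splits) (hf : f.Separable) :
    f = Polynomial.C f.leadingCoeff * Lagrange.nodal f.roots.toFinset id := by
  conv_lhs => rw [hs.eq_prod_roots]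
  rw [Lagrange.nodal_eq, ← Finset.prod_map_val, Multiset.toFinset_val,
    (Polynomial.nodup_roots hf).dedup]
  rfl

lemma sum_roots_div_sub_eq [DecidableEq K] (hs : f.Splits) (hf : f.Separable)
    (hg : g.natDegree ≤ f.natDegree) {x : K} (hx : f.eval x ≠ 0) :
    ∑ t ∈ f.roots.toFinset, g.eval t / f.derivative.eval t / (x - t) =
      g.eval x / f.eval x - g.coeff f.natDegree / f.leadingCoeff := by
  set N := Lagrange.nodal f.roots.toFinset id
  set c := f.leadingCoeff
  have hfN : f = Polynomial.C c * N := eq_C_mul_nodal_roots hs hf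
  have hfx : f.eval x = c * N.eval x := by
    conv_lhs => rw [hfN, Polynomial.eval_C_mul]
  have hfder (t : K) : f.derivative.eval t = c * N.derivative.eval t := by
    conv_lhs => rw [hfN, Polynomial.derivative_C_mul, Polynomial.eval_C_mul]
  have hcard := card_roots_toFinset hs hf
  have hnodal := sum_nodal_div_sub_eq (v := id) Function.injective_id.injOn (hg.trans_eq hcard.symm)
    (right_ne_zero_of_mul (hfx ▸ hx))
  rw [hcard] at hnodal
  simp only [id] at hnodal
  simp only [hfder, hfx, div_mul_eq_div_div_swap _ c]
  rw [← sub_div, ← hnodal, Finset.sum_div]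
  exact Finset.sum_congr rfl fun t _ => div_right_comm _ _ _

end PartialFractions

lemma sum_roots_div_sub_sq_eq {f g : Polynomial ℂ} (hf : f.Separable)
    (hg : g.natDegree ≤ f.natDegree) {x : ℂ} (hx : f.eval x ≠ 0) :
    ∑ t ∈ f.roots.toFinset, -g.eval t / f.derivative.eval t / (t - x) ^ 2 =
      (g.derivative.eval x * f.eval x - g.eval x * f.derivative.eval x) / f.eval x ^ 2 := by
  have hxt : ∀ t ∈ f.roots.toFinset, x - t ≠ 0 := by
    intro t ht h0
    rw [sub_eq_zero.1 h0] at hx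
    exact hx (Polynomial.isRoot_of_mem_roots (Multiset.mem_toFinset.1 ht))
  have hleft : HasDerivAt
      (fun x => ∑ t ∈ f.roots.toFinset, g.eval t / f.derivative.eval t / (x - t))
      (∑ t ∈ f.roots.toFinset, -g.eval t / f.derivative.eval t / (t - x) ^ 2) x := by
    refine HasDerivAt.fun_sum fun t ht => ?_
    refine ((hasDerivAt_const x (g.eval t / f.derivative.eval t)).div
      ((hasDerivAt_id x).sub_const t) (hxt t ht)).congr_deriv ?_
    rw [← neg_sub x t, neg_sq, id]
    ring
  have hright := ((g.hasDerivAt x).div (f.hasDerivAt x) hx).sub_const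
    (g.coeff f.natDegree / f.leadingCoeff)
  refine hleft.unique (hright.congr_of_eventuallyEq ?_)
  filter_upwards [f.continuous.continuousAt.eventually_ne hx] with y hy
  exact sum_roots_div_sub_eq (IsAlgClosed.splits f) hf hg hy

section Pencil

variable {d : ℕ} {𝓐 𝓑 : Polynomial ℂ}

lemma natDegree_add_C_mul_le (hA : 𝓐.natDegree ≤ d) (hB : 𝓑.natDegree ≤ d) (p : ℂ) :
    (𝓐 + Polynomial.C p * 𝓑).natDegree ≤ d :=
  Polynomial.natDegree_add_le_of_degree_le hA ((Polynomial.natDegree_C_mul_le _ _).trans hB)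

lemma coeff_add_C_mul (p : ℂ) (k : ℕ) :
    (𝓐 + Polynomial.C p * 𝓑).coeff k = 𝓐.coeff k + p * 𝓑.coeff k := by
  rw [Polynomial.coeff_add, Polynomial.coeff_C_mul]

lemma natDegree_add_C_mul_eq (hA : 𝓐.natDegree ≤ d) (hB : 𝓑.natDegree ≤ d) {p : ℂ}
    (hp : 𝓐.coeff d + p * 𝓑.coeff d ≠ 0) : (𝓐 + Polynomial.C p * 𝓑).natDegree = d :=
  Polynomial.natDegree_eq_of_le_of_coeff_ne_zero (natDegree_add_C_mul_le hA hB p)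
    (by rwa [coeff_add_C_mul])

lemma eval_add_C_mul (p t : ℂ) :
    (𝓐 + Polynomial.C p * 𝓑).eval t = 𝓐.eval t + p * 𝓑.eval t := by
  rw [Polynomial.eval_add, Polynomial.eval_C_mul]

lemma paramOf_eq_of_eval_eq_zero {p t : ℂ} (h : (𝓐 + Polynomial.C p * 𝓑).eval t = 0)
    (ht : 𝓑.eval t ≠ 0) : paramOf 𝓐 𝓑 t = p := by
  rw [eval_add_C_mul] at h
  rw [paramOf, div_eq_iff ht]
  linear_combination -h

lemma eventually_cauchyBound_le (hA : 𝓐.natDegree ≤ d) (hB : 𝓑.natDegree ≤ d) {p₀ : ℂ}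
    (hp₀ : 𝓐.coeff d + p₀ * 𝓑.coeff d ≠ 0) :
    ∃ M, ∀ᶠ p in nhds p₀, (𝓐 + Polynomial.C p * 𝓑).cauchyBound ≤ M := by
  have hbound : ContinuousAt (fun p => ((Finset.range d).sup fun k =>
      ‖𝓐.coeff k + p * 𝓑.coeff k‖₊) / ‖𝓐.coeff d + p * 𝓑.coeff d‖₊ + 1) p₀ := by
    have hcoeff (k : ℕ) : ContinuousAt (fun p => ‖𝓐.coeff k + p * 𝓑.coeff k‖₊) p₀ := by fun_prop
    have hsup := ContinuousAt.finset_sup_apply fun k (_ : k ∈ Finset.range d) => hcoeff k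
    exact (hsup.div₀ (hcoeff d) (nnnorm_ne_zero_iff.2 hp₀)).add continuousAt_const
  have hlead : ∀ᶠ p in nhds p₀, 𝓐.coeff d + p * 𝓑.coeff d ≠ 0 :=
    ContinuousAt.eventually_ne (by fun_prop) hp₀
  obtain ⟨M, hM⟩ := hbound.tendsto.isBoundedUnder_le
  refine ⟨M, ?_⟩
  filter_upwards [hlead, Filter.eventually_map.1 hM] with p hp hle
  simpa only [Polynomial.cauchyBound, Polynomial.leadingCoeff, natDegree_add_C_mul_eq hA hB hp,
    coeff_add_C_mul] using hle

lemma eventually_forall_root (hA : 𝓐.natDegree ≤ d) (hB : 𝓑.natDegree ≤ d) {p₀ : ℂ}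
    (hp₀ : 𝓐.coeff d + p₀ * 𝓑.coeff d ≠ 0) {good : ℂ → Prop}
    (hgood : ∀ t, (𝓐 + Polynomial.C p₀ * 𝓑).eval t = 0 → ∀ᶠ t' in nhds t, good t') :
    ∀ᶠ p in nhds p₀, ∀ t, (𝓐 + Polynomial.C p * 𝓑).eval t = 0 → good t := by
  obtain ⟨M, hM⟩ := eventually_cauchyBound_le hA hB hp₀
  have hlead : ∀ᶠ p in nhds p₀, 𝓐.coeff d + p * 𝓑.coeff d ≠ 0 :=
    ContinuousAt.eventually_ne (by fun_prop) hp₀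
  have hball : ∀ᶠ p in nhds p₀, ∀ t ∈ Metric.closedBall (0 : ℂ) M,
      (𝓐 + Polynomial.C p * 𝓑).eval t = 0 → good t := by
    refine (isCompact_closedBall 0 (M : ℝ)).eventually_forall_of_forall_eventually fun t _ => ?_
    by_cases ht : (𝓐 + Polynomial.C p₀ * 𝓑).eval t = 0
    · exact (continuousAt_snd.eventually (hgood t ht)).mono fun z hz _ => hz
    · have hcont : ContinuousAt (fun z : ℂ × ℂ => (𝓐 + Polynomial.C z.1 * 𝓑).eval z.2) (p₀, t) := by
        simp only [eval_add_C_mul]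
        fun_prop
      exact (hcont.eventually_ne ht).mono fun z hz h0 => absurd h0 hz
  filter_upwards [hM, hlead, hball] with p hpM hp hpt t ht
  have hf : 𝓐 + Polynomial.C p * 𝓑 ≠ 0 := by
    intro h0
    rw [← coeff_add_C_mul, h0, Polynomial.coeff_zero] at hp
    exact hp rfl
  refine hpt t (mem_closedBall_zero_iff.2 ?_) ht
  exact_mod_cast ((Polynomial.IsRoot.norm_lt_cauchyBound hf ht).trans_le hpM).le

end Pencil

section FibreTrace

variable {d n : ℕ} {𝓐 𝓑 : Polynomial ℂ} {p₀ : ℂ} {ρ : Fin n → ℂ} {ν : Fin n → ℕ}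
  {P : Fin n → Polynomial ℂ}

lemma fibreTrace_add (R S : ℂ → ℂ) (p : ℂ) :
    fibreTrace 𝓐 𝓑 (fun t => R t + S t) p = fibreTrace 𝓐 𝓑 R p + fibreTrace 𝓐 𝓑 S p := by
  simp only [fibreTrace, mul_add, Finset.sum_add_distrib]

lemma fibreTrace_sum {ι : Type*} (s : Finset ι) (R : ι → ℂ → ℂ) (p : ℂ) :
    fibreTrace 𝓐 𝓑 (fun t => ∑ i ∈ s, R i t) p = ∑ i ∈ s, fibreTrace 𝓐 𝓑 (R i) p := by
  simp only [fibreTrace, Finset.mul_sum]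
  exact Finset.sum_comm

lemma fibreTrace_const_mul (c : ℂ) (R : ℂ → ℂ) (p : ℂ) :
    fibreTrace 𝓐 𝓑 (fun t => c * R t) p = c * fibreTrace 𝓐 𝓑 R p := by
  simp only [fibreTrace, Finset.mul_sum, mul_left_comm c]

lemma separable_of_forall_root {f : Polynomial ℂ}
    (hf : ∀ t, f.eval t = 0 → f.derivative.eval t ≠ 0) : f.Separable := by
  refine (Polynomial.isCoprime_iff_aeval_ne_zero_of_isAlgClosed ℂ ℂ _ _).2 fun t => ?_
  simp only [Polynomial.coe_aeval_eq_eval]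
  exact or_iff_not_imp_left.2 fun h => hf t (not_not.1 h)

/-- The affine points `ρ i` are the distinct roots of `𝓐 + p₀ 𝓑`, with multiplicities `ν i` and
cofactors `P i`; none of the `d` roots of this polynomial is at infinity. -/
structure IsFibre (d : ℕ) {n : ℕ} (𝓐 𝓑 : Polynomial ℂ) (p₀ : ℂ) (ρ : Fin n → ℂ)
    (ν : Fin n → ℕ) (P : Fin n → Polynomial ℂ) : Prop where
  natDegree_left : 𝓐.natDegree ≤ d
  natDegree_right : 𝓑.natDegree ≤ d
  lead_ne : 𝓐.coeff d + p₀ * 𝓑.coeff d ≠ 0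
  injective : Function.Injective ρ
  mult_ne_zero : ∀ i, ν i ≠ 0
  factor : ∀ i, 𝓐 + Polynomial.C p₀ * 𝓑 = (Polynomial.X - Polynomial.C (ρ i)) ^ ν i * P i
  eval_ne : ∀ i, (P i).eval (ρ i) ≠ 0
  eval_right_ne : ∀ i, 𝓑.eval (ρ i) ≠ 0
  mem_range : ∀ t, (𝓐 + Polynomial.C p₀ * 𝓑).eval t = 0 → t ∈ Set.range ρ

namespace IsFibre

lemma eval_point (h : IsFibre d 𝓐 𝓑 p₀ ρ ν P) (i : Fin n) (p : ℂ) :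
    (𝓐 + Polynomial.C p * 𝓑).eval (ρ i) = (p - p₀) * 𝓑.eval (ρ i) := by
  have h0 := congrArg (Polynomial.eval (ρ i)) (h.factor i)
  rw [eval_add_C_mul, Polynomial.eval_mul, Polynomial.eval_pow, Polynomial.eval_sub,
    Polynomial.eval_X, Polynomial.eval_C, sub_self, zero_pow (h.mult_ne_zero i), zero_mul] at h0
  rw [eval_add_C_mul]
  linear_combination h0

lemma eval_point_ne (h : IsFibre d 𝓐 𝓑 p₀ ρ ν P) (i : Fin n) {p : ℂ} (hp : p ≠ p₀) :
    (𝓐 + Polynomial.C p * 𝓑).eval (ρ i) ≠ 0 := by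
  rw [h.eval_point i]
  exact mul_ne_zero (sub_ne_zero.2 hp) (h.eval_right_ne i)

lemma eval_derivative_point (h : IsFibre d 𝓐 𝓑 p₀ ρ ν P) {i : Fin n} (hi : ν i ≠ 1) (p : ℂ) :
    (𝓐 + Polynomial.C p * 𝓑).derivative.eval (ρ i) = (p - p₀) * 𝓑.derivative.eval (ρ i) := by
  have hdvd : (Polynomial.X - Polynomial.C (ρ i)) ^ 2 ∣ 𝓐 + Polynomial.C p₀ * 𝓑 := by
    have := h.mult_ne_zero i
    rw [h.factor i]
    exact Dvd.dvd.mul_right (pow_dvd_pow _ (by omega)) _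
  obtain ⟨Q, hQ⟩ := hdvd
  have h0 := congrArg (fun f => (Polynomial.derivative f).eval (ρ i)) hQ
  simp only [Polynomial.derivative_add, Polynomial.derivative_C, Polynomial.derivative_mul,
    Polynomial.derivative_X_sub_C_pow, Polynomial.eval_add, Polynomial.eval_mul,
    Polynomial.eval_pow, Polynomial.eval_sub, Polynomial.eval_X, Polynomial.eval_C, sub_self,
    zero_pow two_ne_zero, Nat.add_one_sub_one, pow_one, mul_zero, zero_mul, add_zero,
    zero_add] at h0 ⊢
  linear_combination h0

lemma eventually_simple_roots (h : IsFibre d 𝓐 𝓑 p₀ ρ ν P) {good : ℂ → Prop}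
    (hgood : ∀ i, ∀ᶠ t in nhdsWithin (ρ i) {ρ i}ᶜ, good t) :
    ∀ᶠ p in nhdsWithin p₀ {p₀}ᶜ, p ≠ p₀ ∧ 𝓐.coeff d + p * 𝓑.coeff d ≠ 0 ∧
      ∀ t, (𝓐 + Polynomial.C p * 𝓑).eval t = 0 →
        𝓑.eval t ≠ 0 ∧ (𝓐 + Polynomial.C p * 𝓑).derivative.eval t ≠ 0 ∧ good t := by
  have hnear : ∀ᶠ p in nhds p₀, ∀ t, (𝓐 + Polynomial.C p * 𝓑).eval t = 0 → t ∈ Set.range ρ ∨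
      (𝓑.eval t ≠ 0 ∧ (𝓐 + Polynomial.C (paramOf 𝓐 𝓑 t) * 𝓑).derivative.eval t ≠ 0 ∧
        good t) := by
    refine eventually_forall_root h.natDegree_left h.natDegree_right h.lead_ne fun t ht => ?_
    obtain ⟨i, rfl⟩ := h.mem_range t ht
    filter_upwards [eventually_nhdsWithin_iff.1 ((eventually_eval_derivative_ne_zero (h.factor i)
      (h.mult_ne_zero i) (h.eval_ne i) (h.eval_right_ne i)).and (hgood i))] with t ht
    rcases eq_or_ne t (ρ i) with rfl | hti
    · exact Or.inl ⟨i, rfl⟩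
    · exact Or.inr ⟨(ht hti).1.2.1, (ht hti).1.2.2.2, (ht hti).2⟩
  have hlead : ∀ᶠ p in nhds p₀, 𝓐.coeff d + p * 𝓑.coeff d ≠ 0 :=
    ContinuousAt.eventually_ne (by fun_prop) h.lead_ne
  filter_upwards [nhdsWithin_le_nhds hnear, nhdsWithin_le_nhds hlead, self_mem_nhdsWithin]
    with p hp hpc hpp
  refine ⟨hpp, hpc, fun t ht => ?_⟩
  have hrange : t ∉ Set.range ρ := by
    rintro ⟨i, rfl⟩
    exact h.eval_point_ne i hpp ht
  obtain ⟨hB, hder, hg⟩ := (hp t ht).resolve_left hrange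
  rw [paramOf_eq_of_eval_eq_zero ht hB] at hder
  exact ⟨hB, hder, hg⟩

lemma fibreTrace_polarPart (h : IsFibre d 𝓐 𝓑 p₀ ρ ν P) {i : Fin n} {α : ℂ} (hα : ν i = 1 → α = 0)
    (β : ℂ) {p : ℂ} (hp : p ≠ p₀) (hc : 𝓐.coeff d + p * 𝓑.coeff d ≠ 0)
    (hf : (𝓐 + Polynomial.C p * 𝓑).Separable) :
    fibreTrace 𝓐 𝓑 (fun t => α / (t - ρ i) ^ 2 + β / (t - ρ i)) p =
      β * (1 / (p - p₀) - 𝓑.coeff d / (𝓐.coeff d + p * 𝓑.coeff d)) := by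
  have hx := h.eval_point_ne i hp
  have hdeg := natDegree_add_C_mul_eq h.natDegree_left h.natDegree_right hc
  have hBdeg := h.natDegree_right.trans_eq hdeg.symm
  have hsimple : fibreTrace 𝓐 𝓑 (fun t => 1 / (t - ρ i)) p =
      1 / (p - p₀) - 𝓑.coeff d / (𝓐.coeff d + p * 𝓑.coeff d) := by
    have hsum := sum_roots_div_sub_eq (IsAlgClosed.splits _) hf hBdeg hx
    rw [Polynomial.leadingCoeff, hdeg, coeff_add_C_mul, h.eval_point i,
      div_mul_cancel_right₀ (h.eval_right_ne i), inv_eq_one_div] at hsum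
    rw [← hsum, fibreTrace]
    refine Finset.sum_congr rfl fun t _ => ?_
    rw [mul_one_div, ← neg_sub (ρ i) t, neg_div, neg_div_neg_eq]
  have hdouble (hi : ν i ≠ 1) : fibreTrace 𝓐 𝓑 (fun t => 1 / (t - ρ i) ^ 2) p = 0 := by
    simp only [fibreTrace, mul_one_div]
    rw [sum_roots_div_sub_sq_eq hf hBdeg hx, h.eval_point i, h.eval_derivative_point hi,
      div_eq_zero_iff]
    left
    ring
  simp only [← mul_one_div α, ← mul_one_div β, fibreTrace_add, fibreTrace_const_mul, hsimple]
  by_cases hi : ν i = 1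
  · rw [hα hi, zero_mul, zero_add]
  · rw [hdouble hi, mul_zero, zero_add]

lemma tendsto_sub_mul_fibreTrace_zero (h : IsFibre d 𝓐 𝓑 p₀ ρ ν P) {R : ℂ → ℂ}
    (hR : ∀ i, ∃ l, Filter.Tendsto R (nhdsWithin (ρ i) {ρ i}ᶜ) (nhds l)) :
    Filter.Tendsto (fun p => (p - p₀) * fibreTrace 𝓐 𝓑 R p) (nhdsWithin p₀ {p₀}ᶜ) (nhds 0) := by
  set E : ℂ → ℂ := fun t => (paramOf 𝓐 𝓑 t - p₀) * (-𝓑.eval t /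
    (𝓐 + Polynomial.C (paramOf 𝓐 𝓑 t) * 𝓑).derivative.eval t) * R t with hE
  have hElim (i : Fin n) : Filter.Tendsto E (nhdsWithin (ρ i) {ρ i}ᶜ) (nhds 0) := by
    obtain ⟨l, hl⟩ := hR i
    simpa only [zero_mul] using (tendsto_paramOf_sub_mul (h.factor i) (h.mult_ne_zero i)
      (h.eval_ne i) (h.eval_right_ne i)).mul hl
  refine Metric.tendsto_nhds.2 fun ε hε => ?_
  have hsmall (i : Fin n) : ∀ᶠ t in nhdsWithin (ρ i) {ρ i}ᶜ, ‖E t‖ < ε / (d + 1) := by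
    simpa only [dist_zero_right] using Metric.tendsto_nhds.1 (hElim i) (ε / (d + 1)) (by positivity)
  filter_upwards [h.eventually_simple_roots hsmall] with p hp
  obtain ⟨-, -, hroots⟩ := hp
  set f := 𝓐 + Polynomial.C p * 𝓑
  have hmem : ∀ t ∈ f.roots.toFinset, f.eval t = 0 :=
    fun t ht => Polynomial.isRoot_of_mem_roots (Multiset.mem_toFinset.1 ht)
  have hsum : (p - p₀) * fibreTrace 𝓐 𝓑 R p = ∑ t ∈ f.roots.toFinset, E t := by
    rw [fibreTrace, Finset.mul_sum]
    refine Finset.sum_congr rfl fun t ht => ?_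
    simp only [hE, paramOf_eq_of_eval_eq_zero (hmem t ht) (hroots t (hmem t ht)).1, mul_assoc]
  have hcard : (f.roots.toFinset.card : ℝ) ≤ d := by
    exact_mod_cast (Multiset.toFinset_card_le _).trans (f.card_roots'.trans
      (natDegree_add_C_mul_le h.natDegree_left h.natDegree_right p))
  rw [dist_zero_right, hsum]
  calc ‖∑ t ∈ f.roots.toFinset, E t‖ ≤ ∑ t ∈ f.roots.toFinset, ‖E t‖ := norm_sum_le _ _
    _ ≤ f.roots.toFinset.card * (ε / (d + 1)) := by
      rw [← nsmul_eq_mul]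
      exact Finset.sum_le_card_nsmul _ _ _ fun t ht => (hroots t (hmem t ht)).2.2.le
    _ ≤ d * (ε / (d + 1)) := by gcongr
    _ < ε := by
      rw [mul_div_assoc', div_lt_iff₀ (by positivity)]
      nlinarith

lemma tendsto_sub_mul_fibreTrace_polarPart (h : IsFibre d 𝓐 𝓑 p₀ ρ ν P) {i : Fin n} {α : ℂ}
    (hα : ν i = 1 → α = 0) (β : ℂ) :
    Filter.Tendsto
      (fun p => (p - p₀) * fibreTrace 𝓐 𝓑 (fun t => α / (t - ρ i) ^ 2 + β / (t - ρ i)) p)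
      (nhdsWithin p₀ {p₀}ᶜ) (nhds β) := by
  have hquot : ContinuousAt (fun p => 𝓑.coeff d / (𝓐.coeff d + p * 𝓑.coeff d)) p₀ :=
    ContinuousAt.div (by fun_prop) (by fun_prop) h.lead_ne
  have hlim : ContinuousAt
      (fun p => β * (1 - (p - p₀) * (𝓑.coeff d / (𝓐.coeff d + p * 𝓑.coeff d)))) p₀ := by fun_prop
  have hlim' := hlim.tendsto.mono_left (nhdsWithin_le_nhds (s := {p₀}ᶜ))
  rw [sub_self, zero_mul, sub_zero, mul_one] at hlim'
  refine hlim'.congr' ?_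
  filter_upwards [h.eventually_simple_roots fun _ => Filter.Eventually.of_forall fun _ => trivial]
    with p hp
  obtain ⟨hpp, hpc, hroots⟩ := hp
  rw [h.fibreTrace_polarPart hα β hpp hpc (separable_of_forall_root fun t ht => (hroots t ht).2.1),
    mul_left_comm, mul_sub (p - p₀), mul_one_div_cancel (sub_ne_zero.2 hpp)]

lemma tendsto_sub_mul_fibreTrace (h : IsFibre d 𝓐 𝓑 p₀ ρ ν P) {R : ℂ → ℂ} {α β : Fin n → ℂ}
    (hα : ∀ i, ν i = 1 → α i = 0)
    (hR : ∀ i, ∃ l, Filter.Tendsto (fun t => R t - (α i / (t - ρ i) ^ 2 + β i / (t - ρ i)))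
      (nhdsWithin (ρ i) {ρ i}ᶜ) (nhds l)) :
    Filter.Tendsto (fun p => (p - p₀) * fibreTrace 𝓐 𝓑 R p) (nhdsWithin p₀ {p₀}ᶜ)
      (nhds (∑ i, β i)) := by
  set Q : Fin n → ℂ → ℂ := fun i t => α i / (t - ρ i) ^ 2 + β i / (t - ρ i)
  have hregular : Filter.Tendsto
      (fun p => (p - p₀) * fibreTrace 𝓐 𝓑 (fun t => R t - ∑ i, Q i t) p)
      (nhdsWithin p₀ {p₀}ᶜ) (nhds 0) := by
    refine h.tendsto_sub_mul_fibreTrace_zero fun j => ?_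
    obtain ⟨l, hl⟩ := hR j
    have hother : ContinuousAt (fun t => ∑ i ∈ Finset.univ.erase j, Q i t) (ρ j) := by
      refine tendsto_finsetSum _ fun i hi => ?_
      have hne : ρ j - ρ i ≠ 0 := sub_ne_zero.2 (h.injective.ne (Finset.ne_of_mem_erase hi).symm)
      have hne2 := pow_ne_zero 2 hne
      exact ContinuousAt.add (ContinuousAt.div (by fun_prop) (by fun_prop) hne2)
        (ContinuousAt.div (by fun_prop) (by fun_prop) hne)
    refine ⟨_, (hl.sub (hother.tendsto.mono_left nhdsWithin_le_nhds)).congr fun t => ?_⟩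
    rw [← Finset.add_sum_erase _ _ (Finset.mem_univ j), sub_sub]
  have hpolar := tendsto_finsetSum Finset.univ fun i _ =>
    h.tendsto_sub_mul_fibreTrace_polarPart (hα i) (β i)
  refine ((zero_add (∑ i, β i)) ▸ hregular.add hpolar).congr fun p => ?_
  rw [← Finset.mul_sum, ← mul_add, ← fibreTrace_sum, ← fibreTrace_add]
  simp only [Q, sub_add_cancel]

lemma tendsto_sub_mul_rootSum (h : IsFibre d 𝓐 𝓑 p₀ ρ ν P) (κ : ℂ) :
    Filter.Tendsto (fun p => (p - p₀) * rootSum d κ 𝓐 𝓑 p) (nhdsWithin p₀ {p₀}ᶜ)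
      (nhds (∑ i, fibreResidue d (ν i) κ p₀ 𝓑 (P i) (ρ i) / 6)) := by
  choose α hα hlim using fun i => exists_tendsto_traceForm_sub d κ (h.factor i)
    (h.mult_ne_zero i) (h.eval_ne i) (h.eval_right_ne i)
  refine (h.tendsto_sub_mul_fibreTrace hα hlim).congr' ?_
  filter_upwards [h.eventually_simple_roots fun _ => Filter.Eventually.of_forall fun _ => trivial]
    with p hp
  obtain ⟨-, -, hroots⟩ := hp
  refine congrArg _ (Finset.sum_congr rfl fun t ht => ?_)
  have ht0 := Polynomial.isRoot_of_mem_roots (Multiset.mem_toFinset.1 ht)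
  rw [traceForm, paramOf_eq_of_eval_eq_zero ht0 (hroots t ht0).1]

end IsFibre

end FibreTrace

/-! ### Existence of the branches -/

section ExistenceOfBranches

variable {d : ℕ} {𝓐 𝓑 : Polynomial ℂ}

lemma eq_C_coeff_mul_prod_of_eval_eq_zero {f : Polynomial ℂ} (hf : f.natDegree ≤ d)
    (hd : f.coeff d ≠ 0) {t : Fin d → ℂ} (ht : Function.Injective t)
    (h0 : ∀ s, f.eval (t s) = 0) :
    f = Polynomial.C (f.coeff d) * ∏ s, (Polynomial.X - Polynomial.C (t s)) := by
  have hdeg : f.natDegree = d := hf.antisymm (Polynomial.le_natDegree_of_ne_zero hd)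
  have hroots : f.roots = (Finset.univ.map ⟨t, ht⟩).val := by
    refine Polynomial.roots_eq_of_natDegree_le_card_of_ne_zero (fun x hx => ?_) ?_ fun h => ?_
    · obtain ⟨s, -, rfl⟩ := Finset.mem_map.1 hx
      exact h0 s
    · simp [hdeg]
    · exact hd (by rw [h, Polynomial.coeff_zero])
  have h := (IsAlgClosed.splits f).eq_prod_roots
  rwa [hroots, Polynomial.leadingCoeff, hdeg, Finset.prod_map_val, Finset.prod_map] at h

lemma deriv_paramOf_ne_zero {p₁ t₁ : ℂ} (h0 : (𝓐 + Polynomial.C p₁ * 𝓑).eval t₁ = 0)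
    (hB : 𝓑.eval t₁ ≠ 0) (h1 : (𝓐 + Polynomial.C p₁ * 𝓑).derivative.eval t₁ ≠ 0) :
    deriv (paramOf 𝓐 𝓑) t₁ ≠ 0 := by
  have h : HasDerivAt (paramOf 𝓐 𝓑) _ t₁ := (𝓐.hasDerivAt t₁).neg.div (𝓑.hasDerivAt t₁) hB
  rw [h.deriv]
  refine div_ne_zero (fun h => h1 (mul_right_cancel₀ hB ?_)) (pow_ne_zero 2 hB)
  rw [eval_add_C_mul] at h0
  simp only [Polynomial.derivative_add, Polynomial.derivative_C_mul, Polynomial.eval_add,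
    Polynomial.eval_mul, Polynomial.eval_C, Pi.neg_apply] at h ⊢
  linear_combination 𝓑.derivative.eval t₁ * h0 - h

lemma exists_analyticAt_root {p₁ t₁ : ℂ} (h0 : (𝓐 + Polynomial.C p₁ * 𝓑).eval t₁ = 0)
    (hB : 𝓑.eval t₁ ≠ 0) (h1 : (𝓐 + Polynomial.C p₁ * 𝓑).derivative.eval t₁ ≠ 0) :
    ∃ τ : ℂ → ℂ, AnalyticAt ℂ τ p₁ ∧ τ p₁ = t₁ ∧
      ∀ᶠ p in nhds p₁, (𝓐 + Polynomial.C p * 𝓑).eval (τ p) = 0 := by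
  have hg : AnalyticAt ℂ (paramOf 𝓐 𝓑) t₁ := analyticAt_paramOf hB
  have hd := deriv_paramOf_ne_zero h0 hB h1
  have hτ := hg.analyticAt_localInverse hd
  have hτ1 : hg.hasStrictDerivAt.localInverse _ _ _ hd (paramOf 𝓐 𝓑 t₁) = t₁ :=
    HasStrictFDerivAt.localInverse_apply_image ..
  have hright := HasStrictDerivAt.eventually_right_inverse hg.hasStrictDerivAt hd
  rw [paramOf_eq_of_eval_eq_zero h0 hB] at hτ hτ1 hright
  refine ⟨_, hτ, hτ1, ?_⟩
  have hBτ := (𝓑.continuous.continuousAt.comp hτ.continuousAt).eventually_ne (by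
    rwa [Function.comp_apply, hτ1])
  filter_upwards [hright, hBτ] with p hp hBp
  rw [Function.comp_apply] at hBp
  rw [paramOf, div_eq_iff hBp] at hp
  rw [eval_add_C_mul]
  linear_combination -hp

lemma eventually_injective {ι : Type*} [Finite ι] {τ : ι → ℂ → ℂ} {p₁ : ℂ}
    (hτ : ∀ i, ContinuousAt (τ i) p₁) (h : Function.Injective fun i => τ i p₁) :
    ∀ᶠ p in nhds p₁, Function.Injective fun i => τ i p := by
  have hne : ∀ᶠ p in nhds p₁, ∀ i j, i ≠ j → τ i p ≠ τ j p :=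
    Filter.eventually_all.2 fun i => Filter.eventually_all.2 fun j =>
      Filter.eventually_imp_distrib_left.2 fun hij => (hτ i).ne_iff_eventually_ne (hτ j) |>.1
        (h.ne hij)
  exact hne.mono fun p hp i j hij => by_contra fun hne => hp i j hne hij

lemma exists_isBranches (hA : 𝓐.natDegree ≤ d) (hB : 𝓑.natDegree ≤ d) {p₁ : ℂ}
    (hc : 𝓐.coeff d + p₁ * 𝓑.coeff d ≠ 0)
    (hroot : ∀ t, (𝓐 + Polynomial.C p₁ * 𝓑).eval t = 0 →
      𝓑.eval t ≠ 0 ∧ (𝓐 + Polynomial.C p₁ * 𝓑).derivative.eval t ≠ 0) :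
    ∃ V τ, IsBranches d 𝓐 𝓑 V τ ∧ p₁ ∈ V := by
  have hcard : (𝓐 + Polynomial.C p₁ * 𝓑).roots.toFinset.card = d :=
    (card_roots_toFinset (IsAlgClosed.splits _)
      (separable_of_forall_root fun t ht => (hroot t ht).2)).trans
      (natDegree_add_C_mul_eq hA hB hc)
  set t := (Finset.equivFinOfCardEq hcard).symm
  have ht0 (r : Fin d) : (𝓐 + Polynomial.C p₁ * 𝓑).eval ↑(t r) = 0 :=
    Polynomial.isRoot_of_mem_roots (Multiset.mem_toFinset.1 (t r).2)
  choose τ hτ hτ1 hτ0 using fun r => exists_analyticAt_root (ht0 r) (hroot _ (ht0 r)).1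
    (hroot _ (ht0 r)).2
  have hinj : ∀ᶠ p in nhds p₁, Function.Injective fun r => τ r p :=
    eventually_injective (fun r => (hτ r).continuousAt) (by
      simp only [hτ1]
      exact Subtype.val_injective.comp t.injective)
  have hlead : ∀ᶠ p in nhds p₁, 𝓐.coeff d + p * 𝓑.coeff d ≠ 0 :=
    ContinuousAt.eventually_ne (by fun_prop) hc
  obtain ⟨V, hV, hVo, hpV⟩ := eventually_nhds_iff.1 <| hinj.and <| hlead.and <|
    (Filter.eventually_all.2 fun r => (hτ r).eventually_analyticAt).and
      (Filter.eventually_all.2 hτ0)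
  refine ⟨V, τ, ⟨hVo, fun r p hp => ((hV p hp).2.2.1 r).differentiableAt.differentiableWithinAt,
    fun p hp => (hV p hp).1, fun p hp => (hV p hp).2.1, fun p hp => ?_⟩, hpV⟩
  obtain ⟨hinj, hlead, -, hτ0⟩ := hV p hp
  rw [← coeff_add_C_mul] at hlead ⊢
  exact eq_C_coeff_mul_prod_of_eval_eq_zero (natDegree_add_C_mul_le hA hB p) hlead hinj hτ0

lemma IsFibre.eventually_isBranches {n : ℕ} {p₀ : ℂ} {ρ : Fin n → ℂ} {ν : Fin n → ℕ}
    {P : Fin n → Polynomial ℂ} (h : IsFibre d 𝓐 𝓑 p₀ ρ ν P) :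
    ∀ᶠ p in nhdsWithin p₀ {p₀}ᶜ, ∃ V τ, IsBranches d 𝓐 𝓑 V τ ∧ p ∈ V := by
  filter_upwards [h.eventually_simple_roots fun _ => Filter.Eventually.of_forall fun _ => trivial]
    with p hp
  obtain ⟨-, hc, hroot⟩ := hp
  exact exists_isBranches h.natDegree_left h.natDegree_right hc fun t ht =>
    ⟨(hroot t ht).1, (hroot t ht).2.1⟩

end ExistenceOfBranches

/-! ### Holomorphic extension of the curvature -/

section SimplePole

variable {r : ℂ → ℂ} {p₀ L : ℂ}

lemma exists_analyticAt_eq_sub_mul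
    (hr : ∀ᶠ p in nhdsWithin p₀ {p₀}ᶜ, DifferentiableAt ℂ r p)
    (hL : Filter.Tendsto (fun p => (p - p₀) * r p) (nhdsWithin p₀ {p₀}ᶜ) (nhds L)) :
    ∃ f, AnalyticAt ℂ f p₀ ∧ f p₀ = L ∧ ∀ p ≠ p₀, f p = (p - p₀) * r p := by
  classical
  refine ⟨Function.update (fun p => (p - p₀) * r p) p₀ L,
    Complex.analyticAt_of_differentiable_on_punctured_nhds_of_continuousAt ?_
      (continuousAt_update_same.2 hL), Function.update_self .., fun p hp =>
    Function.update_of_ne hp _ _⟩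
  filter_upwards [hr, self_mem_nhdsWithin] with p hrp hp
  have hdiff : DifferentiableAt ℂ (fun p => (p - p₀) * r p) p := by fun_prop
  refine hdiff.congr_of_eventuallyEq ?_
  filter_upwards [isOpen_ne.mem_nhds hp] with x hx using Function.update_of_ne hx _ _

lemma eq_zero_of_tendsto_deriv {l : ℂ}
    (hr : ∀ᶠ p in nhdsWithin p₀ {p₀}ᶜ, DifferentiableAt ℂ r p)
    (hL : Filter.Tendsto (fun p => (p - p₀) * r p) (nhdsWithin p₀ {p₀}ᶜ) (nhds L))
    (hl : Filter.Tendsto (deriv r) (nhdsWithin p₀ {p₀}ᶜ) (nhds l)) : L = 0 := by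
  obtain ⟨f, hf, -, hfr⟩ := exists_analyticAt_eq_sub_mul hr hL
  have hsub : Filter.Tendsto (fun p : ℂ => p - p₀) (nhdsWithin p₀ {p₀}ᶜ) (nhds 0) :=
    tendsto_sub_nhds_zero_iff.2 (Filter.tendsto_id.mono_left nhdsWithin_le_nhds)
  have hsub_deriv := hsub.mul (hf.deriv.continuousAt.tendsto.mono_left
    (nhdsWithin_le_nhds (s := {p₀}ᶜ)))
  have hderiv : (fun p => (p - p₀) * deriv f p) =ᶠ[nhdsWithin p₀ {p₀}ᶜ]
      fun p => (p - p₀) * r p + (p - p₀) ^ 2 * deriv r p := by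
    filter_upwards [hr, self_mem_nhdsWithin] with p hrp hp
    have hfp : f =ᶠ[nhds p] fun p => (p - p₀) * r p := by
      filter_upwards [isOpen_ne.mem_nhds hp] with x hx using hfr x hx
    rw [hfp.deriv_eq, (((hasDerivAt_id' p).sub_const p₀).fun_mul hrp.hasDerivAt).deriv]
    ring
  simpa using tendsto_nhds_unique (hL.add ((hsub.pow 2).mul hl)) (hsub_deriv.congr' hderiv)

lemma exists_analyticAt_eq_of_tendsto_zero
    (hr : ∀ᶠ p in nhdsWithin p₀ {p₀}ᶜ, DifferentiableAt ℂ r p)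
    (hL : Filter.Tendsto (fun p => (p - p₀) * r p) (nhdsWithin p₀ {p₀}ᶜ) (nhds 0)) :
    ∃ s, AnalyticAt ℂ s p₀ ∧ ∀ p ≠ p₀, s p = r p := by
  obtain ⟨f, ⟨φ, hφ⟩, hf0, hfr⟩ := exists_analyticAt_eq_sub_mul hr hL
  refine ⟨dslope f p₀, hφ.has_fpower_series_dslope_fslope.analyticAt, fun p hp => ?_⟩
  rw [dslope_of_ne _ hp, slope_def_field, hf0, sub_zero, hfr p hp,
    mul_div_cancel_left₀ _ (sub_ne_zero.2 hp)]

end SimplePole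

section Holomorphy

variable {d : ℕ} {F : SymForm} {p₀ L : ℂ} {r : ℂ → ℂ}

lemma CurvatureHolomorphicAlong.exists_ne_zero
    (h : CurvatureHolomorphicAlong d F {z : ℂ × ℂ | z.1 = p₀}) :
    ∃ q ≠ 0, CurvatureHolomorphicAt d F (p₀, q) := by
  have hfin : {q : ℂ | ¬ CurvatureHolomorphicAt d F (p₀, q)}.Finite :=
    (h.preimage (Prod.mk_right_injective p₀).injOn).subset fun q hq => ⟨rfl, hq⟩
  obtain ⟨q, hq⟩ := (hfin.union (Set.finite_singleton 0)).infinite_compl.nonempty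
  rw [Set.compl_union] at hq
  exact ⟨q, hq.2, not_not.1 hq.1⟩

/-- Near the line `p = p₀`, away from it and from the line `q = 0`, the web of `F` is regular and
its curvature is `-r'(p) / q dp ∧ dq`. -/
def IsCurvaturePotential (d : ℕ) (F : SymForm) (p₀ : ℂ) (r : ℂ → ℂ) : Prop :=
  ∀ᶠ p in nhdsWithin p₀ {p₀}ᶜ, DifferentiableAt ℂ r p ∧ ∀ q, q ≠ 0 →
    (p, q) ∉ discriminantLocus d F ∧ ∀ k, IsCurvatureAt d F (p, q) k ↔ k = -deriv r p / q

namespace IsCurvaturePotential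

lemma eq_zero_of_curvatureHolomorphicAt (hr : IsCurvaturePotential d F p₀ r)
    (hL : Filter.Tendsto (fun p => (p - p₀) * r p) (nhdsWithin p₀ {p₀}ᶜ) (nhds L)) {q : ℂ}
    (hq : q ≠ 0) (hhol : CurvatureHolomorphicAt d F (p₀, q)) : L = 0 := by
  obtain ⟨N, hN, hmem, g, hg, hcurv⟩ := hhol
  have hline : Filter.Tendsto (fun p : ℂ => (p, q)) (nhdsWithin p₀ {p₀}ᶜ) (nhds (p₀, q)) :=
    (Continuous.tendsto (by fun_prop) p₀).mono_left nhdsWithin_le_nhds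
  have hlim := (((hg _ hmem).continuousAt.tendsto.comp hline).const_mul q).neg
  refine eq_zero_of_tendsto_deriv (hr.mono fun p hp => hp.1) hL (hlim.congr' ?_)
  filter_upwards [hr, hline (hN.mem_nhds hmem)] with p hp hpN
  obtain ⟨hreg, hk⟩ := hp.2 q hq
  rw [Function.comp_apply, (hk _).1 (hcurv _ ⟨hpN, hreg⟩), mul_div_cancel₀ _ hq, neg_neg]

lemma curvatureHolomorphicAt (hr : IsCurvaturePotential d F p₀ r)
    (hL : Filter.Tendsto (fun p => (p - p₀) * r p) (nhdsWithin p₀ {p₀}ᶜ) (nhds 0))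
    (hD : {z : ℂ × ℂ | z.1 = p₀} ⊆ discriminantLocus d F) {q : ℂ} (hq : q ≠ 0) :
    CurvatureHolomorphicAt d F (p₀, q) := by
  obtain ⟨s, hs, hsr⟩ := exists_analyticAt_eq_of_tendsto_zero (hr.mono fun p hp => hp.1) hL
  obtain ⟨U, hU, hUo, hpU⟩ := eventually_nhds_iff.1
    ((eventually_nhdsWithin_iff.1 hr).and hs.eventually_analyticAt)
  refine ⟨{z | z.1 ∈ U ∧ z.2 ≠ 0}, (hUo.preimage continuous_fst).inter
    (isOpen_ne.preimage continuous_snd), ⟨hpU, hq⟩, fun z => -deriv s z.1 / z.2,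
    fun z hz => ?_, ?_⟩
  · have hderiv : AnalyticAt ℂ (fun z : ℂ × ℂ => deriv s z.1) z :=
      AnalyticAt.fun_comp (f := fun z : ℂ × ℂ => z.1) (hU _ hz.1).2.deriv analyticAt_fst
    exact hderiv.neg.div analyticAt_snd hz.2
  · rintro ⟨x, y⟩ ⟨⟨hx, hy⟩, hreg⟩
    have hxp : x ≠ p₀ := fun h0 => hreg (hD h0)
    have hsx : s =ᶠ[nhds x] r := by
      filter_upwards [isOpen_ne.mem_nhds hxp] with w hw using hsr w hw
    refine ((((hU x hx).1 hxp).2 y hy).2 _).2 ?_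
    simp only [hsx.deriv_eq]

lemma curvatureHolomorphicAlong_iff (hr : IsCurvaturePotential d F p₀ r)
    (hL : Filter.Tendsto (fun p => (p - p₀) * r p) (nhdsWithin p₀ {p₀}ᶜ) (nhds L))
    (hD : {z : ℂ × ℂ | z.1 = p₀} ⊆ discriminantLocus d F) :
    CurvatureHolomorphicAlong d F {z : ℂ × ℂ | z.1 = p₀} ↔ L = 0 := by
  constructor
  · intro h
    obtain ⟨q, hq, hhol⟩ := h.exists_ne_zero
    exact hr.eq_zero_of_curvatureHolomorphicAt hL hq hhol
  · rintro rfl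
    refine (Set.finite_singleton ((p₀, 0) : ℂ × ℂ)).subset ?_
    rintro ⟨_, q⟩ ⟨rfl, hnot⟩
    have hq : q = 0 := by_contra fun hq => hnot (hr.curvatureHolomorphicAt hL hD hq)
    rw [hq, Set.mem_singleton_iff]

end IsCurvaturePotential

lemma IsFibre.isCurvaturePotential_rootSum {A B : MvPolynomial (Fin 2) ℂ} {n : ℕ} {κ : ℂ}
    {ρ : Fin n → ℂ} {ν : Fin n → ℕ} {P : Fin n → Polynomial ℂ} (hd : 2 ≤ d)
    (hA : A.IsHomogeneous d) (hB : B.IsHomogeneous d)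
    (h : IsFibre d (dehom κ A) (dehom κ B) p₀ ρ ν P) :
    IsCurvaturePotential d (legForm A B) p₀ (rootSum d κ (dehom κ A) (dehom κ B)) := by
  filter_upwards [h.eventually_isBranches] with p hp
  obtain ⟨V, τ, hτ, hpV⟩ := hp
  have hsum : rootSum d κ (dehom κ A) (dehom κ B) =ᶠ[nhds p]
      fun p => (d * (d - 1) * (d - 2) / 2 : ℂ) - branchSum κ τ p := by
    filter_upwards [hτ.isOpen.mem_nhds hpV] with x hx
    rw [hτ.branchSum_eq hd hx]
    ring
  have hderiv : -deriv (rootSum d κ (dehom κ A) (dehom κ B)) p = deriv (branchSum κ τ) p := by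
    rw [hsum.deriv_eq, deriv_const_sub, neg_neg]
  refine ⟨((hτ.differentiableAt_branchSum κ hpV).const_sub _).congr_of_eventuallyEq hsum,
    fun q hq => ⟨notMem_discriminantLocus (by omega) hA hB hτ hpV hq, fun k => ?_⟩⟩
  rw [hderiv]
  refine ⟨fun hk => hk.eq_deriv_branchSum hd hA hB hτ hpV hq, ?_⟩
  rintro rfl
  exact isCurvatureAt_deriv_branchSum (z := (p, q)) hd hA hB hτ hpV hq

end Holomorphy

/-! ### The fibre over the line -/

lemma mk_eq_mk_iff_mul_eq_mul {K : Type*} [Field K] {a b c e : K} (hab : ![a, b] ≠ 0)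
    (hce : ![c, e] ≠ 0) :
    Projectivization.mk K ![a, b] hab = Projectivization.mk K ![c, e] hce ↔ a * e = c * b := by
  rw [Projectivization.mk_eq_mk_iff']
  constructor
  · rintro ⟨u, hu⟩
    have ha : u * c = a := congrFun hu 0
    have hb : u * e = b := congrFun hu 1
    rw [← ha, ← hb]
    ring
  · intro h
    rcases eq_or_ne c 0 with rfl | hc
    · have he : e ≠ 0 := by simpa using hce
      have ha : a = 0 := by simpa [he] using h
      exact ⟨b / e, by simp [ha, he]⟩
    · refine ⟨a / c, ?_⟩
      have hb : a / c * e = b := by rw [div_mul_eq_mul_div, h, mul_div_cancel_left₀ _ hc]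
      simp [hb, hc]

lemma exists_forall_add_mul_ne_zero {K ι : Type*} [Field K] [Infinite K] [Finite ι] {a b : ι → K}
    (hab : ∀ i, ![a i, b i] ≠ 0) : ∃ κ : K, ∀ i, b i + κ * a i ≠ 0 := by
  have hfin : (⋃ i, {κ : K | b i + κ * a i = 0}).Finite := by
    refine Set.finite_iUnion fun i => Set.Subsingleton.finite fun x hx y hy => ?_
    rw [Set.mem_ofPred_eq] at hx hy
    have ha : a i ≠ 0 := fun ha => hab i (by
      have hb : b i = 0 := by simpa [ha] using hx
      simp [ha, hb])
    exact mul_right_cancel₀ ha (by linear_combination hx - hy)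
  obtain ⟨κ, hκ⟩ := hfin.infinite_compl.nonempty
  exact ⟨κ, fun i hi => hκ (Set.mem_iUnion.2 ⟨i, hi⟩)⟩

section Fibre

variable {A B P : MvPolynomial (Fin 2) ℂ} {d ν : ℕ} {p κ a b : ℂ}

lemma eval_right_ne_zero (hA : A.IsHomogeneous d) (hB : B.IsHomogeneous d) (hAB : IsRelPrime A B)
    (hab : ![a, b] ≠ 0) (hz : eval ![b, a] (A + C p * B) = 0) : eval ![b, a] B ≠ 0 := by
  intro hB0
  rw [map_add, map_mul, hB0, mul_zero, add_zero] at hz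
  exact (eval_ne_zero_or_eval_ne_zero hA hB hAB hab).elim (· hz) (· hB0)

lemma exists_eq_lineForm_pow_ramificationIndex_mul (hd : d ≠ 0) (hA : A.IsHomogeneous d)
    (hB : B.IsHomogeneous d) (hAB : IsRelPrime A B) (hab : ![a, b] ≠ 0)
    (hp : gMap A B (Projectivization.mk ℂ ![a, b] hab) = P1.ofAffine p)
    (hν : ν = ramificationIndex (gMap A B) (Projectivization.mk ℂ ![a, b] hab)) :
    1 ≤ ν ∧ ν ≤ d ∧ ∃ P, P.IsHomogeneous (d - ν) ∧ A + C p * B = lineForm a b ^ ν * P ∧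
      eval ![b, a] P ≠ 0 := by
  have hz := (gMap_mk_eq_ofAffine_iff hA hB hAB hab).1 hp
  have hG : (A + C p * B).IsHomogeneous d := hA.add (hB.C_mul p)
  obtain ⟨m, hm, P, hPh, hP, hP0⟩ :=
    exists_eq_lineForm_pow_mul hG (add_C_mul_ne_zero hd hB hAB p) hab
  obtain rfl : ν = m := hν.trans
    (ramificationIndex_eq hA hB hAB hab hp (eval_right_ne_zero hA hB hAB hab hz) hPh hP hP0)
  refine ⟨Nat.one_le_iff_ne_zero.2 fun h0 => hP0 ?_, hm, P, hPh, hP, hP0⟩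
  rwa [hP, h0, pow_zero, one_mul] at hz

lemma polyP_polyQ_ramificationIndex (hd : d ≠ 0) (hA : A.IsHomogeneous d)
    (hB : B.IsHomogeneous d) (hAB : IsRelPrime A B) (hab : ![a, b] ≠ 0)
    (hp : gMap A B (Projectivization.mk ℂ ![a, b] hab) = P1.ofAffine p)
    (hν : ν = ramificationIndex (gMap A B) (Projectivization.mk ℂ ![a, b] hab)) :
    1 ≤ ν ∧ ν ≤ d ∧ polyP A B a b ν * lineForm a b ^ ν = numP A B a b ∧
      (polyP A B a b ν).IsHomogeneous (d - ν) ∧ (polyQ A B a b ν).IsHomogeneous (2 * d - ν - 1) ∧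
      eval ![b, a] (polyP A B a b ν) ≠ 0 ∧ eval ![b, a] B ≠ 0 := by
  obtain ⟨hν1, hνd, P, hPh, hP, hP0⟩ :=
    exists_eq_lineForm_pow_ramificationIndex_mul hd hA hB hAB hab hp hν
  have hz := (gMap_mk_eq_ofAffine_iff hA hB hAB hab).1 hp
  have hB0 := eval_right_ne_zero hA hB hAB hab hz
  have hpoly := polyP_eq hab hz hP
  have hpolyh : (polyP A B a b ν).IsHomogeneous (d - ν) := hpoly ▸ hPh.C_mul _
  refine ⟨hν1, hνd, ?_, hpolyh, polyQ_isHomogeneous hA hB hνd hpolyh, ?_, hB0⟩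
  · rw [hpoly, numP_eq hz, hP]
    ring
  · rw [hpoly, map_mul, eval_C]
    exact mul_ne_zero hB0 hP0

lemma add_C_mul_eq_lineForm_pow_mul (hz : eval ![b, a] (A + C p * B) = 0)
    (hB0 : eval ![b, a] B ≠ 0) (hP : P * lineForm a b ^ ν = numP A B a b) :
    A + C p * B = lineForm a b ^ ν * (C (eval ![b, a] B)⁻¹ * P) := by
  rw [numP_eq hz] at hP
  rw [mul_left_comm, mul_comm _ P, hP, ← mul_assoc, ← C_mul, inv_mul_cancel₀ hB0, C_1, one_mul]

lemma dehom_add_C_mul_eq (hl : b + κ * a ≠ 0) (hP : A + C p * B = lineForm a b ^ ν * P) :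
    dehom κ A + Polynomial.C p * dehom κ B =
      (Polynomial.X - Polynomial.C (a / (b + κ * a))) ^ ν *
        (Polynomial.C ((b + κ * a) ^ ν) * dehom κ P) := by
  have hline : Polynomial.C (b + κ * a) * Polynomial.X - Polynomial.C a =
      Polynomial.C (b + κ * a) * (Polynomial.X - Polynomial.C (a / (b + κ * a))) := by
    rw [mul_sub, ← Polynomial.C_mul, mul_div_cancel₀ _ hl]
  have h := congrArg (dehom κ) hP
  rw [map_add, map_mul, map_mul, map_pow, dehom_C, dehom_lineForm, hline, mul_pow] at h
  rw [h, Polynomial.C_pow]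
  ring

lemma eval_dehom_ne_zero {G : MvPolynomial (Fin 2) ℂ} (hG : G.IsHomogeneous d)
    (hl : b + κ * a ≠ 0) (h : eval ![b, a] G ≠ 0) :
    (dehom κ G).eval (a / (b + κ * a)) ≠ 0 := by
  rw [eval_eq_pow_mul_eval_dehom hG hl] at h
  exact right_ne_zero_of_mul h

lemma exists_mul_eq_mul_of_fiber_eq_range {n : ℕ} {a b : Fin n → ℂ} (hA : A.IsHomogeneous d)
    (hB : B.IsHomogeneous d) (hAB : IsRelPrime A B) (hab : ∀ i, ![a i, b i] ≠ 0)
    (hfiber : gMap A B ⁻¹' {P1.ofAffine p} =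
      Set.range fun i => Projectivization.mk ℂ ![a i, b i] (hab i))
    {x y : ℂ} (hxy : ![y, x] ≠ 0) (h : eval ![x, y] (A + C p * B) = 0) :
    ∃ i, a i * x = y * b i := by
  obtain ⟨i, hi⟩ := hfiber.le ((gMap_mk_eq_ofAffine_iff hA hB hAB hxy).2 h)
  exact ⟨i, (mk_eq_mk_iff_mul_eq_mul (hab i) hxy).1 hi⟩

lemma isFibre_dehom {n : ℕ} {a b : Fin n → ℂ} {ν : Fin n → ℕ} (hd : d ≠ 0)
    (hA : A.IsHomogeneous d) (hB : B.IsHomogeneous d) (hAB : IsRelPrime A B)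
    (hab : ∀ i, ![a i, b i] ≠ 0)
    (hinj : Function.Injective fun i => Projectivization.mk ℂ ![a i, b i] (hab i))
    (hfiber : gMap A B ⁻¹' {P1.ofAffine p} =
      Set.range fun i => Projectivization.mk ℂ ![a i, b i] (hab i))
    (hν : ∀ i, ν i = ramificationIndex (gMap A B) (Projectivization.mk ℂ ![a i, b i] (hab i)))
    (hκ : ∀ i, b i + κ * a i ≠ 0) :
    IsFibre d (dehom κ A) (dehom κ B) p (fun i => a i / (b i + κ * a i)) ν fun i =>
      Polynomial.C ((b i + κ * a i) ^ ν i * (eval ![b i, a i] B)⁻¹) *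
        dehom κ (polyP A B (a i) (b i) (ν i)) := by
  have hp i := hfiber.ge ⟨i, rfl⟩
  have hP i := polyP_polyQ_ramificationIndex hd hA hB hAB (hab i) (hp i) (hν i)
  choose hν1 _ hnum hPh _ hP0 hB0 using hP
  have hroot {x y : ℂ} (hxy : ![y, x] ≠ 0) (h : eval ![x, y] (A + C p * B) = 0) :=
    exists_mul_eq_mul_of_fiber_eq_range hA hB hAB hab hfiber hxy h
  refine ⟨natDegree_dehom_le hA, natDegree_dehom_le hB, fun h => ?_, fun i j hij => hinj ?_,
    fun i => Nat.one_le_iff_ne_zero.1 (hν1 i), fun i => ?_, fun i => ?_,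
    fun i => eval_dehom_ne_zero hB (hκ i) (hB0 i), fun t ht => ?_⟩
  · rw [coeff_dehom hA, coeff_dehom hB] at h
    obtain ⟨i, hi⟩ := hroot (x := -κ) (y := 1) (by simp) (by simpa using h)
    exact hκ i (by linear_combination -hi)
  · rw [div_eq_div_iff (hκ i) (hκ j)] at hij
    exact (mk_eq_mk_iff_mul_eq_mul (hab i) (hab j)).2 (by linear_combination hij)
  · have hz := (gMap_mk_eq_ofAffine_iff hA hB hAB (hab i)).1 (hp i)
    rw [dehom_add_C_mul_eq (hκ i) (add_C_mul_eq_lineForm_pow_mul hz (hB0 i) (hnum i)), map_mul,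
      dehom_C, ← mul_assoc (Polynomial.C _), ← Polynomial.C_mul]
  · rw [Polynomial.eval_mul, Polynomial.eval_C]
    exact mul_ne_zero (mul_ne_zero (pow_ne_zero _ (hκ i)) (inv_ne_zero (hB0 i)))
      (eval_dehom_ne_zero (hPh i) (hκ i) (hP0 i))
  · rw [← dehom_C κ p, ← map_mul, ← map_add, eval_dehom] at ht
    have hne : ![t, 1 - κ * t] ≠ 0 := fun h0 => by
      have h1 : t = 0 := congrFun h0 0
      simpa [h1] using congrFun h0 1
    obtain ⟨i, hi⟩ := hroot hne ht
    exact ⟨i, (div_eq_iff (hκ i)).2 (by linear_combination hi)⟩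

end Fibre

end HomogeneousWeb

open HomogeneousWeb in
theorem theorem3p1 (d : ℕ) (hd : 3 ≤ d)
    (A B : MvPolynomial (Fin 2) ℂ) (hA : A.IsHomogeneous d) (hB : B.IsHomogeneous d)
    (hAB : IsRelPrime A B)
    (p₀ : ℂ) (hD : {z : ℂ × ℂ | z.1 = p₀} ⊆ discriminantLocus d (legForm A B))
    (n : ℕ) (a b : Fin n → ℂ) (hab : ∀ i, ![a i, b i] ≠ 0)
    (hinj : Function.Injective fun i => Projectivization.mk ℂ ![a i, b i] (hab i))
    (hfiber : gMap A B ⁻¹' {P1.ofAffine p₀} =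
      Set.range fun i => Projectivization.mk ℂ ![a i, b i] (hab i))
    (ν : Fin n → ℕ)
    (hν : ∀ i, ν i = ramificationIndex (gMap A B) (Projectivization.mk ℂ ![a i, b i] (hab i))) :
    (∀ i, 1 ≤ ν i ∧ ν i ≤ d ∧
      polyP A B (a i) (b i) (ν i) * lineForm (a i) (b i) ^ ν i = numP A B (a i) (b i) ∧
      (polyP A B (a i) (b i) (ν i)).IsHomogeneous (d - ν i) ∧
      (polyQ A B (a i) (b i) (ν i)).IsHomogeneous (2 * d - ν i - 1) ∧
      MvPolynomial.eval ![b i, a i] (polyP A B (a i) (b i) (ν i)) ≠ 0 ∧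
      MvPolynomial.eval ![b i, a i] B ≠ 0) ∧
    (CurvatureHolomorphicAlong d (legForm A B) {z : ℂ × ℂ | z.1 = p₀} ↔
      ∑ i, (1 - 1 / (ν i : ℂ)) *
        ((p₀ * b i - a i) * MvPolynomial.eval ![b i, a i] (polyQ A B (a i) (b i) (ν i)) /
          (MvPolynomial.eval ![b i, a i] (polyP A B (a i) (b i) (ν i)) *
            MvPolynomial.eval ![b i, a i] B)) = 0) := by
  have hp i := hfiber.ge ⟨i, rfl⟩
  have hP i := polyP_polyQ_ramificationIndex (by omega) hA hB hAB (hab i) (hp i) (hν i)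
  refine ⟨hP, ?_⟩
  obtain ⟨κ, hκ⟩ := exists_forall_add_mul_ne_zero hab
  have hF := isFibre_dehom (by omega) hA hB hAB hab hinj hfiber hν hκ
  rw [(hF.isCurvaturePotential_rootSum (by omega) hA hB).curvatureHolomorphicAlong_iff
    (hF.tendsto_sub_mul_rootSum κ) hD, ← Finset.sum_div, div_eq_zero_iff, or_iff_left (by norm_num)]
  refine Eq.congr (Finset.sum_congr rfl fun i _ => ?_) rfl
  obtain ⟨hν1, hνd, hnum, hPh, -, hP0, hB0⟩ := hP i
  have hz := (gMap_mk_eq_ofAffine_iff hA hB hAB (hab i)).1 (hp i)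
  rw [fibreResidue_C_mul _ _ _ (mul_ne_zero (pow_ne_zero _ (hκ i)) (inv_ne_zero hB0))]
  exact (criterion_term_eq_fibreResidue hB hν1 hνd hPh
    (add_C_mul_eq_lineForm_pow_mul hz hB0 hnum) hP0 hB0 (hκ i)).symm
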